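/- Let $\mathfrak g=\mathfrak{gl}_{\mathbb R}(1/1)$ be the Lie superalgebra of real $2\times2$ matrices with even part the diagonal matrices, odd part $\mathfrak g_1$ spanned by $C=E_{12}$, $D=E_{21}$ (dual basis $C^*,D^*$ of $\mathfrak g_1^*$) and $[X,Y]=XY-(-1)^{|X||Y|}YX$, and let $G=(\mathbb R^\times)^2$ with coordinates $(z,w)$. An LRT Lie supergroup structure for $(G,\mathfrak g)$ is a representation $\rho$ of $\mathfrak g$ by superderivations on the sheaf $\mathcal C^\infty_G\otimes\Lambda\mathfrak g_1^*$ such that even $X_0$ act on functions $f\otimes 1$ by $(X_0.f)(g)=\frac{d}{dt}|_{0}f(g\exp(tX_0))$ and such that the sheaf of superfunctions killed by all of $\mathfrak g$ is the constant sheaf $\mathbb R$. An RRT structure is defined in the same way with $\frac{d}{dt}|_{0}f(\exp(-tX_0)g)$. An RT structure is a pair $(\rho_L,\rho_R)$ of an LRT and an RRT structure with $\rho_R(X)\rho_L(Y)=(-1)^{|X||Y|}\rho_L(Y)\rho_R(X)$. An LRT structure is planed if $X_0.\alpha=\alpha([\,\cdot\,,X_0])$ for $X_0\in\mathfrak g_0$,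 $\alpha\in 1\otimes\mathfrak g_1^*$. A morphism consists of a Lie group morphism $\psi$, an even morphism $\psi^\diamond$ of Lie superalgebras, and the pull-back $\psi^\#(\sum f_I\theta^I)=\sum(f_I\circ\psi)\,\psi^{\diamond*}(\theta^I)$, with $\rho_a(X)\circ\psi^\#=\psi^\#\circ\rho_b(\psi^\diamond(X))$ (for both representations in the RT case); it is an isomorphism if $(\psi,\psi^\#)$ is one. The Kostant–Koszul construction: identify $\mathcal C^\infty(U)\otimes\Lambda\mathfrak g_1^*$ by Koszul's splitting with the functionals $\Phi$ on $\mathbb R(U)\#E(\mathfrak g)$ that are smooth in $g$ and satisfy $\Phi(g\#X_0Z)=(X_0.\Phi(\cdot\,\#Z))(g)$ for $X_0\in\mathfrak g_0$; then $X$ acts by $(\rho_L(X)\Phi)(W)=(-1)^{|X|}\Phi(W\cdot(e\#X))$ and $(\rho_R(X)\Phi)(W)=-(-1)^{|X||\Phi|}\Phi((e\#X)\cdot W)$. The Berezin construction: continue superfunctions to the group $\widetilde G$ of invertible even supermatrices over $\Lambda\mathfrak g_1^*$ by Grassmann analytic continuation in the decomposition $\tilde g=h\exp\begin{pmatrix}0&\gamma\\\delta&0\end{pmatrix}$,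 $h$ even ($C^*\mapsto\gamma$, $D^*\mapsto\delta$, $C^*\wedge D^*\mapsto\delta\gamma$); then $X$ acts by $\rho_L(X)F=\frac{d}{dt}|_0F(\tilde g\exp(tX))$ for $X$ even and $(\rho_L(X)F)\,\alpha=\frac{d}{dt}|_0F(\tilde g\exp(t\alpha X))$ for $X$ and $\alpha$ odd, and $\rho_R$ is given in the same way by $\exp(-tX)\tilde g$, $\exp(-t\alpha X)\tilde g$. The essential constants of an LRT structure are the matrices $M_C=\begin{pmatrix}c^z_{C^*}&c^z_{D^*}\\c^w_{C^*}&c^w_{D^*}\end{pmatrix}$, $M_D$ (the same with $d$) and $M_1=\begin{pmatrix}c_1^{C^*}&c_1^{D^*}\\d_1^{C^*}&d_1^{D^*}\end{pmatrix}$ in $$C.z=c^z_{C^*}z^3w^{-2}C^*+c^z_{D^*}zD^*,\quad C.w=c^w_{C^*}z^2w^{-1}C^*+c^w_{D^*}wD^*,$$ $$D.z=d^z_{C^*}zC^*+d^z_{D^*}z^{-1}w^2D^*,\quad D.w=d^w_{C^*}wC^*+d^w_{D^*}z^{-2}w^3D^*,$$ the numerical parts of $C.C^*,\,C.D^*,\,D.C^*,\,D.D^*$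 being $c_1^{C^*},\ c_1^{D^*}z^2w^{-2},\ d_1^{C^*}z^{-2}w^2,\ d_1^{D^*}$. Theorem. (1) The constructions by Kostant–Koszul and by Berezin each define exactly one RT Lie supergroup structure for $(G,\mathfrak g)$. Both are planed. The essential constants $(M_C,M_D,M_1)$ of the first are $$(\mathbf{KK})\quad \begin{pmatrix}0&-\frac12\\0&-\frac12\end{pmatrix},\ \begin{pmatrix}-\frac12&0\\-\frac12&0\end{pmatrix},\ \begin{pmatrix}-1&0\\0&-1\end{pmatrix},$$ and those of the second are $$(\mathbf{Ber})\quad \begin{pmatrix}0&\frac12\\0&\frac12\end{pmatrix},\ \begin{pmatrix}\frac12&0\\\frac12&0\end{pmatrix},\ \begin{pmatrix}1&0\\0&1\end{pmatrix}.$$ (2) The two structures are isomorphic neither as LRT nor as RT Lie supergroups. (3) There is also a planed LRT structure with the constants $$(\mathbf{Ber}')\quad \begin{pmatrix}0&1\\0&0\end{pmatrix},\ \begin{pmatrix}0&0\\1&0\end{pmatrix},\ \begin{pmatrix}1&0\\0&1\end{pmatrix},$$ and no LRT structure with the constants $(\mathbf{KK})$ is isomorphic, among all LRT structures, to one with the constants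 $(\mathbf{Ber})$ or $(\mathbf{Ber}')$. (4) If two LRT structures for $(G,\mathfrak g)$ are isomorphic and one of them is planed, then so is the other. -/

import Mathlib

open scoped Manifold ContDiff
open TopologicalSpace

noncomputable section

namespace RTLie

/-! ### The exterior algebra on two generators, superfunctions -/

/-- The exterior (Grassmann) algebra over `R` on two generators: the algebra with `R`-basis
`1, i, j, k` and relations `i² = j² = 0`, `k = i j = - j i`, which is the fully degenerate
quaternion algebra. In all uses below `i` is `C*`, `j` is `D*` and `k` is `C* ∧ D*`, so the element
`⟨f, a, b, h⟩` is `f + a C* + b D* + h C* ∧ D*`. -/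
abbrev Gr (R : Type) [CommRing R] : Type := QuaternionAlgebra R 0 0 0

/-- The Lie group `(ℝˣ)²`, with coordinates `(z, w)`. -/
abbrev G : Type := ℝˣ × ℝˣ

/-- The model with corners of `(ℝˣ)²`. -/
abbrev IG : ModelWithCorners ℝ (ℝ × ℝ) (ModelProd ℝ ℝ) := 𝓘(ℝ, ℝ).prod 𝓘(ℝ, ℝ)

/-- Smooth real functions on the open set `U`. -/
abbrev Fn (U : Opens G) : Type := ContMDiffMap IG 𝓘(ℝ, ℝ) U ℝ ∞

/-- Superfunctions on the open set `U`: `C^∞(U) ⊗ Λ 𝔤₁*`. -/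
abbrev SF (U : Opens G) : Type := Gr (Fn U)

/-- Restriction of superfunctions. -/
def SF.restr {U V : Opens G} (h : V ≤ U) (F : SF U) : SF V :=
  let r := ContMDiffMap.restrictRingHom (n := ∞) IG 𝓘(ℝ, ℝ) ℝ h
  ⟨r F.re, r F.imI, r F.imJ, r F.imK⟩

/-- The value of a superfunction at a point, an element of `Λ 𝔤₁*`. -/
def SF.eval {U : Opens G} (F : SF U) (x : U) : Gr ℝ :=
  ⟨F.re x, F.imI x, F.imJ x, F.imK x⟩

/-- The superfunction `f ⊗ 1`. -/
def SF.fn {U : Opens G} (f : Fn U) : SF U := ⟨f, 0, 0, 0⟩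

/-- The constant superfunction `1 ⊗ (a C* + b D*)`. -/
def SF.cov (U : Opens G) (a b : ℝ) : SF U :=
  ⟨0, algebraMap ℝ (Fn U) a, algebraMap ℝ (Fn U) b, 0⟩

/-- The homogeneous part of parity `p` of an exterior algebra on two generators. -/
def grPart (R : Type) [CommRing R] (p : ZMod 2) : Set (Gr R) :=
  if p = 0 then {F | F.imI = 0 ∧ F.imJ = 0} else {F | F.re = 0 ∧ F.imK = 0}

/-- The sign `(-1)^{pq}`. -/
def sgn (p q : ZMod 2) : ℝ := if p = 1 ∧ q = 1 then -1 else 1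

/-! ### The Lie superalgebra `𝔤𝔩(1/1)` -/

/-- The underlying vector space of `𝔤𝔩_ℝ(1/1)`. -/
abbrev gl : Type := Matrix (Fin 2) (Fin 2) ℝ

/-- Diagonal matrices are even, antidiagonal ones are odd. -/
def glPart (p : ZMod 2) : Set gl :=
  if p = 0 then {X | X 0 1 = 0 ∧ X 1 0 = 0} else {X | X 0 0 = 0 ∧ X 1 1 = 0}

/-- The superbracket of homogeneous elements of parity `p` and `q`. -/
def sbr (p q : ZMod 2) (X Y : gl) : gl := X * Y - sgn p q • (Y * X)

def matC : gl := !![0, 1; 0, 0]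
def matD : gl := !![0, 0; 1, 0]

/-- `exp X` in `(ℝˣ)²` for an even (that is, diagonal) matrix `X`. -/
def expG (X : gl) : G :=
  (Units.mk0 (Real.exp (X 0 0)) (Real.exp_ne_zero _),
    Units.mk0 (Real.exp (X 1 1)) (Real.exp_ne_zero _))

/-- `(ℝˣ)²` as diagonal matrices. -/
def toMat (g : G) : gl := !![(g.1 : ℝ), 0; 0, (g.2 : ℝ)]

/-- Extension by zero of a function on `U`. -/
def ext0 {U : Opens G} (f : U → ℝ) (g : G) : ℝ :=
  open Classical in if h : g ∈ U then f ⟨g, h⟩ else 0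

/-- The left-invariant derivative `(X.f)(g) = d/dt f(g exp(tX))` at `t = 0`. -/
def leftD {U : Opens G} (X : gl) (f : U → ℝ) (g : G) : ℝ :=
  deriv (fun t : ℝ => ext0 f (g * expG (t • X))) 0

/-- The right-invariant derivative `d/dt f(exp(-tX) g)` at `t = 0`. -/
def rightD {U : Opens G} (X : gl) (f : U → ℝ) (g : G) : ℝ :=
  deriv (fun t : ℝ => ext0 f (expG (-(t • X)) * g)) 0

/-! ### Representation-theoretical Lie supergroups -/

/-- A representation of `𝔤𝔩(1/1)` by superderivations on the sheaf of superfunctions. -/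
@[ext]
structure SuperRep where
  op : ∀ U : Opens G, gl →ₗ[ℝ] (SF U →ₗ[ℝ] SF U)
  restr_op : ∀ (U V : Opens G) (h : V ≤ U) (X : gl) (F : SF U),
    SF.restr h (op U X F) = op V X (SF.restr h F)
  parity : ∀ (U : Opens G) (p q : ZMod 2), ∀ X ∈ glPart p, ∀ F ∈ grPart (Fn U) q,
    op U X F ∈ grPart (Fn U) (p + q)
  leibniz : ∀ (U : Opens G) (p q : ZMod 2), ∀ X ∈ glPart p, ∀ F ∈ grPart (Fn U) q, ∀ H : SF U,
    op U X (F * H) = op U X F * H + sgn p q • (F * op U X H)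
  bracket : ∀ (U : Opens G) (p q : ZMod 2), ∀ X ∈ glPart p, ∀ Y ∈ glPart q, ∀ F : SF U,
    op U (sbr p q X Y) F = op U X (op U Y F) - sgn p q • op U Y (op U X F)

/-- Definiteness: the superfunctions annihilated by `𝔤` are exactly the locally constant numerical
functions, that is, the sections of the constant sheaf `ℝ`. -/
def SuperRep.Definite (ρ : SuperRep) : Prop :=
  ∀ (U : Opens G) (F : SF U), (∀ X : gl, ρ.op U X F = 0) ↔
    (IsLocallyConstant (F.re : U → ℝ) ∧ F.imI = 0 ∧ F.imJ = 0 ∧ F.imK = 0)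

/-- Left-representation-theoretical Lie supergroup structures for `𝔤𝔩(1/1)` and `(ℝˣ)²`. -/
@[ext]
structure LRT extends SuperRep where
  native : ∀ (U : Opens G), ∀ X ∈ glPart 0, ∀ (f : Fn U) (x : U),
    (op U X (SF.fn f)).eval x = ⟨leftD X f x, 0, 0, 0⟩
  definite : toSuperRep.Definite

/-- Right-representation-theoretical Lie supergroup structures for `𝔤𝔩(1/1)` and `(ℝˣ)²`. -/
@[ext]
structure RRT extends SuperRep where
  native : ∀ (U : Opens G), ∀ X ∈ glPart 0, ∀ (f : Fn U) (x : U),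
    (op U X (SF.fn f)).eval x = ⟨rightD X f x, 0, 0, 0⟩
  definite : toSuperRep.Definite

/-- Representation-theoretical Lie supergroup structures for `𝔤𝔩(1/1)` and `(ℝˣ)²`. -/
@[ext]
structure RT where
  left : LRT
  right : RRT
  bilateral : ∀ (U : Opens G) (p q : ZMod 2), ∀ X ∈ glPart p, ∀ Y ∈ glPart q, ∀ F : SF U,
    right.op U X (left.op U Y F) = sgn p q • left.op U Y (right.op U X F)

/-- Planed: `X₀.α = α([·, X₀])` for `X₀` even and `α = a C* + b D*`. -/
def LRT.Planed (S : LRT) : Prop :=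
  ∀ (U : Opens G), ∀ X ∈ glPart 0, ∀ a b : ℝ,
    S.op U X (SF.cov U a b) =
      SF.cov U (a * sbr 1 0 matC X 0 1 + b * sbr 1 0 matC X 1 0)
        (a * sbr 1 0 matD X 0 1 + b * sbr 1 0 matD X 1 0)

/-! ### Morphisms -/

/-- The preimage of an open set under a smooth group morphism. -/
def preim (ψ : G →* G) (h : ContMDiff IG IG ∞ ψ) (U : Opens G) : Opens G :=
  ⟨ψ ⁻¹' U, U.isOpen.preimage h.continuous⟩

/-- The morphism of exterior algebras induced by the dual of the odd part of
`L : 𝔤 → 𝔤`: it maps `α ∈ 𝔤₁*` to `α ∘ L`, where `C*(X) = X 0 1` and `D*(X) = X 1 0`. -/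
def dualMap (L : gl →ₗ[ℝ] gl) (v : Gr ℝ) : Gr ℝ :=
  let c : Gr ℝ := ⟨0, L matC 0 1, L matD 0 1, 0⟩
  let d : Gr ℝ := ⟨0, L matC 1 0, L matD 1 0, 0⟩
  v.re • (1 : Gr ℝ) + v.imI • c + v.imJ • d + v.imK • (c * d)

/-- A morphism of supermanifolds with fixed splitting together with a morphism of Lie
superalgebras, subject to the compatibility condition. -/
structure Mor where
  ψ : G →* G
  smooth : ContMDiff IG IG ∞ ψ
  L : gl →ₗ[ℝ] gl
  L_even : ∀ p : ZMod 2, ∀ X ∈ glPart p, L X ∈ glPart p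
  L_bracket : ∀ p q : ZMod 2, ∀ X ∈ glPart p, ∀ Y ∈ glPart q,
    L (sbr p q X Y) = sbr p q (L X) (L Y)
  pull : ∀ U : Opens G, SF U →ₗ[ℝ] SF (preim ψ smooth U)
  compat : ∀ (U : Opens G) (F : SF U) (x : preim ψ smooth U),
    (pull U F).eval x = dualMap L (F.eval ⟨ψ x, x.2⟩)

/-- The underlying morphism of supermanifolds is an isomorphism. -/
def Mor.IsIso (m : Mor) : Prop :=
  Function.Bijective m.ψ ∧ (∀ φ : G → G, Function.RightInverse φ m.ψ → ContMDiff IG IG ∞ φ) ∧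
    ∀ U : Opens G, Function.Bijective (m.pull U)

/-- Equivariance with respect to the representations `ρa` and `ρb`. -/
def Mor.Equivariant (m : Mor) (ρa ρb : SuperRep) : Prop :=
  ∀ (U : Opens G) (X : gl) (F : SF U),
    ρa.op (preim m.ψ m.smooth U) X (m.pull U F) = m.pull U (ρb.op U (m.L X) F)

/-- Isomorphy of LRT Lie supergroups. -/
def LRT.Isomorphic (S T : LRT) : Prop :=
  ∃ m : Mor, m.IsIso ∧ m.Equivariant S.toSuperRep T.toSuperRep

/-- Isomorphy of RT Lie supergroups. -/
def RT.Isomorphic (S T : RT) : Prop :=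
  ∃ m : Mor, m.IsIso ∧ m.Equivariant S.left.toSuperRep T.left.toSuperRep ∧
    m.Equivariant S.right.toSuperRep T.right.toSuperRep

/-! ### The essential constants -/

/-- The superfunction `z`. -/
def zF : SF ⊤ := SF.fn ⟨fun x => (x.1.1 : ℝ),
  Units.contMDiff_val.comp (contMDiff_fst.comp contMDiff_subtype_val)⟩

/-- The superfunction `w`. -/
def wF : SF ⊤ := SF.fn ⟨fun x => (x.1.2 : ℝ),
  Units.contMDiff_val.comp (contMDiff_snd.comp contMDiff_subtype_val)⟩

/-- The twelve essential constants of an LRT structure are the entries of `MC`, `MD` and `M1`: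
with `f_{n,m} = z^n w^m`, row `0` of `MC` is `(c^z_{C*}, c^z_{D*})` and row `1` is
`(c^w_{C*}, c^w_{D*})`, where `C.z = c^z_{C*} f_{3,-2} C* + c^z_{D*} f_{1,0} D*` and
`C.w = c^w_{C*} f_{2,-1} C* + c^w_{D*} f_{0,1} D*`; likewise for `MD` with
`D.z = d^z_{C*} f_{1,0} C* + d^z_{D*} f_{-1,2} D*` and
`D.w = d^w_{C*} f_{0,1} C* + d^w_{D*} f_{-2,3} D*`; and
`M1 = (c₁^{C*}, c₁^{D*}; d₁^{C*}, d₁^{D*})` gives the numerical parts of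
`C.C*`, `C.D*`, `D.C*`, `D.D*` as `c₁^{C*}`, `c₁^{D*} f_{2,-2}`, `d₁^{C*} f_{-2,2}`, `d₁^{D*}`. -/
structure LRT.HasConstants (S : LRT) (MC MD M1 : Matrix (Fin 2) (Fin 2) ℝ) : Prop where
  C_z : ∀ x : (⊤ : Opens G), let z : ℝ := x.1.1; let w : ℝ := x.1.2
    (S.op ⊤ matC zF).eval x = ⟨0, MC 0 0 * (z ^ 3 * w ^ (-2 : ℤ)), MC 0 1 * z, 0⟩
  C_w : ∀ x : (⊤ : Opens G), let z : ℝ := x.1.1; let w : ℝ := x.1.2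
    (S.op ⊤ matC wF).eval x = ⟨0, MC 1 0 * (z ^ 2 * w ^ (-1 : ℤ)), MC 1 1 * w, 0⟩
  D_z : ∀ x : (⊤ : Opens G), let z : ℝ := x.1.1; let w : ℝ := x.1.2
    (S.op ⊤ matD zF).eval x = ⟨0, MD 0 0 * z, MD 0 1 * (z ^ (-1 : ℤ) * w ^ 2), 0⟩
  D_w : ∀ x : (⊤ : Opens G), let z : ℝ := x.1.1; let w : ℝ := x.1.2
    (S.op ⊤ matD wF).eval x = ⟨0, MD 1 0 * w, MD 1 1 * (z ^ (-2 : ℤ) * w ^ 3), 0⟩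
  C_C : ∀ x : (⊤ : Opens G), ((S.op ⊤ matC (SF.cov ⊤ 1 0)).eval x).re = M1 0 0
  C_D : ∀ x : (⊤ : Opens G), let z : ℝ := x.1.1; let w : ℝ := x.1.2
    ((S.op ⊤ matC (SF.cov ⊤ 0 1)).eval x).re = M1 0 1 * (z ^ 2 * w ^ (-2 : ℤ))
  D_C : ∀ x : (⊤ : Opens G), let z : ℝ := x.1.1; let w : ℝ := x.1.2
    ((S.op ⊤ matD (SF.cov ⊤ 1 0)).eval x).re = M1 1 0 * (z ^ (-2 : ℤ) * w ^ 2)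
  D_D : ∀ x : (⊤ : Opens G), ((S.op ⊤ matD (SF.cov ⊤ 0 1)).eval x).re = M1 1 1

/-! ### The construction by Kostant and Koszul -/

/-- The defining relations `X Y = [X, Y] + (-1)^{|X||Y|} Y X` of the enveloping algebra. -/
inductive EnvRel : TensorAlgebra ℝ gl → TensorAlgebra ℝ gl → Prop
  | rel (p q : ZMod 2) (X Y : gl) (hX : X ∈ glPart p) (hY : Y ∈ glPart q) :
      EnvRel (TensorAlgebra.ι ℝ X * TensorAlgebra.ι ℝ Y)
        (TensorAlgebra.ι ℝ (sbr p q X Y) +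
          sgn p q • (TensorAlgebra.ι ℝ Y * TensorAlgebra.ι ℝ X))

/-- The universal enveloping algebra `E(𝔤)` of `𝔤 = 𝔤𝔩(1/1)`. -/
abbrev Env : Type := RingQuot EnvRel

/-- The canonical map `𝔤 → E(𝔤)`. -/
def envι : gl →ₗ[ℝ] Env :=
  (RingQuot.mkAlgHom ℝ EnvRel).toLinearMap ∘ₗ TensorAlgebra.ι ℝ

/-- `γ(C ∧ D)` for the supersymmetrization `γ : Λ 𝔤₁ → E(𝔤)`. -/
def gammaCD : Env := (1 / 2 : ℝ) • (envι matC * envι matD - envι matD * envι matC)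

/-- Kostant's superfunctions on `U`. A functional `Φ` on the smash product `ℝ(U) # E(𝔤)` such that
`g ↦ Φ(g # Z)` is smooth for all `Z` is the same as a linear map `Φ : E(𝔤) → C^∞(U)`,
`Φ(Z)(g) = Φ(g # Z)`. The condition says that `Φ(g # X Z)` is the derivative of `Φ(g # Z)` with
respect to `g` along `X ∈ 𝔤₀`, so that `Φ(g # X₀ Z) = (X₀.Φ(· # Z))(g)` for `X₀ ∈ E(𝔤₀)`. -/
def KostantFn (U : Opens G) : Set (Env →ₗ[ℝ] Fn U) :=
  {Φ | ∀ X ∈ glPart 0, ∀ (Z : Env) (g : U), Φ (envι X * Z) g = leftD X (Φ Z) g}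

/-- Koszul's splitting: an isomorphism `κ` from `C^∞(U) ⊗ Λ 𝔤₁*` to Kostant's superfunctions, given
on `γ(Λ 𝔤₁)` by evaluation. By the sign rule `(α ∧ β)(C ∧ D) = - α(C) β(D) + α(D) β(C)`, the form
`C* ∧ D*` takes the value `-1` on `C ∧ D`; with this sign `κ` is multiplicative for the
convolution product of functionals. -/
structure IsKoszulSplitting (U : Opens G) (κ : SF U →ₗ[ℝ] (Env →ₗ[ℝ] Fn U)) : Prop where
  bij : Set.BijOn κ Set.univ (KostantFn U)
  on_one : ∀ F, κ F 1 = F.re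
  on_C : ∀ F, κ F (envι matC) = F.imI
  on_D : ∀ F, κ F (envι matD) = F.imJ
  on_CD : ∀ F, κ F gammaCD = -F.imK

/-- The RT structure is the one obtained by the construction of Kostant and Koszul. Via the
splitting, `X ∈ 𝔤` of parity `p` acts on the left structure by
`(X.Φ)(g # Z) = (-1)^p Φ((g # Z)(e # X)) = (-1)^p Φ(g # Z X)`. The right structure is obtained from
it by conjugation with the antipode, which gives
`(X.Φ)(g # Z) = -(-1)^{p |Φ|} Φ((e # X)(g # Z)) = -(-1)^{p |Φ|} Φ(g # (Ad(g⁻¹)X) Z)`. -/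
def RT.IsKostantKoszul (S : RT) : Prop :=
  ∀ U : Opens G, ∃ κ : SF U →ₗ[ℝ] (Env →ₗ[ℝ] Fn U), IsKoszulSplitting U κ ∧
    (∀ p : ZMod 2, ∀ X ∈ glPart p, ∀ (F : SF U) (Z : Env),
      κ (S.left.op U X F) Z = sgn p p • κ F (Z * envι X)) ∧
    (∀ p q : ZMod 2, ∀ X ∈ glPart p, ∀ F ∈ grPart (Fn U) q, ∀ (Z : Env) (g : U),
      κ (S.right.op U X F) Z g =
        -(sgn p q * κ F (envι (toMat (g : G)⁻¹ * X * toMat (g : G)) * Z) g))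

/-! ### The construction by Berezin -/

/-- A point `g (1 + diag(a, b) C* ∧ D*) · exp(0, γ; δ, 0)` of the group `G̃` of invertible even
supermatrices with entries in `Λ 𝔤₁*`; every element of `G̃` is uniquely of this form. -/
structure SPoint where
  g : G
  a : ℝ
  b : ℝ
  γ : Gr ℝ
  δ : Gr ℝ
  γ_odd : γ ∈ grPart ℝ 1
  δ_odd : δ ∈ grPart ℝ 1

/-- The matrix of a point of `G̃`. -/
def SPoint.mat (x : SPoint) : Matrix (Fin 2) (Fin 2) (Gr ℝ) :=
  !![⟨x.g.1, 0, 0, x.g.1 * x.a⟩, 0; 0, ⟨x.g.2, 0, 0, x.g.2 * x.b⟩] *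
    IsNilpotent.exp !![0, x.γ; x.δ, 0]

/-- Grassmann analytic continuation of a numerical function, by Taylor expansion in the nilpotent
part of the argument: `f(g exp(diag(a, b) C* ∧ D*)) = f(g) + (diag(a, b).f)(g) C* ∧ D*`. -/
def contFn {U : Opens G} (f : Fn U) (x : SPoint) : Gr ℝ :=
  ⟨ext0 f x.g, 0, 0, leftD !![x.a, 0; 0, x.b] f x.g⟩

/-- Grassmann analytic continuation of a superfunction to `G̃`; `C*` is continued to `γ` and `D*`
to `δ`. Since the Grassmann coefficient of a derivation is split off to the right (see
`RT.IsBerezin`), the product `C* ∧ D*` is continued to `δ γ`. -/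
def cont {U : Opens G} (F : SF U) (x : SPoint) : Gr ℝ :=
  contFn F.re x + contFn F.imI x * x.γ + contFn F.imJ x * x.δ + contFn F.imK x * (x.δ * x.γ)

/-- `v` is the derivative at `0` of the curve `u` in `Λ 𝔤₁*`. -/
def HasDerivGr (u : ℝ → Gr ℝ) (v : Gr ℝ) : Prop :=
  HasDerivAt (fun t => (u t).re) v.re 0 ∧ HasDerivAt (fun t => (u t).imI) v.imI 0 ∧
    HasDerivAt (fun t => (u t).imJ) v.imJ 0 ∧ HasDerivAt (fun t => (u t).imK) v.imK 0

/-- A real matrix as a matrix over `Λ 𝔤₁*`, multiplied by the element `α` of `Λ 𝔤₁*`. -/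
def grMat (X : gl) (α : Gr ℝ) : Matrix (Fin 2) (Fin 2) (Gr ℝ) := X.map fun r => r • α

/-- The RT structure is the one obtained by the construction of Berezin: on continued
superfunctions `X ∈ 𝔤` acts on the left structure by the left-invariant derivation of `G̃`,
`(X.F)(g̃) = d/dt F(g̃ exp(tX))` for `X` even and `(X.F)(g̃) α = d/dt F(g̃ exp(t α X))` for `X` and `α`
odd, and on the right structure by the right-invariant derivations, with `exp(-tX) g̃` and
`exp(-t α X) g̃` in place of `g̃ exp(tX)` and `g̃ exp(t α X)`. -/
structure RT.IsBerezin (S : RT) : Prop where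
  left_even : ∀ (U : Opens G), ∀ X ∈ glPart 0, ∀ (F : SF U) (x : ℝ → SPoint), (x 0).g ∈ U →
    (∀ t, (x t).mat = (x 0).mat * grMat (toMat (expG (t • X))) 1) →
    HasDerivGr (fun t => cont F (x t)) (cont (S.left.op U X F) (x 0))
  left_odd : ∀ (U : Opens G), ∀ X ∈ glPart 1, ∀ α ∈ grPart ℝ 1, ∀ (F : SF U) (x : ℝ → SPoint),
    (x 0).g ∈ U →
    (∀ t, (x t).mat = (x 0).mat * IsNilpotent.exp (grMat X (t • α))) →
    HasDerivGr (fun t => cont F (x t)) (cont (S.left.op U X F) (x 0) * α)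
  right_even : ∀ (U : Opens G), ∀ X ∈ glPart 0, ∀ (F : SF U) (x : ℝ → SPoint), (x 0).g ∈ U →
    (∀ t, (x t).mat = grMat (toMat (expG (-(t • X)))) 1 * (x 0).mat) →
    HasDerivGr (fun t => cont F (x t)) (cont (S.right.op U X F) (x 0))
  right_odd : ∀ (U : Opens G), ∀ X ∈ glPart 1, ∀ α ∈ grPart ℝ 1, ∀ (F : SF U) (x : ℝ → SPoint),
    (x 0).g ∈ U →
    (∀ t, (x t).mat = IsNilpotent.exp (-(grMat X (t • α))) * (x 0).mat) →
    HasDerivGr (fun t => cont F (x t)) (cont (S.right.op U X F) (x 0) * α)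

end RTLie

end

/-!
A superfunction on an open `U ⊆ (ℝˣ)²` is `f + a C* + b D* + h C* ∧ D*`, and every operator in
question is an explicit superderivation in the four coefficients. With `A`, `B` the two invariant
derivations of `C^∞(U)` (`invDer (1, 0)`, `invDer (0, 1)`), let `y = y₁ A + y₂ B`,
`y' = A + B - y` and `ε = ±1`. The left structure `leftLRT y ε` lets a diagonal `X` act by the
invariant derivation on coefficients and by its weights on `C*` and `D*`, and has
`C = ε (∂/∂C* + D* y)`, `D = ε (∂/∂D* + C* y')` on functions and generators. The relations
`C² = D² = 0` and `[C, D] = A + B` hold because `y` and `y'` commute and have sum `A + B`.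
The right structure `rightRRT ε` has the same shape, with the functions `w z⁻¹` and `z w⁻¹` as
coefficients of its odd operators; for `y = y' = (A + B) / 2` the two structures supercommute
(`rightOp_leftOp`) and form `stdRT ε`.

Kostant–Koszul: for `ε = 1` the left structure makes the superfunctions a module over the enveloping
algebra, and `κ(F)(Z) = (Z.F)₀` is Koszul's splitting. It is the only one, since `1, C, D, γ(C ∧ D)`
generate the enveloping algebra over that of `𝔤₀` (`span_envMonomial`); no independence statement is
needed, because the inverse of `κ` is written down. The sign `(-1)^{|X|}` in the left action turns
`ε = 1` into `ε = -1`, so the construction yields exactly `stdRT (-1)`.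

Berezin: the exponential of an odd supermatrix stops at the quadratic term, so one-parameter
translations on `G̃` are affine in the odd coordinates (`mat_mul_exp_odd_iff`,
`exp_odd_mul_mat_iff`), and differentiating a continued superfunction along them gives `stdRT 1`.
Conversely the derivatives determine the even operators, and the odd ones up to the coefficient of
`C* ∧ D*`, which `C² = D² = 0` then fixes (`SuperRep.op_eq_of_sq_zero`).

Isomorphisms: if the matrix `M₁` is `s` times the identity, the numerical part of `X.α` is `s α(X)`
for odd `X`. For an equivariant `(ψ, L)` between structures with opposite `s`, comparison of
numerical parts gives `s α(L X) = -s α(L X)`, so the pull-back kills `C*` and is not injective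
(`LRT.HasConstants.not_isomorphic`). Planedness is transported by an isomorphism because pull-back of
`α` is `α ∘ L`, `L` respects brackets, and `L` is onto in the even part
(`LRT.Isomorphic.planed_iff`).
-/

noncomputable section
namespace RTLie

/-! ### Invariant differentiation on `(ℝˣ)²` -/

/-- The exponential map `ℝ² → (ℝˣ)²`. -/
def expPair (v : ℝ × ℝ) : G :=
  (Units.mk0 (Real.exp v.1) (Real.exp_ne_zero _), Units.mk0 (Real.exp v.2) (Real.exp_ne_zero _))

lemma expPair_add (v w : ℝ × ℝ) : expPair (v + w) = expPair v * expPair w := by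
  ext <;> simp [expPair, Real.exp_add]

@[simp] lemma expPair_zero : expPair 0 = 1 := by
  ext <;> simp [expPair]

lemma contMDiff_expPair : ContMDiff 𝓘(ℝ, ℝ × ℝ) IG ∞ expPair := by
  apply ContMDiff.prodMk
  · apply ContMDiff.of_comp_isOpenEmbedding Units.isOpenEmbedding_val
    exact contMDiff_iff_contDiff.2 (Real.contDiff_exp.comp contDiff_fst)
  · apply ContMDiff.of_comp_isOpenEmbedding Units.isOpenEmbedding_val
    exact contMDiff_iff_contDiff.2 (Real.contDiff_exp.comp contDiff_snd)

lemma continuous_expPair : Continuous expPair := contMDiff_expPair.continuous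

/-- The logarithm of absolute values; on the identity component it inverts `expPair`. -/
def logPair (g : G) : ℝ × ℝ := (Real.log g.1, Real.log g.2)

@[simp] lemma logPair_one : logPair 1 = 0 := by
  simp [logPair]

lemma contMDiff_fst_val : ContMDiff IG 𝓘(ℝ, ℝ) ∞ (fun g : G => (g.1 : ℝ)) :=
  Units.contMDiff_val.comp contMDiff_fst

lemma contMDiff_snd_val : ContMDiff IG 𝓘(ℝ, ℝ) ∞ (fun g : G => (g.2 : ℝ)) :=
  Units.contMDiff_val.comp contMDiff_snd

lemma contMDiff_logPair : ContMDiff IG 𝓘(ℝ, ℝ × ℝ) ∞ logPair := by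
  apply ContMDiff.prodMk_space
  · intro g
    exact ((Real.contDiffAt_log.2 g.1.ne_zero).contMDiffAt).comp g
      contMDiff_fst_val.contMDiffAt
  · intro g
    exact ((Real.contDiffAt_log.2 g.2.ne_zero).contMDiffAt).comp g
      contMDiff_snd_val.contMDiffAt

open Filter Topology in
lemma eventually_expPair_logPair (g : G) :
    ∀ᶠ h in 𝓝 g, g * expPair (logPair (g⁻¹ * h)) = h := by
  have hc : Continuous fun h : G => g⁻¹ * h := by fun_prop
  have h1 : ∀ᶠ h in 𝓝 g, (0 : ℝ) < ((g⁻¹ * h).1 : ℝ) := by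
    have : Continuous fun h : G => ((g⁻¹ * h).1 : ℝ) :=
      Units.continuous_val.comp (continuous_fst.comp hc)
    exact this.continuousAt.eventually (lt_mem_nhds (by simp))
  have h2 : ∀ᶠ h in 𝓝 g, (0 : ℝ) < ((g⁻¹ * h).2 : ℝ) := by
    have : Continuous fun h : G => ((g⁻¹ * h).2 : ℝ) :=
      Units.continuous_val.comp (continuous_snd.comp hc)
    exact this.continuousAt.eventually (lt_mem_nhds (by simp))
  filter_upwards [h1, h2] with h h1 h2
  have : expPair (logPair (g⁻¹ * h)) = g⁻¹ * h := by
    ext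
    · simp only [expPair, logPair, Units.val_mk0]; exact Real.exp_log h1
    · simp only [expPair, logPair, Units.val_mk0]; exact Real.exp_log h2
  rw [this]; group

variable {U V : Opens G}

/-- The function `f` (extended by zero) in exponential coordinates around `g`. -/
def expCoord (f : U → ℝ) (g : G) (v : ℝ × ℝ) : ℝ := ext0 f (g * expPair v)

@[simp] lemma ext0_coe (f : U → ℝ) (x : U) : ext0 f x = f x := by
  simp [ext0]

lemma ext0_of_mem (f : U → ℝ) {g : G} (h : g ∈ U) : ext0 f g = f ⟨g, h⟩ := by
  simp [ext0, h]

lemma expCoord_mul (f : U → ℝ) (g : G) (v w : ℝ × ℝ) :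
    expCoord f (g * expPair v) w = expCoord f g (v + w) := by
  simp [expCoord, expPair_add, mul_assoc]

lemma contMDiffAt_ext0 (f : Fn U) {g : G} (h : g ∈ U) :
    ContMDiffAt IG 𝓘(ℝ, ℝ) ∞ (ext0 f) g := by
  have : ContMDiffAt IG 𝓘(ℝ, ℝ) ∞ (fun x : U => ext0 f x) ⟨g, h⟩ := by
    simpa using! f.contMDiff.contMDiffAt
  exact contMDiffAt_subtype_iff.1 this

lemma contDiffAt_expCoord (f : Fn U) {g : G} {v : ℝ × ℝ} (h : g * expPair v ∈ U) :
    ContDiffAt ℝ ∞ (expCoord f g) v := by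
  rw [← contMDiffAt_iff_contDiffAt]
  exact (contMDiffAt_ext0 f h).comp v
    (contMDiff_const.mul contMDiff_expPair).contMDiffAt

open Filter Topology in
lemma eventually_mul_expPair_mem {g : G} {v : ℝ × ℝ} (h : g * expPair v ∈ U) :
    ∀ᶠ w in 𝓝 v, g * expPair w ∈ U :=
  (continuous_const.mul continuous_expPair).continuousAt.eventually (U.isOpen.mem_nhds h)

lemma fderiv_expCoord_mul (f : U → ℝ) (g : G) (v : ℝ × ℝ) :
    fderiv ℝ (expCoord f (g * expPair v)) 0 = fderiv ℝ (expCoord f g) v := by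
  have : expCoord f (g * expPair v) = fun w => expCoord f g (v + w) := by
    funext w; exact expCoord_mul f g v w
  rw [this, fderiv_comp_add_left]; simp

open Filter Topology in
/-- The derivative of a smooth function along an invariant vector field is smooth. -/
lemma contMDiff_fderiv_expCoord (v : ℝ × ℝ) (f : Fn U) :
    ContMDiff IG 𝓘(ℝ, ℝ) ∞ (fun x : U => fderiv ℝ (expCoord f x) 0 v) := by
  intro x
  rw [contMDiffAt_subtype_iff (f := fun g : G => fderiv ℝ (expCoord f g) 0 v)]
  have h0 : (x : G) * expPair 0 ∈ U := by simp
  have h1 : ContDiffAt ℝ ∞ (fun w => fderiv ℝ (expCoord f x) w v) 0 :=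
    (((contDiffAt_expCoord f h0).fderiv_right (m := ∞) (by simp)).clm_apply contDiffAt_const)
  have h2 : ContMDiffAt IG 𝓘(ℝ, ℝ × ℝ) ∞ (fun g : G => logPair ((x : G)⁻¹ * g)) x :=
    (contMDiff_logPair.comp (contMDiff_const.mul contMDiff_id)).contMDiffAt
  have h3 : logPair ((x : G)⁻¹ * x) = 0 := by simp
  have h4 := ContMDiffAt.comp (x : G) (g := fun w => fderiv ℝ (expCoord f x) w v)
    (by rw [h3]; exact h1.contMDiffAt) h2
  refine h4.congr_of_eventuallyEq ?_
  filter_upwards [eventually_expPair_logPair (x : G)] with h hh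
  simp only [Function.comp]
  rw [← fderiv_expCoord_mul f (x : G), hh]

lemma expCoord_zero (f : U → ℝ) (g : G) : expCoord f g 0 = ext0 f g := by simp [expCoord]

lemma ext0_add (f h : Fn U) (g : G) : ext0 (f + h : Fn U) g = ext0 f g + ext0 h g := by
  by_cases hg : g ∈ U <;> simp [ext0, hg]

lemma ext0_mul (f h : Fn U) (g : G) : ext0 (f * h : Fn U) g = ext0 f g * ext0 h g := by
  by_cases hg : g ∈ U <;> simp [ext0, hg]

lemma ext0_smul (r : ℝ) (h : Fn U) (g : G) : ext0 (r • h : Fn U) g = r * ext0 h g := by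
  by_cases hg : g ∈ U <;> simp [ext0, hg]

lemma differentiableAt_expCoord (f : Fn U) (x : U) :
    DifferentiableAt ℝ (expCoord f x) 0 :=
  (contDiffAt_expCoord f (v := 0) (by simp)).differentiableAt (by simp)

lemma expCoord_add (f h : Fn U) (g : G) :
    expCoord (f + h : Fn U) g = expCoord f g + expCoord h g :=
  funext fun _ => ext0_add f h _

lemma expCoord_mul_fn (f h : Fn U) (g : G) :
    expCoord (f * h : Fn U) g = expCoord f g * expCoord h g :=
  funext fun _ => ext0_mul f h _

lemma expCoord_smul (r : ℝ) (f : Fn U) (g : G) :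
    expCoord (r • f : Fn U) g = r • expCoord f g :=
  funext fun _ => ext0_smul r f _

/-- The derivative of a smooth function along the invariant vector field with value `v` at the
identity. -/
def invDerFun (v : ℝ × ℝ) (f : Fn U) : Fn U :=
  ⟨fun x : U => fderiv ℝ (expCoord f x) 0 v, contMDiff_fderiv_expCoord v f⟩

lemma invDerFun_apply (v : ℝ × ℝ) (f : Fn U) (x : U) :
    invDerFun v f x = fderiv ℝ (expCoord f x) 0 v := rfl

/-- The invariant derivation of `C^∞(U)` with value `v` at the identity. -/
def invDer (v : ℝ × ℝ) : Derivation ℝ (Fn U) (Fn U) :=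
  Derivation.mk'
    { toFun := invDerFun v
      map_add' := fun f h => by
        ext x
        rw [ContMDiffMap.coe_add, Pi.add_apply]
        simp only [invDerFun_apply]
        rw [expCoord_add, fderiv_add (differentiableAt_expCoord f x)
          (differentiableAt_expCoord h x)]
        rfl
      map_smul' := fun r f => by
        ext x
        rw [RingHom.id_apply, ContMDiffMap.coe_smul, Pi.smul_apply]
        simp only [invDerFun_apply]
        rw [expCoord_smul, fderiv_const_smul (differentiableAt_expCoord f x)]
        rfl }
    (fun f h => by
      ext x
      simp only [LinearMap.coe_mk, AddHom.coe_mk, smul_eq_mul]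
      rw [ContMDiffMap.coe_add, Pi.add_apply, ContMDiffMap.coe_mul, Pi.mul_apply,
        ContMDiffMap.coe_mul, Pi.mul_apply]
      simp only [invDerFun_apply]
      rw [expCoord_mul_fn, fderiv_mul (differentiableAt_expCoord f x)
        (differentiableAt_expCoord h x)]
      simp [expCoord_zero])

lemma invDer_apply (v : ℝ × ℝ) (f : Fn U) (x : U) :
    invDer v f x = fderiv ℝ (expCoord f x) 0 v := rfl

lemma invDer_add (v w : ℝ × ℝ) (f : Fn U) : invDer (v + w) f = invDer v f + invDer w f := by
  ext x; simp [invDer_apply]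

lemma invDer_smul (r : ℝ) (v : ℝ × ℝ) (f : Fn U) : invDer (r • v) f = r • invDer v f := by
  ext x; simp [invDer_apply]

open Filter Topology in
lemma expCoord_invDer (v : ℝ × ℝ) (f : Fn U) (x : U) :
    expCoord (invDer v f) x =ᶠ[𝓝 0] fun w => fderiv ℝ (expCoord f x) w v := by
  filter_upwards [eventually_mul_expPair_mem (U := U) (g := x) (v := 0) (by simp)] with w hw
  rw [expCoord, ext0_of_mem _ hw, invDer_apply, fderiv_expCoord_mul]

/-- Invariant derivations commute. -/
lemma invDer_comm (v w : ℝ × ℝ) (f : Fn U) : invDer v (invDer w f) = invDer w (invDer v f) := by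
  ext x
  have hs : IsSymmSndFDerivAt ℝ (expCoord f x) 0 :=
    (contDiffAt_expCoord f (v := 0) (by simp)).isSymmSndFDerivAt
      (by rw [minSmoothness_of_isRCLikeNormedField]; exact WithTop.coe_le_coe.2 (le_top : (2 : ℕ∞) ≤ ⊤))
  have hd : DifferentiableAt ℝ (fderiv ℝ (expCoord f x)) 0 :=
    ((contDiffAt_expCoord f (v := 0) (by simp)).fderiv_right (m := 1)
      (WithTop.coe_le_coe.2 (le_top : (1 + 1 : ℕ∞) ≤ ⊤))).differentiableAt one_ne_zero
  rw [invDer_apply, invDer_apply, (expCoord_invDer w f x).fderiv_eq,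
    (expCoord_invDer v f x).fderiv_eq, fderiv_clm_apply hd (by fun_prop),
    fderiv_clm_apply hd (by fun_prop)]
  simpa using hs v w

/-- Restriction of smooth functions. -/
abbrev resFn (h : V ≤ U) : Fn U →+* Fn V :=
  ContMDiffMap.restrictRingHom (n := ∞) IG 𝓘(ℝ, ℝ) ℝ h

lemma resFn_apply (h : V ≤ U) (f : Fn U) (x : V) : resFn h f x = f ⟨x, h x.2⟩ := rfl

open Filter Topology in
lemma invDer_resFn (h : V ≤ U) (v : ℝ × ℝ) (f : Fn U) :
    invDer v (resFn h f) = resFn h (invDer v f) := by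
  ext x
  have : expCoord (resFn h f) x =ᶠ[𝓝 0] expCoord f x := by
    filter_upwards [eventually_mul_expPair_mem (U := V) (g := x) (v := 0) (by simp)] with w hw
    rw [expCoord, expCoord, ext0_of_mem _ hw, ext0_of_mem _ (h hw), resFn_apply]
  rw [invDer_apply, resFn_apply, invDer_apply, this.fderiv_eq]

lemma resFn_smul (h : V ≤ U) (r : ℝ) (f : Fn U) : resFn h (r • f) = r • resFn h f := rfl

lemma expG_eq (X : gl) : expG X = expPair (X 0 0, X 1 1) := rfl

lemma hasDerivAt_ext0 (X : gl) (f : Fn U) {g : G} (hg : g ∈ U) :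
    HasDerivAt (fun t : ℝ => ext0 f (g * expG (t • X))) (invDer (X 0 0, X 1 1) f ⟨g, hg⟩) 0 := by
  have h1 : HasFDerivAt (expCoord f g) (fderiv ℝ (expCoord f g) 0) ((0 : ℝ) • (X 0 0, X 1 1)) := by
    rw [zero_smul]
    exact (differentiableAt_expCoord f ⟨g, hg⟩).hasFDerivAt
  have h2 : HasDerivAt (fun t : ℝ => t • (X 0 0, X 1 1)) (X 0 0, X 1 1) 0 := by
    simpa using! (hasDerivAt_id (0 : ℝ)).smul_const (X 0 0, X 1 1)
  exact h1.comp_hasDerivAt 0 h2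

lemma leftD_eq (X : gl) (f : Fn U) {g : G} (hg : g ∈ U) :
    leftD X f g = invDer (X 0 0, X 1 1) f ⟨g, hg⟩ :=
  (hasDerivAt_ext0 X f hg).deriv

lemma rightD_eq (X : gl) (f : Fn U) {g : G} (hg : g ∈ U) :
    rightD X f g = -invDer (X 0 0, X 1 1) f ⟨g, hg⟩ := by
  have h := (hasDerivAt_ext0 (-X) f hg).deriv
  have h2 : invDer ((-X) 0 0, (-X) 1 1) f = -invDer (X 0 0, X 1 1) f := by
    have := invDer_smul (-1) (X 0 0, X 1 1) f
    simpa using! this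
  rw [h2] at h
  have h3 : (-invDer (X 0 0, X 1 1) f) ⟨g, hg⟩ = -invDer (X 0 0, X 1 1) f ⟨g, hg⟩ := rfl
  rw [rightD, ← h3, ← h]
  simp [mul_comm]

open Filter Topology in
/-- A function all of whose invariant derivatives vanish is locally constant. -/
lemma isLocallyConstant_of_invDer (f : Fn U) (hf : ∀ v, invDer v f = 0) :
    IsLocallyConstant (f : U → ℝ) := by
  rw [IsLocallyConstant.iff_eventually_eq]
  intro x
  obtain ⟨r, hr, hball⟩ := Metric.eventually_nhds_iff_ball.1
    (eventually_mul_expPair_mem (U := U) (g := x) (v := 0) (by simp))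
  have hconst : ∀ w ∈ Metric.ball (0 : ℝ × ℝ) r, expCoord f x w = expCoord f x 0 := by
    intro w hw
    refine Metric.isOpen_ball.is_const_of_fderiv_eq_zero (convex_ball _ _).isPreconnected
      (fun v hv => ((contDiffAt_expCoord f (hball v hv)).differentiableAt
        (by simp)).differentiableWithinAt) (fun v hv => ?_) hw (Metric.mem_ball_self hr)
    refine ContinuousLinearMap.ext fun u => ?_
    rw [← fderiv_expCoord_mul]
    have := invDer_apply u f ⟨_, hball v hv⟩
    rw [hf u] at this
    simpa using! this.symm
  have hlog : Tendsto (fun g : G => logPair ((x : G)⁻¹ * g)) (𝓝 x) (𝓝 0) := by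
    have : Continuous fun g : G => logPair ((x : G)⁻¹ * g) :=
      contMDiff_logPair.continuous.comp (by fun_prop)
    simpa using this.tendsto (x : G)
  have hev : ∀ᶠ g in 𝓝 (x : G), ext0 f g = f x := by
    filter_upwards [eventually_expPair_logPair (x : G),
      hlog.eventually (Metric.ball_mem_nhds 0 hr)] with g h1 h2
    have := hconst _ h2
    rw [expCoord, h1, expCoord_zero, ext0_coe] at this
    exact this
  have := continuous_subtype_val.continuousAt.eventually hev
  filter_upwards [this] with y hy
  simpa using hy

open Filter Topology in
lemma invDer_of_isLocallyConstant (f : Fn U) (hf : IsLocallyConstant (f : U → ℝ)) (v : ℝ × ℝ) :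
    invDer v f = 0 := by
  ext x
  have h1 : ∀ᶠ g in 𝓝 (x : G), ext0 f g = f x := by
    have h2 := (IsLocallyConstant.iff_eventually_eq _).1 hf x
    rw [nhds_subtype_eq_comap, eventually_comap] at h2
    filter_upwards [h2, U.isOpen.mem_nhds x.2] with g hg hgU
    rw [ext0_of_mem _ hgU]
    exact hg ⟨g, hgU⟩ rfl
  have h3 : expCoord f x =ᶠ[𝓝 0] fun _ => f x := by
    have hc : Continuous fun w : ℝ × ℝ => (x : G) * expPair w :=
      continuous_const.mul continuous_expPair
    have : Tendsto (fun w : ℝ × ℝ => (x : G) * expPair w) (𝓝 0) (𝓝 x) := by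
      simpa using hc.tendsto 0
    exact this.eventually h1
  rw [invDer_apply, h3.fderiv_eq]
  simp

/-! ### Superderivations of an exterior algebra on two generators -/

section Algebra

set_option linter.unusedSimpArgs false

variable {R : Type} [CommRing R]

@[simp] lemma mem_grPart_zero {F : Gr R} : F ∈ grPart R 0 ↔ F.imI = 0 ∧ F.imJ = 0 := by
  simp [grPart]

@[simp] lemma mem_grPart_one {F : Gr R} : F ∈ grPart R 1 ↔ F.re = 0 ∧ F.imK = 0 := by
  simp [grPart]

@[simp] lemma mem_glPart_zero {X : gl} : X ∈ glPart 0 ↔ X 0 1 = 0 ∧ X 1 0 = 0 := by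
  simp [glPart]

@[simp] lemma mem_glPart_one {X : gl} : X ∈ glPart 1 ↔ X 0 0 = 0 ∧ X 1 1 = 0 := by
  simp [glPart]

@[simp] lemma sgn_one_one : sgn 1 1 = -1 := by simp [sgn]
@[simp] lemma sgn_zero_left (p : ZMod 2) : sgn 0 p = 1 := by simp [sgn]
@[simp] lemma sgn_zero_right (p : ZMod 2) : sgn p 0 = 1 := by simp [sgn]

lemma forall_parity {P : ZMod 2 → Prop} (h0 : P 0) (h1 : P 1) (p : ZMod 2) : P p := by
  fin_cases p
  · exact h0
  · exact h1

variable [Algebra ℝ R]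

/-- The operator on `Λ_R(C*, D*)` which on `R` is `V + C* V₁ + D* V₂`, on the generators is
`C* ↦ p + l C*`, `D* ↦ q + m D*`, and is extended by the Leibniz rule (with signs for the odd
part given by `V₁, V₂, p, q`). -/
def superDer (V V₁ V₂ : Derivation ℝ R R) (l m p q : R) : Gr R →ₗ[ℝ] Gr R where
  toFun F := ⟨V F.re + (p * F.imI + q * F.imJ), V F.imI + l * F.imI + (V₁ F.re - q * F.imK),
    V F.imJ + m * F.imJ + (V₂ F.re + p * F.imK),
    V F.imK + (l + m) * F.imK + (V₁ F.imJ - V₂ F.imI)⟩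
  map_add' F H := by ext <;> simp <;> ring
  map_smul' r F := by
    ext <;> simp <;> simp only [Algebra.smul_def, map_add, map_mul, map_neg] <;> ring

section

variable (V V₁ V₂ : Derivation ℝ R R) (l m p q : R) (F : Gr R)

lemma re_superDer : (superDer V V₁ V₂ l m p q F).re = V F.re + (p * F.imI + q * F.imJ) := rfl

lemma imI_superDer : (superDer V V₁ V₂ l m p q F).imI =
    V F.imI + l * F.imI + (V₁ F.re - q * F.imK) := rfl

lemma imJ_superDer : (superDer V V₁ V₂ l m p q F).imJ =
    V F.imJ + m * F.imJ + (V₂ F.re + p * F.imK) := rfl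

lemma imK_superDer : (superDer V V₁ V₂ l m p q F).imK =
    V F.imK + (l + m) * F.imK + (V₁ F.imJ - V₂ F.imI) := rfl

end

lemma superDer_leibniz_even (V : Derivation ℝ R R) (l m : R) (F H : Gr R) :
    superDer V 0 0 l m 0 0 (F * H) = superDer V 0 0 l m 0 0 F * H +
      F * superDer V 0 0 l m 0 0 H := by
  ext <;> simp [re_superDer, imI_superDer, imJ_superDer, imK_superDer] <;> ring

lemma superDer_leibniz_odd_even (V₁ V₂ : Derivation ℝ R R) (p q : R) {F : Gr R}
    (hF : F ∈ grPart R 0) (H : Gr R) :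
    superDer 0 V₁ V₂ 0 0 p q (F * H) = superDer 0 V₁ V₂ 0 0 p q F * H +
      F * superDer 0 V₁ V₂ 0 0 p q H := by
  obtain ⟨h1, h2⟩ := mem_grPart_zero.1 hF
  ext <;> simp [re_superDer, imI_superDer, imJ_superDer, imK_superDer, h1, h2] <;> ring

lemma superDer_leibniz_odd_odd (V₁ V₂ : Derivation ℝ R R) (p q : R) {F : Gr R}
    (hF : F ∈ grPart R 1) (H : Gr R) :
    superDer 0 V₁ V₂ 0 0 p q (F * H) = superDer 0 V₁ V₂ 0 0 p q F * H -
      F * superDer 0 V₁ V₂ 0 0 p q H := by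
  obtain ⟨h1, h2⟩ := mem_grPart_one.1 hF
  ext <;> simp [re_superDer, imI_superDer, imJ_superDer, imK_superDer, h1, h2] <;> ring

/-- The operators of a left structure: `A` and `B` are the actions of `E₁₁` and `E₂₂` on functions,
`C` acts on functions by `ε D* Y` and `D` by `ε C* Y'`, and `ε` is the common value of
`C.C*` and `D.D*`. -/
def leftOp (A B Y Y' : Derivation ℝ R R) (ε : ℝ) : gl →ₗ[ℝ] (Gr R →ₗ[ℝ] Gr R) where
  toFun X := superDer (X 0 0 • A + X 1 1 • B) ((ε * X 1 0) • Y') ((ε * X 0 1) • Y)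
    (algebraMap ℝ R (X 1 1 - X 0 0)) (algebraMap ℝ R (X 0 0 - X 1 1))
    (algebraMap ℝ R (ε * X 0 1)) (algebraMap ℝ R (ε * X 1 0))
  map_add' X Z := by
    refine LinearMap.ext fun F => ?_
    ext <;> simp [re_superDer, imI_superDer, imJ_superDer, imK_superDer] <;>
      simp only [Algebra.smul_def, map_add, map_mul, map_neg] <;> ring
  map_smul' r X := by
    refine LinearMap.ext fun F => ?_
    ext <;> simp [re_superDer, imI_superDer, imJ_superDer, imK_superDer] <;>
      simp only [Algebra.smul_def, map_add, map_mul, map_neg] <;> ring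

/-- The operators of a right structure: `E₁₁` and `E₂₂` act coefficientwise by `-A` and `-B`; with
`H` half of `A + B`, the matrix `C` acts on functions by `ε u D* H` and `D` by `ε v C* H`. -/
def rightOp (A B H : Derivation ℝ R R) (u v : R) (ε : ℝ) : gl →ₗ[ℝ] (Gr R →ₗ[ℝ] Gr R) where
  toFun X := superDer (-(X 0 0 • A + X 1 1 • B)) (((ε * X 1 0) • v) • H) (((ε * X 0 1) • u) • H)
    0 0 (-((ε * X 0 1) • u)) (-((ε * X 1 0) • v))
  map_add' X Z := by
    refine LinearMap.ext fun F => ?_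
    ext <;> simp [re_superDer, imI_superDer, imJ_superDer, imK_superDer] <;>
      simp only [Algebra.smul_def, map_add, map_mul, map_neg] <;> ring
  map_smul' r X := by
    refine LinearMap.ext fun F => ?_
    ext <;> simp [re_superDer, imI_superDer, imJ_superDer, imK_superDer] <;>
      simp only [Algebra.smul_def, map_add, map_mul, map_neg] <;> ring

variable {A B Y Y' H : Derivation ℝ R R} {u v : R} {ε ε' : ℝ}

lemma leftOp_even {X : gl} (hX : X ∈ glPart 0) :
    leftOp A B Y Y' ε X = superDer (X 0 0 • A + X 1 1 • B) 0 0
      (algebraMap ℝ R (X 1 1 - X 0 0)) (algebraMap ℝ R (X 0 0 - X 1 1)) 0 0 := by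
  obtain ⟨h1, h2⟩ := mem_glPart_zero.1 hX
  simp [leftOp, h1, h2]

lemma leftOp_odd {X : gl} (hX : X ∈ glPart 1) :
    leftOp A B Y Y' ε X = superDer 0 ((ε * X 1 0) • Y') ((ε * X 0 1) • Y) 0 0
    (algebraMap ℝ R (ε * X 0 1)) (algebraMap ℝ R (ε * X 1 0)) := by
  obtain ⟨h1, h2⟩ := mem_glPart_one.1 hX
  simp [leftOp, h1, h2]

lemma rightOp_even {X : gl} (hX : X ∈ glPart 0) :
    rightOp A B H u v ε X = superDer (-(X 0 0 • A + X 1 1 • B)) 0 0 0 0 0 0 := by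
  obtain ⟨h1, h2⟩ := mem_glPart_zero.1 hX
  simp [rightOp, h1, h2]

lemma rightOp_odd {X : gl} (hX : X ∈ glPart 1) :
    rightOp A B H u v ε X = superDer 0 (((ε * X 1 0) • v) • H) (((ε * X 0 1) • u) • H)
      0 0 (-((ε * X 0 1) • u)) (-((ε * X 1 0) • v)) := by
  obtain ⟨h1, h2⟩ := mem_glPart_one.1 hX
  simp [rightOp, h1, h2]

lemma superDer_parity_even (V : Derivation ℝ R R) (l m : R) {q : ZMod 2} {F : Gr R}
    (hF : F ∈ grPart R q) : superDer V 0 0 l m 0 0 F ∈ grPart R q := by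
  revert hF
  refine forall_parity (P := fun q => F ∈ grPart R q → _ ∈ grPart R q) ?_ ?_ q
  all_goals
    simp only [mem_grPart_zero, mem_grPart_one]
    rintro ⟨h1, h2⟩
    simp [re_superDer, imI_superDer, imJ_superDer, imK_superDer, h1, h2]

lemma superDer_parity_odd (V₁ V₂ : Derivation ℝ R R) (r s : R) {q : ZMod 2} {F : Gr R}
    (hF : F ∈ grPart R q) : superDer 0 V₁ V₂ 0 0 r s F ∈ grPart R (1 + q) := by
  revert hF
  refine forall_parity (P := fun q => F ∈ grPart R q → _ ∈ grPart R (1 + q)) ?_ ?_ q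
  · simp only [mem_grPart_zero, add_zero, mem_grPart_one]
    rintro ⟨h1, h2⟩
    simp [re_superDer, imI_superDer, imJ_superDer, imK_superDer, h1, h2]
  · rw [show (1 : ZMod 2) + 1 = 0 from rfl]
    simp only [mem_grPart_zero, mem_grPart_one]
    rintro ⟨h1, h2⟩
    simp [re_superDer, imI_superDer, imJ_superDer, imK_superDer, h1, h2]

/-- The family `T` consists of superderivations of the right parity. -/
structure IsSuperDerFamily (T : gl →ₗ[ℝ] (Gr R →ₗ[ℝ] Gr R)) : Prop where
  even : ∀ X ∈ glPart 0, ∃ V l m, T X = superDer V 0 0 l m 0 0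
  odd : ∀ X ∈ glPart 1, ∃ V₁ V₂ p q, T X = superDer 0 V₁ V₂ 0 0 p q

lemma IsSuperDerFamily.parity {T : gl →ₗ[ℝ] (Gr R →ₗ[ℝ] Gr R)} (hT : IsSuperDerFamily T)
    (p q : ZMod 2) {X : gl} (hX : X ∈ glPart p) {F : Gr R} (hF : F ∈ grPart R q) :
    T X F ∈ grPart R (p + q) := by
  revert hX
  refine forall_parity (P := fun p => X ∈ glPart p → _ ∈ grPart R (p + q)) ?_ ?_ p
  · intro hX
    obtain ⟨V, l, m, h⟩ := hT.even X hX
    rw [h, zero_add]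
    exact superDer_parity_even V l m hF
  · intro hX
    obtain ⟨V, l, m, r, h⟩ := hT.odd X hX
    rw [h]
    exact superDer_parity_odd V l m r hF

lemma IsSuperDerFamily.leibniz {T : gl →ₗ[ℝ] (Gr R →ₗ[ℝ] Gr R)} (hT : IsSuperDerFamily T)
    (p q : ZMod 2) {X : gl} (hX : X ∈ glPart p) {F : Gr R} (hF : F ∈ grPart R q) (K : Gr R) :
    T X (F * K) = T X F * K + sgn p q • (F * T X K) := by
  revert hX
  refine forall_parity (P := fun p => X ∈ glPart p → _ = _ + sgn p q • _) ?_ ?_ p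
  · intro hX
    obtain ⟨V, l, m, h⟩ := hT.even X hX
    rw [h, sgn_zero_left, one_smul]
    exact superDer_leibniz_even V l m F K
  · intro hX
    obtain ⟨V, l, m, r, h⟩ := hT.odd X hX
    rw [h]
    revert hF
    refine forall_parity (P := fun q => F ∈ grPart R q → _ = _ + sgn 1 q • _) ?_ ?_ q
    · intro hF
      rw [sgn_zero_right, one_smul]
      exact superDer_leibniz_odd_even V l m r hF K
    · intro hF
      rw [sgn_one_one, neg_one_smul, ← sub_eq_add_neg]
      exact superDer_leibniz_odd_odd V l m r hF K

lemma isSuperDerFamily_leftOp : IsSuperDerFamily (leftOp A B Y Y' ε) :=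
  ⟨fun _ hX => ⟨_, _, _, leftOp_even hX⟩, fun _ hX => ⟨_, _, _, _, leftOp_odd hX⟩⟩

lemma isSuperDerFamily_rightOp : IsSuperDerFamily (rightOp A B H u v ε) :=
  ⟨fun _ hX => ⟨_, _, _, rightOp_even hX⟩, fun _ hX => ⟨_, _, _, _, rightOp_odd hX⟩⟩

lemma sbr_zero_left (p : ZMod 2) (X Z : gl) : sbr 0 p X Z = X * Z - Z * X := by simp [sbr]
lemma sbr_zero_right (p : ZMod 2) (X Z : gl) : sbr p 0 X Z = X * Z - Z * X := by simp [sbr]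
lemma sbr_one_one (X Z : gl) : sbr 1 1 X Z = X * Z + Z * X := by simp [sbr]

/-- The bracket relations follow from those between two even elements, an even and an odd one,
and two odd ones. -/
lemma bracket_of_cases {T : gl →ₗ[ℝ] (Gr R →ₗ[ℝ] Gr R)}
    (h₀₀ : ∀ X ∈ glPart 0, ∀ Z ∈ glPart 0, ∀ F, T (X * Z - Z * X) F = T X (T Z F) - T Z (T X F))
    (h₀₁ : ∀ X ∈ glPart 0, ∀ Z ∈ glPart 1, ∀ F, T (X * Z - Z * X) F = T X (T Z F) - T Z (T X F))
    (h₁₁ : ∀ X ∈ glPart 1, ∀ Z ∈ glPart 1, ∀ F, T (X * Z + Z * X) F = T X (T Z F) + T Z (T X F))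
    (p q : ZMod 2) {X : gl} (hX : X ∈ glPart p) {Z : gl} (hZ : Z ∈ glPart q) (F : Gr R) :
    T (sbr p q X Z) F = T X (T Z F) - sgn p q • T Z (T X F) := by
  revert hX hZ
  refine forall_parity (P := fun p => X ∈ glPart p → Z ∈ glPart q →
    T (sbr p q X Z) F = _ - sgn p q • _) ?_ ?_ p <;>
  refine forall_parity (P := fun q => X ∈ glPart _ → Z ∈ glPart q →
    T (sbr _ q X Z) F = _ - sgn _ q • _) ?_ ?_ q <;>
  intro hX hZ
  · rw [sbr_zero_left, sgn_zero_left, one_smul, h₀₀ X hX Z hZ]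
  · rw [sbr_zero_left, sgn_zero_left, one_smul, h₀₁ X hX Z hZ]
  · rw [sbr_zero_right, sgn_zero_right, one_smul, ← neg_sub (Z * X), map_neg,
      LinearMap.neg_apply, h₀₁ Z hZ X hX, neg_sub]
  · rw [sbr_one_one, sgn_one_one, neg_one_smul, sub_neg_eq_add, h₁₁ X hX Z hZ]

lemma mul_sub_mul_mem_even {X Z : gl} (hX : X ∈ glPart 0) (hZ : Z ∈ glPart 0) :
    X * Z - Z * X ∈ glPart 0 := by
  simp_all [Matrix.mul_apply]

lemma mul_sub_mul_mem_odd {X Z : gl} (hX : X ∈ glPart 0) (hZ : Z ∈ glPart 1) :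
    X * Z - Z * X ∈ glPart 1 := by
  simp_all [Matrix.mul_apply]

lemma mul_add_mul_mem_even {X Z : gl} (hX : X ∈ glPart 1) (hZ : Z ∈ glPart 1) :
    X * Z + Z * X ∈ glPart 0 := by
  simp_all [Matrix.mul_apply]

lemma leftOp_bracket_even_even (hAB : ∀ f, B (A f) = A (B f)) {X : gl} (hX : X ∈ glPart 0)
    {Z : gl} (hZ : Z ∈ glPart 0) (F : Gr R) :
    leftOp A B Y Y' ε (X * Z - Z * X) F = leftOp A B Y Y' ε X (leftOp A B Y Y' ε Z F) -
      leftOp A B Y Y' ε Z (leftOp A B Y Y' ε X F) := by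
  rw [leftOp_even hX, leftOp_even hZ, leftOp_even (mul_sub_mul_mem_even hX hZ)]
  obtain ⟨h1, h2⟩ := mem_glPart_zero.1 hX
  obtain ⟨h3, h4⟩ := mem_glPart_zero.1 hZ
  ext <;> simp [re_superDer, imI_superDer, imJ_superDer, imK_superDer, h1, h2, h3, h4,
    Matrix.mul_apply, Fin.sum_univ_two, hAB] <;> simp only [Algebra.smul_def, map_sub, map_mul]
  all_goals ring

lemma leftOp_bracket_even_odd (hAY : ∀ f, Y (A f) = A (Y f)) (hBY : ∀ f, Y (B f) = B (Y f))
    (hAY' : ∀ f, Y' (A f) = A (Y' f)) (hBY' : ∀ f, Y' (B f) = B (Y' f))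
    {X : gl} (hX : X ∈ glPart 0) {Z : gl} (hZ : Z ∈ glPart 1) (F : Gr R) :
    leftOp A B Y Y' ε (X * Z - Z * X) F = leftOp A B Y Y' ε X (leftOp A B Y Y' ε Z F) -
      leftOp A B Y Y' ε Z (leftOp A B Y Y' ε X F) := by
  rw [leftOp_even hX, leftOp_odd hZ, leftOp_odd (mul_sub_mul_mem_odd hX hZ)]
  obtain ⟨h1, h2⟩ := mem_glPart_zero.1 hX
  obtain ⟨h3, h4⟩ := mem_glPart_one.1 hZ
  ext <;> simp [re_superDer, imI_superDer, imJ_superDer, imK_superDer, h1, h2, h3, h4,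
    Matrix.mul_apply, Fin.sum_univ_two, hAY, hBY, hAY', hBY'] <;>
    simp only [Algebra.smul_def, map_sub, map_mul]
  all_goals ring

lemma leftOp_bracket_odd_odd (hε : ε * ε = 1) (hYY' : ∀ f, Y' (Y f) = Y (Y' f))
    (hAB : ∀ f, Y f + Y' f = A f + B f)
    {X : gl} (hX : X ∈ glPart 1) {Z : gl} (hZ : Z ∈ glPart 1) (F : Gr R) :
    leftOp A B Y Y' ε (X * Z + Z * X) F = leftOp A B Y Y' ε X (leftOp A B Y Y' ε Z F) +
      leftOp A B Y Y' ε Z (leftOp A B Y Y' ε X F) := by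
  have hε' : algebraMap ℝ R ε * algebraMap ℝ R ε = 1 := by rw [← map_mul, hε, map_one]
  rw [leftOp_odd hX, leftOp_odd hZ, leftOp_even (mul_add_mul_mem_even hX hZ)]
  obtain ⟨h1, h2⟩ := mem_glPart_one.1 hX
  obtain ⟨h3, h4⟩ := mem_glPart_one.1 hZ
  ext <;> simp [re_superDer, imI_superDer, imJ_superDer, imK_superDer, h1, h2, h3, h4,
    Matrix.mul_apply, Fin.sum_univ_two, hYY'] <;>
    simp only [Algebra.smul_def, map_mul, map_add]
  · linear_combination (-(algebraMap ℝ R (X 0 1) * algebraMap ℝ R (Z 1 0) +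
      algebraMap ℝ R (X 1 0) * algebraMap ℝ R (Z 0 1)) * (Y F.re + Y' F.re)) * hε' -
      (algebraMap ℝ R (X 0 1) * algebraMap ℝ R (Z 1 0) +
      algebraMap ℝ R (X 1 0) * algebraMap ℝ R (Z 0 1)) * hAB F.re
  · linear_combination (-(algebraMap ℝ R (X 0 1) * algebraMap ℝ R (Z 1 0) +
      algebraMap ℝ R (X 1 0) * algebraMap ℝ R (Z 0 1)) * (Y F.imI + Y' F.imI)) * hε' -
      (algebraMap ℝ R (X 0 1) * algebraMap ℝ R (Z 1 0) +
      algebraMap ℝ R (X 1 0) * algebraMap ℝ R (Z 0 1)) * hAB F.imI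
  · linear_combination (-(algebraMap ℝ R (X 0 1) * algebraMap ℝ R (Z 1 0) +
      algebraMap ℝ R (X 1 0) * algebraMap ℝ R (Z 0 1)) * (Y F.imJ + Y' F.imJ)) * hε' -
      (algebraMap ℝ R (X 0 1) * algebraMap ℝ R (Z 1 0) +
      algebraMap ℝ R (X 1 0) * algebraMap ℝ R (Z 0 1)) * hAB F.imJ
  · linear_combination (-(algebraMap ℝ R (X 0 1) * algebraMap ℝ R (Z 1 0) +
      algebraMap ℝ R (X 1 0) * algebraMap ℝ R (Z 0 1)) * (Y F.imK + Y' F.imK)) * hε' -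
      (algebraMap ℝ R (X 0 1) * algebraMap ℝ R (Z 1 0) +
      algebraMap ℝ R (X 1 0) * algebraMap ℝ R (Z 0 1)) * hAB F.imK

lemma rightOp_bracket_even_even (hAB : ∀ f, B (A f) = A (B f)) {X : gl} (hX : X ∈ glPart 0)
    {Z : gl} (hZ : Z ∈ glPart 0) (F : Gr R) :
    rightOp A B H u v ε (X * Z - Z * X) F = rightOp A B H u v ε X (rightOp A B H u v ε Z F) -
      rightOp A B H u v ε Z (rightOp A B H u v ε X F) := by
  rw [rightOp_even hX, rightOp_even hZ, rightOp_even (mul_sub_mul_mem_even hX hZ)]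
  obtain ⟨h1, h2⟩ := mem_glPart_zero.1 hX
  obtain ⟨h3, h4⟩ := mem_glPart_zero.1 hZ
  ext <;> simp [re_superDer, imI_superDer, imJ_superDer, imK_superDer, h1, h2, h3, h4,
    Matrix.mul_apply, Fin.sum_univ_two, hAB] <;> simp only [Algebra.smul_def, map_sub, map_mul]
  all_goals ring

/-- The functions and vector fields entering a right structure: `H` is half of `A + B`, the
functions `u` and `v` are inverse to each other and have weights `∓1`, `±1` under `A`, `B`. -/
structure RightData (A B H : Derivation ℝ R R) (u v : R) : Prop where
  sum : ∀ f, H f + H f = A f + B f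
  comm_A : ∀ f, H (A f) = A (H f)
  comm_B : ∀ f, H (B f) = B (H f)
  comm : ∀ f, B (A f) = A (B f)
  A_u : A u = -u
  B_u : B u = u
  A_v : A v = v
  B_v : B v = -v
  H_u : H u = 0
  H_v : H v = 0
  mul : u * v = 1

lemma rightOp_bracket_even_odd (h : RightData A B H u v)
    {X : gl} (hX : X ∈ glPart 0) {Z : gl} (hZ : Z ∈ glPart 1) (F : Gr R) :
    rightOp A B H u v ε (X * Z - Z * X) F = rightOp A B H u v ε X (rightOp A B H u v ε Z F) -
      rightOp A B H u v ε Z (rightOp A B H u v ε X F) := by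
  rw [rightOp_even hX, rightOp_odd hZ, rightOp_odd (mul_sub_mul_mem_odd hX hZ)]
  obtain ⟨h1, h2⟩ := mem_glPart_zero.1 hX
  obtain ⟨h3, h4⟩ := mem_glPart_one.1 hZ
  ext <;> simp [re_superDer, imI_superDer, imJ_superDer, imK_superDer, h1, h2, h3, h4,
    Matrix.mul_apply, Fin.sum_univ_two, h.comm_A, h.comm_B, h.A_u, h.A_v, h.B_u, h.B_v] <;>
    simp only [Algebra.smul_def, map_sub, map_mul]
  all_goals ring

lemma rightOp_bracket_odd_odd (hε : ε * ε = 1) (h : RightData A B H u v)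
    {X : gl} (hX : X ∈ glPart 1) {Z : gl} (hZ : Z ∈ glPart 1) (F : Gr R) :
    rightOp A B H u v ε (X * Z + Z * X) F = rightOp A B H u v ε X (rightOp A B H u v ε Z F) +
      rightOp A B H u v ε Z (rightOp A B H u v ε X F) := by
  have hε' : algebraMap ℝ R ε * algebraMap ℝ R ε * u * v = 1 := by
    rw [← map_mul, hε, map_one, one_mul, h.mul]
  rw [rightOp_odd hX, rightOp_odd hZ, rightOp_even (mul_add_mul_mem_even hX hZ)]
  obtain ⟨h1, h2⟩ := mem_glPart_one.1 hX
  obtain ⟨h3, h4⟩ := mem_glPart_one.1 hZ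
  ext <;> simp [re_superDer, imI_superDer, imJ_superDer, imK_superDer, h1, h2, h3, h4,
    Matrix.mul_apply, Fin.sum_univ_two, h.H_u, h.H_v] <;>
    simp only [Algebra.smul_def, map_mul, map_add]
  · linear_combination ((algebraMap ℝ R (X 0 1) * algebraMap ℝ R (Z 1 0) +
      algebraMap ℝ R (X 1 0) * algebraMap ℝ R (Z 0 1)) * (H F.re + H F.re)) * hε' +
      (algebraMap ℝ R (X 0 1) * algebraMap ℝ R (Z 1 0) +
      algebraMap ℝ R (X 1 0) * algebraMap ℝ R (Z 0 1)) * h.sum F.re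
  · linear_combination ((algebraMap ℝ R (X 0 1) * algebraMap ℝ R (Z 1 0) +
      algebraMap ℝ R (X 1 0) * algebraMap ℝ R (Z 0 1)) * (H F.imI + H F.imI)) * hε' +
      (algebraMap ℝ R (X 0 1) * algebraMap ℝ R (Z 1 0) +
      algebraMap ℝ R (X 1 0) * algebraMap ℝ R (Z 0 1)) * h.sum F.imI
  · linear_combination ((algebraMap ℝ R (X 0 1) * algebraMap ℝ R (Z 1 0) +
      algebraMap ℝ R (X 1 0) * algebraMap ℝ R (Z 0 1)) * (H F.imJ + H F.imJ)) * hε' +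
      (algebraMap ℝ R (X 0 1) * algebraMap ℝ R (Z 1 0) +
      algebraMap ℝ R (X 1 0) * algebraMap ℝ R (Z 0 1)) * h.sum F.imJ
  · linear_combination ((algebraMap ℝ R (X 0 1) * algebraMap ℝ R (Z 1 0) +
      algebraMap ℝ R (X 1 0) * algebraMap ℝ R (Z 0 1)) * (H F.imK + H F.imK)) * hε' +
      (algebraMap ℝ R (X 0 1) * algebraMap ℝ R (Z 1 0) +
      algebraMap ℝ R (X 1 0) * algebraMap ℝ R (Z 0 1)) * h.sum F.imK

lemma rightOp_leftOp_even_even (h : RightData A B H u v) {X : gl} (hX : X ∈ glPart 0) {Z : gl}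
    (hZ : Z ∈ glPart 0) (F : Gr R) :
    rightOp A B H u v ε X (leftOp A B H H ε' Z F) =
      leftOp A B H H ε' Z (rightOp A B H u v ε X F) := by
  rw [rightOp_even hX, leftOp_even hZ]
  ext <;> simp [re_superDer, imI_superDer, imJ_superDer, imK_superDer, h.comm] <;>
    simp only [Algebra.smul_def]
  all_goals ring

lemma rightOp_leftOp_even_odd (h : RightData A B H u v) {X : gl} (hX : X ∈ glPart 0) {Z : gl}
    (hZ : Z ∈ glPart 1) (F : Gr R) :
    rightOp A B H u v ε X (leftOp A B H H ε' Z F) =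
      leftOp A B H H ε' Z (rightOp A B H u v ε X F) := by
  rw [rightOp_even hX, leftOp_odd hZ]
  ext <;> simp [re_superDer, imI_superDer, imJ_superDer, imK_superDer, h.comm_A, h.comm_B] <;>
    simp only [Algebra.smul_def]
  all_goals ring

lemma rightOp_leftOp_odd_even (h : RightData A B H u v) {X : gl} (hX : X ∈ glPart 1) {Z : gl}
    (hZ : Z ∈ glPart 0) (F : Gr R) :
    rightOp A B H u v ε X (leftOp A B H H ε' Z F) =
      leftOp A B H H ε' Z (rightOp A B H u v ε X F) := by
  rw [rightOp_odd hX, leftOp_even hZ]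
  ext <;> simp [re_superDer, imI_superDer, imJ_superDer, imK_superDer, h.comm_A, h.comm_B,
    h.A_u, h.B_u, h.A_v, h.B_v] <;>
    simp only [Algebra.smul_def, map_sub, map_mul]
  all_goals ring

lemma rightOp_leftOp_odd_odd (h : RightData A B H u v) {X : gl} (hX : X ∈ glPart 1) {Z : gl}
    (hZ : Z ∈ glPart 1) (F : Gr R) :
    rightOp A B H u v ε X (leftOp A B H H ε' Z F) =
      -leftOp A B H H ε' Z (rightOp A B H u v ε X F) := by
  rw [rightOp_odd hX, leftOp_odd hZ]
  ext <;> simp [re_superDer, imI_superDer, imJ_superDer, imK_superDer, h.H_u, h.H_v] <;>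
    simp only [Algebra.smul_def, map_mul]
  all_goals ring

/-- Left and right structures supercommute. -/
lemma rightOp_leftOp (h : RightData A B H u v) (p q : ZMod 2) {X : gl} (hX : X ∈ glPart p)
    {Z : gl} (hZ : Z ∈ glPart q) (F : Gr R) :
    rightOp A B H u v ε X (leftOp A B H H ε' Z F) =
        sgn p q • leftOp A B H H ε' Z (rightOp A B H u v ε X F) := by
  revert hX hZ
  refine forall_parity (P := fun p => X ∈ glPart p → Z ∈ glPart q →
    rightOp A _ H u v ε _ _ = sgn p q • _) ?_ ?_ p <;>
  refine forall_parity (P := fun q => X ∈ glPart _ → Z ∈ glPart q →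
    rightOp A _ H u v ε _ _ = sgn _ q • _) ?_ ?_ q <;>
  intro hX hZ
  · rw [sgn_zero_left, one_smul, rightOp_leftOp_even_even h hX hZ]
  · rw [sgn_zero_left, one_smul, rightOp_leftOp_even_odd h hX hZ]
  · rw [sgn_zero_right, one_smul, rightOp_leftOp_odd_even h hX hZ]
  · rw [sgn_one_one, neg_one_smul, rightOp_leftOp_odd_odd h hX hZ]

end Algebra

/-! ### The left and right structures on `(ℝˣ)²` -/

/-- A function which is multiplied by `exp (a v₁ + b v₂)` under translation by `expPair v` is an
eigenvector of all invariant derivations. -/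
lemma invDer_eq_smul (f : Fn U) (χ : G → ℝ) (a b : ℝ) (hf : ∀ x : U, f x = χ x)
    (hχ : ∀ g w, χ (g * expPair w) = χ g * Real.exp (a * w.1 + b * w.2)) (v : ℝ × ℝ) :
    invDer v f = (a * v.1 + b * v.2) • f := by
  ext x
  have h1 : expCoord f x =ᶠ[nhds 0] fun w => χ x * Real.exp (a * w.1 + b * w.2) := by
    filter_upwards [eventually_mul_expPair_mem (U := U) (g := x) (v := 0) (by simp)] with w hw
    rw [expCoord, ext0_of_mem _ hw, hf, hχ]
  have h2 : HasFDerivAt (fun w : ℝ × ℝ => χ x * Real.exp (a * w.1 + b * w.2))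
      (χ x • (Real.exp (a * (0 : ℝ × ℝ).1 + b * (0 : ℝ × ℝ).2) •
        (a • ContinuousLinearMap.fst ℝ ℝ ℝ + b • ContinuousLinearMap.snd ℝ ℝ ℝ))) 0 :=
    (((hasFDerivAt_fst.const_mul a).add (hasFDerivAt_snd.const_mul b)).exp).const_mul _
  have h3 : ((a * v.1 + b * v.2) • f) x = (a * v.1 + b * v.2) * f x := rfl
  rw [invDer_apply, h1.fderiv_eq, h2.fderiv, h3, hf]
  simp [mul_comm, mul_add]

/-- The function `w z⁻¹`. -/
def ratioFn (U : Opens G) : Fn U :=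
  ⟨fun x => ((x.1.2 * x.1.1⁻¹ : ℝˣ) : ℝ), Units.contMDiff_val.comp
    ((contMDiff_snd.mul contMDiff_fst.inv).comp contMDiff_subtype_val)⟩

/-- The function `z w⁻¹`. -/
def ratioFn' (U : Opens G) : Fn U :=
  ⟨fun x => ((x.1.1 * x.1.2⁻¹ : ℝˣ) : ℝ), Units.contMDiff_val.comp
    ((contMDiff_fst.mul contMDiff_snd.inv).comp contMDiff_subtype_val)⟩

lemma ratioFn_apply (x : U) : ratioFn U x = (x.1.2 : ℝ) * (x.1.1 : ℝ)⁻¹ := by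
  rw [← Units.val_inv_eq_inv_val, ← Units.val_mul]; rfl

lemma ratioFn'_apply (x : U) : ratioFn' U x = (x.1.1 : ℝ) * (x.1.2 : ℝ)⁻¹ := by
  rw [← Units.val_inv_eq_inv_val, ← Units.val_mul]; rfl

lemma invDer_ratioFn (v : ℝ × ℝ) : invDer v (ratioFn U) = (v.2 - v.1) • ratioFn U := by
  rw [invDer_eq_smul (ratioFn U) (fun g => (g.2 : ℝ) * (g.1 : ℝ)⁻¹) (-1) 1 ratioFn_apply]
  · congr 1; ring
  · intro g w
    simp [expPair, Real.exp_add, Real.exp_neg]; ring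

lemma invDer_ratioFn' (v : ℝ × ℝ) : invDer v (ratioFn' U) = (v.1 - v.2) • ratioFn' U := by
  rw [invDer_eq_smul (ratioFn' U) (fun g => (g.1 : ℝ) * (g.2 : ℝ)⁻¹) 1 (-1) ratioFn'_apply]
  · congr 1; ring
  · intro g w
    simp [expPair, Real.exp_add, Real.exp_neg]; ring

lemma ratioFn_mul_ratioFn' : ratioFn U * ratioFn' U = 1 := by
  ext x
  rw [ContMDiffMap.coe_mul, Pi.mul_apply, ratioFn_apply, ratioFn'_apply]
  simp only [ContMDiffMap.coe_one, Pi.one_apply]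
  field_simp

lemma invDer_combination (x y : ℝ) (f : Fn U) :
    invDer (x, y) f = x • invDer (1, 0) f + y • invDer (0, 1) f := by
  rw [← invDer_smul, ← invDer_smul, ← invDer_add]; simp

lemma rightData_invDer :
    RightData (invDer (U := U) (1, 0)) (invDer (0, 1)) (invDer (1 / 2, 1 / 2))
      (ratioFn U) (ratioFn' U) where
  sum f := by rw [← invDer_add, ← invDer_add]; norm_num
  comm_A f := invDer_comm _ _ f
  comm_B f := invDer_comm _ _ f
  comm f := invDer_comm _ _ f
  A_u := by rw [invDer_ratioFn]; simp
  B_u := by rw [invDer_ratioFn]; simp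
  A_v := by rw [invDer_ratioFn']; simp
  B_v := by rw [invDer_ratioFn']; simp
  H_u := by rw [invDer_ratioFn]; simp
  H_v := by rw [invDer_ratioFn']; simp
  mul := ratioFn_mul_ratioFn'

lemma resFn_ratioFn (h : V ≤ U) : resFn h (ratioFn U) = ratioFn V := rfl

lemma resFn_ratioFn' (h : V ≤ U) : resFn h (ratioFn' U) = ratioFn' V := rfl

lemma restr_eq (h : V ≤ U) (F : SF U) :
    SF.restr h F = ⟨resFn h F.re, resFn h F.imI, resFn h F.imJ, resFn h F.imK⟩ := rfl

/-- The operators of the left structure with parameters `y ∈ ℝ²` and `ε = ±1`. On functions, `C`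
acts by `ε D*` times the invariant derivation `y`, and `D` by `ε C*` times the invariant
derivation `(1, 1) - y`. -/
def leftFam (y : ℝ × ℝ) (ε : ℝ) (U : Opens G) : gl →ₗ[ℝ] (SF U →ₗ[ℝ] SF U) :=
  leftOp (invDer (1, 0)) (invDer (0, 1)) (invDer y) (invDer ((1, 1) - y)) ε

/-- The operators of the right structure with parameter `ε = ±1`. -/
def rightFam (ε : ℝ) (U : Opens G) : gl →ₗ[ℝ] (SF U →ₗ[ℝ] SF U) :=
  rightOp (invDer (1, 0)) (invDer (0, 1)) (invDer (1 / 2, 1 / 2)) (ratioFn U) (ratioFn' U) ε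

lemma invDer_one_one_sub (y : ℝ × ℝ) (f : Fn U) :
    invDer y f + invDer ((1, 1) - y) f = invDer (1, 0) f + invDer (0, 1) f := by
  rw [← invDer_add, ← invDer_add]; simp

section components

variable (y : ℝ × ℝ) (ε : ℝ) (X : gl) (F : SF U)

lemma re_leftFam : (leftFam y ε U X F).re = invDer (X 0 0, X 1 1) F.re +
    ε • (X 0 1 • F.imI + X 1 0 • F.imJ) := by
  simp only [leftFam, leftOp, LinearMap.coe_mk, AddHom.coe_mk, re_superDer, Derivation.add_apply,
    Derivation.smul_apply, ← Algebra.smul_def, smul_add, smul_smul,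
    invDer_combination (X 0 0) (X 1 1)]

lemma imI_leftFam : (leftFam y ε U X F).imI = invDer (X 0 0, X 1 1) F.imI +
    (X 1 1 - X 0 0) • F.imI + (ε * X 1 0) • (invDer ((1, 1) - y) F.re - F.imK) := by
  simp only [leftFam, leftOp, LinearMap.coe_mk, AddHom.coe_mk, imI_superDer, Derivation.add_apply,
    Derivation.smul_apply, ← Algebra.smul_def, smul_sub, invDer_combination (X 0 0) (X 1 1)]

lemma imJ_leftFam : (leftFam y ε U X F).imJ = invDer (X 0 0, X 1 1) F.imJ +
    (X 0 0 - X 1 1) • F.imJ + (ε * X 0 1) • (invDer y F.re + F.imK) := by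
  simp only [leftFam, leftOp, LinearMap.coe_mk, AddHom.coe_mk, imJ_superDer, Derivation.add_apply,
    Derivation.smul_apply, ← Algebra.smul_def, smul_add, invDer_combination (X 0 0) (X 1 1)]

lemma imK_leftFam : (leftFam y ε U X F).imK = invDer (X 0 0, X 1 1) F.imK +
    ε • (X 1 0 • invDer ((1, 1) - y) F.imJ - X 0 1 • invDer y F.imI) := by
  have : (algebraMap ℝ (Fn U) (X 1 1 - X 0 0) + algebraMap ℝ (Fn U) (X 0 0 - X 1 1)) = 0 := by
    rw [← map_add]; simp
  simp only [leftFam, leftOp, LinearMap.coe_mk, AddHom.coe_mk, imK_superDer, Derivation.add_apply,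
    Derivation.smul_apply, this, smul_sub, smul_smul, invDer_combination (X 0 0) (X 1 1), zero_mul,
    add_zero]

lemma re_rightFam : (rightFam ε U X F).re = -invDer (X 0 0, X 1 1) F.re -
    ε • (X 0 1 • (ratioFn U * F.imI) + X 1 0 • (ratioFn' U * F.imJ)) := by
  simp only [rightFam, rightOp, LinearMap.coe_mk, AddHom.coe_mk, re_superDer,
    Derivation.add_apply, Derivation.neg_apply,
    Derivation.smul_apply, smul_add, smul_smul, neg_mul, smul_mul_assoc,
    invDer_combination (X 0 0) (X 1 1)]
  ring

lemma imI_rightFam : (rightFam ε U X F).imI = -invDer (X 0 0, X 1 1) F.imI +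
    (ε * X 1 0) • (ratioFn' U * (invDer (1 / 2, 1 / 2) F.re + F.imK)) := by
  simp only [rightFam, rightOp, LinearMap.coe_mk, AddHom.coe_mk, imI_superDer,
    Derivation.add_apply, Derivation.neg_apply, smul_eq_mul,
    Derivation.smul_apply, smul_add, neg_mul, smul_mul_assoc, zero_mul, mul_add,
    invDer_combination (X 0 0) (X 1 1)]
  ring

lemma imJ_rightFam : (rightFam ε U X F).imJ = -invDer (X 0 0, X 1 1) F.imJ +
    (ε * X 0 1) • (ratioFn U * (invDer (1 / 2, 1 / 2) F.re - F.imK)) := by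
  simp only [rightFam, rightOp, LinearMap.coe_mk, AddHom.coe_mk, imJ_superDer,
    Derivation.add_apply, Derivation.neg_apply, smul_eq_mul,
    Derivation.smul_apply, smul_sub, neg_mul, smul_mul_assoc, zero_mul, mul_sub,
    invDer_combination (X 0 0) (X 1 1)]
  ring

lemma imK_rightFam : (rightFam ε U X F).imK = -invDer (X 0 0, X 1 1) F.imK +
    ε • (X 1 0 • (ratioFn' U * invDer (1 / 2, 1 / 2) F.imJ) -
      X 0 1 • (ratioFn U * invDer (1 / 2, 1 / 2) F.imI)) := by
  simp only [rightFam, rightOp, LinearMap.coe_mk, AddHom.coe_mk, imK_superDer,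
    Derivation.add_apply, Derivation.neg_apply, smul_eq_mul,
    Derivation.smul_apply, smul_sub, smul_smul, smul_mul_assoc, zero_mul, add_zero,
    invDer_combination (X 0 0) (X 1 1)]

end components

/-- The left structure with parameters `y` and `ε`. -/
def leftRep (y : ℝ × ℝ) (ε : ℝ) (hε : ε * ε = 1) : SuperRep where
  op := leftFam y ε
  restr_op U V h X F := by
    simp only [restr_eq]
    ext1 <;> simp only [re_leftFam, imI_leftFam, imJ_leftFam, imK_leftFam, map_add, map_sub,
      resFn_smul, invDer_resFn]
  parity U p q X hX F hF := isSuperDerFamily_leftOp.parity p q hX hF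
  leibniz U p q X hX F hF K := isSuperDerFamily_leftOp.leibniz p q hX hF K
  bracket U p q X hX Z hZ F := by
    refine bracket_of_cases (fun X hX Z hZ F => ?_) (fun X hX Z hZ F => ?_)
      (fun X hX Z hZ F => ?_) p q hX hZ F
    · exact leftOp_bracket_even_even (invDer_comm _ _) hX hZ F
    · exact leftOp_bracket_even_odd (invDer_comm _ _) (invDer_comm _ _) (invDer_comm _ _)
        (invDer_comm _ _) hX hZ F
    · exact leftOp_bracket_odd_odd hε (invDer_comm _ _) (invDer_one_one_sub y) hX hZ F

/-- The right structure with parameter `ε`. -/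
def rightRep (ε : ℝ) (hε : ε * ε = 1) : SuperRep where
  op := rightFam ε
  restr_op U V h X F := by
    simp only [restr_eq]
    ext1 <;> simp only [re_rightFam, imI_rightFam, imJ_rightFam, imK_rightFam, map_add, map_sub,
      map_neg, map_mul, resFn_smul, invDer_resFn, resFn_ratioFn, resFn_ratioFn']
  parity U p q X hX F hF := isSuperDerFamily_rightOp.parity p q hX hF
  leibniz U p q X hX F hF K := isSuperDerFamily_rightOp.leibniz p q hX hF K
  bracket U p q X hX Z hZ F := by
    refine bracket_of_cases (fun X hX Z hZ F => ?_) (fun X hX Z hZ F => ?_)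
      (fun X hX Z hZ F => ?_) p q hX hZ F
    · exact rightOp_bracket_even_even (invDer_comm _ _) hX hZ F
    · exact rightOp_bracket_even_odd rightData_invDer hX hZ F
    · exact rightOp_bracket_odd_odd hε rightData_invDer hX hZ F

lemma invDer_eq_zero_of {f : Fn U} (h1 : invDer (1, 0) f = 0) (h2 : invDer (0, 1) f = 0)
    (v : ℝ × ℝ) : invDer v f = 0 := by
  rw [show v = (v.1, v.2) from rfl, invDer_combination, h1, h2]; simp

lemma leftRep_definite (y : ℝ × ℝ) (ε : ℝ) (hε : ε * ε = 1) : (leftRep y ε hε).Definite := by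
  have hε0 : ε ≠ 0 := by rintro rfl; simp at hε
  intro U F
  constructor
  · intro h
    have hre := fun X => congrArg QuaternionAlgebra.re (h X)
    have hJ := fun X => congrArg QuaternionAlgebra.imJ (h X)
    simp only [leftRep, re_leftFam, imJ_leftFam] at hre hJ
    have hf : ∀ v, invDer v F.re = 0 := by
      apply invDer_eq_zero_of
      · simpa using hre !![1, 0; 0, 0]
      · simpa using hre !![0, 0; 0, 1]
    have h00 : invDer ((0, 0) : ℝ × ℝ) F.re = 0 := hf _
    refine ⟨isLocallyConstant_of_invDer _ hf, ?_, ?_, ?_⟩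
    · simpa [matC, hf, hε0] using hre matC
    · simpa [matD, hf, hε0] using hre matD
    · have := hJ matC
      have h0 : invDer ((0, 0) : ℝ × ℝ) F.imJ = 0 := by
        rw [invDer_combination]; simp
      simpa [matC, hf, hε0, h0] using this
  · rintro ⟨hf, hI, hJ, hK⟩ X
    have hf := invDer_of_isLocallyConstant _ hf
    ext1 <;> simp [leftRep, re_leftFam, imI_leftFam, imJ_leftFam, imK_leftFam, hf, hI, hJ, hK]

lemma ratioFn_ne_zero_mul {f : Fn U} (h : ratioFn U * f = 0) : f = 0 := by
  rw [← one_mul f, ← ratioFn_mul_ratioFn', mul_comm (ratioFn U), mul_assoc, h, mul_zero]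

lemma ratioFn'_ne_zero_mul {f : Fn U} (h : ratioFn' U * f = 0) : f = 0 := by
  rw [← one_mul f, ← ratioFn_mul_ratioFn', mul_assoc, h, mul_zero]

lemma rightRep_definite (ε : ℝ) (hε : ε * ε = 1) : (rightRep ε hε).Definite := by
  have hε0 : ε ≠ 0 := by rintro rfl; simp at hε
  intro U F
  constructor
  · intro h
    have hre := fun X => congrArg QuaternionAlgebra.re (h X)
    have hJ := fun X => congrArg QuaternionAlgebra.imJ (h X)
    simp only [rightRep, re_rightFam, imJ_rightFam] at hre hJ
    have hf : ∀ v, invDer v F.re = 0 := by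
      apply invDer_eq_zero_of
      · simpa using hre !![1, 0; 0, 0]
      · simpa using hre !![0, 0; 0, 1]
    refine ⟨isLocallyConstant_of_invDer _ hf, ?_, ?_, ?_⟩
    · apply ratioFn_ne_zero_mul
      simpa [matC, hf, hε0] using hre matC
    · apply ratioFn'_ne_zero_mul
      simpa [matD, hf, hε0] using hre matD
    · apply ratioFn_ne_zero_mul
      have := hJ matC
      have h0 : invDer ((0, 0) : ℝ × ℝ) F.imJ = 0 := by
        rw [invDer_combination]; simp
      simpa [matC, hf, hε0, h0] using this
  · rintro ⟨hf, hI, hJ, hK⟩ X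
    have hf := invDer_of_isLocallyConstant _ hf
    ext1 <;> simp [rightRep, re_rightFam, imI_rightFam, imJ_rightFam, imK_rightFam, hf, hI, hJ, hK]

/-- The left structure with parameters `y` and `ε` as an LRT structure. -/
def leftLRT (y : ℝ × ℝ) (ε : ℝ) (hε : ε * ε = 1) : LRT where
  toSuperRep := leftRep y ε hε
  native U X hX f x := by
    obtain ⟨h1, h2⟩ := mem_glPart_zero.1 hX
    rw [leftD_eq X f x.2]
    ext1 <;> simp [leftRep, SF.eval, SF.fn, re_leftFam, imI_leftFam, imJ_leftFam, imK_leftFam,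
      h1, h2]
  definite := leftRep_definite y ε hε

/-- The right structure with parameter `ε` as an RRT structure. -/
def rightRRT (ε : ℝ) (hε : ε * ε = 1) : RRT where
  toSuperRep := rightRep ε hε
  native U X hX f x := by
    obtain ⟨h1, h2⟩ := mem_glPart_zero.1 hX
    rw [rightD_eq X f x.2]
    ext1 <;> simp [rightRep, SF.eval, SF.fn, re_rightFam, imI_rightFam, imJ_rightFam,
      imK_rightFam, h1, h2]
  definite := rightRep_definite ε hε

/-- The RT structure with parameter `ε`: for `ε = 1` it is the one of Berezin, for `ε = -1` the one
of Kostant and Koszul. -/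
def stdRT (ε : ℝ) (hε : ε * ε = 1) : RT where
  left := leftLRT (1 / 2, 1 / 2) ε hε
  right := rightRRT ε hε
  bilateral U p q X hX Z hZ F := by
    have h := rightOp_leftOp (ε := ε) (ε' := ε) (rightData_invDer (U := U)) p q hX hZ F
    have hy : ((1, 1) - (1 / 2, 1 / 2) : ℝ × ℝ) = (1 / 2, 1 / 2) := by norm_num
    simpa only [leftLRT, rightRRT, leftRep, rightRep, leftFam, rightFam, hy] using h

/-! ### Homogeneous components and extensionality -/

/-- The even part of a matrix. -/
def glEven (X : gl) : gl := !![X 0 0, 0; 0, X 1 1]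

/-- The odd part of a matrix. -/
def glOdd (X : gl) : gl := !![0, X 0 1; X 1 0, 0]

lemma glEven_mem (X : gl) : glEven X ∈ glPart 0 := by simp [glEven]
lemma glOdd_mem (X : gl) : glOdd X ∈ glPart 1 := by simp [glOdd]

lemma glEven_add_glOdd (X : gl) : glEven X + glOdd X = X := by
  ext i j; fin_cases i <;> fin_cases j <;> simp [glEven, glOdd]

lemma matC_mem : matC ∈ glPart 1 := by simp [matC]
lemma matD_mem : matD ∈ glPart 1 := by simp [matD]

lemma eq_smul_matC_add (X : gl) (hX : X ∈ glPart 1) : X = X 0 1 • matC + X 1 0 • matD := by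
  obtain ⟨h1, h2⟩ := mem_glPart_one.1 hX
  ext i j; fin_cases i <;> fin_cases j <;> simp [matC, matD, h1, h2]

lemma exists_homogeneous {R : Type} [CommRing R] (F : Gr R) :
    ∃ F₀ ∈ grPart R 0, ∃ F₁ ∈ grPart R 1, F = F₀ + F₁ :=
  ⟨⟨F.re, 0, 0, F.imK⟩, by simp, ⟨0, F.imI, F.imJ, 0⟩, by simp, by ext <;> simp⟩

lemma linearMap_gl_ext {M : Type*} [AddCommGroup M] [Module ℝ M] {S T : gl →ₗ[ℝ] M}
    (h : ∀ p : ZMod 2, ∀ X ∈ glPart p, S X = T X) : S = T := by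
  ext1 X
  rw [← glEven_add_glOdd X, map_add, map_add, h 0 _ (glEven_mem X), h 1 _ (glOdd_mem X)]

lemma linearMap_gr_ext {R : Type} [CommRing R] [Algebra ℝ R] {M : Type*} [AddCommGroup M]
    [Module ℝ M] {S T : Gr R →ₗ[ℝ] M}
    (h : ∀ q : ZMod 2, ∀ F ∈ grPart R q, S F = T F) : S = T := by
  refine LinearMap.ext fun F => ?_
  obtain ⟨F₀, h₀, F₁, h₁, rfl⟩ := exists_homogeneous F
  rw [map_add, map_add, h 0 _ h₀, h 1 _ h₁]

/-- An RT structure is determined by the two families of operators on homogeneous arguments. -/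
lemma RT.ext_homogeneous {S T : RT}
    (hl : ∀ U, ∀ p q : ZMod 2, ∀ X ∈ glPart p, ∀ F ∈ grPart (Fn U) q,
      S.left.op U X F = T.left.op U X F)
    (hr : ∀ U, ∀ p q : ZMod 2, ∀ X ∈ glPart p, ∀ F ∈ grPart (Fn U) q,
      S.right.op U X F = T.right.op U X F) : S = T := by
  apply RT.ext
  · apply LRT.ext
    funext U
    exact linearMap_gl_ext fun p X hX => linearMap_gr_ext fun q F hF => hl U p q X hX F hF
  · apply RRT.ext
    funext U
    exact linearMap_gl_ext fun p X hX => linearMap_gr_ext fun q F hF => hr U p q X hX F hF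

/-! ### The enveloping algebra -/

lemma envι_mul (p q : ZMod 2) {X Y : gl} (hX : X ∈ glPart p) (hY : Y ∈ glPart q) :
    envι X * envι Y = envι (sbr p q X Y) + sgn p q • (envι Y * envι X) := by
  have := RingQuot.mkAlgHom_rel ℝ (EnvRel.rel p q X Y hX hY)
  simpa [envι] using! this

@[elab_as_elim]
lemma Env.induction {P : Env → Prop} (algebraMap : ∀ r : ℝ, P (algebraMap ℝ Env r))
    (ι : ∀ X : gl, P (envι X)) (mul : ∀ a b, P a → P b → P (a * b))
    (add : ∀ a b, P a → P b → P (a + b)) (Z : Env) : P Z := by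
  obtain ⟨T, rfl⟩ := RingQuot.mkAlgHom_surjective ℝ EnvRel Z
  induction T using TensorAlgebra.induction with
  | algebraMap r => simpa using! algebraMap r
  | ι x => exact ι x
  | mul a b ha hb => rw [map_mul]; exact mul _ _ ha hb
  | add a b ha hb => rw [map_add]; exact add _ _ ha hb

lemma env_neg_one_smul (Z : Env) : (-1 : ℝ) • Z = -Z := neg_one_smul ℝ Z

lemma env_eq_zero_of_eq_neg {Z : Env} (h : Z = -Z) : Z = 0 := by
  have h2 : Z = (1 / 2 : ℝ) • (Z + Z) := by rw [← two_smul ℝ Z, smul_smul]; norm_num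
  rw [h2]
  nth_rw 1 [h]
  simp

lemma envι_matC_sq : envι matC * envι matC = 0 := by
  have h := envι_mul 1 1 matC_mem matC_mem
  have h0 : sbr 1 1 matC matC = 0 := by
    rw [sbr_one_one]; ext i j; fin_cases i <;> fin_cases j <;> simp [matC]
  rw [h0, map_zero, zero_add, sgn_one_one, env_neg_one_smul] at h
  exact env_eq_zero_of_eq_neg h

lemma envι_matD_sq : envι matD * envι matD = 0 := by
  have h := envι_mul 1 1 matD_mem matD_mem
  have h0 : sbr 1 1 matD matD = 0 := by
    rw [sbr_one_one]; ext i j; fin_cases i <;> fin_cases j <;> simp [matD]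
  rw [h0, map_zero, zero_add, sgn_one_one, env_neg_one_smul] at h
  exact env_eq_zero_of_eq_neg h

lemma envι_matC_matD : envι matC * envι matD = envι 1 - envι matD * envι matC := by
  have h := envι_mul 1 1 matC_mem matD_mem
  have h0 : sbr 1 1 matC matD = 1 := by
    rw [sbr_one_one]
    ext i j; fin_cases i <;> fin_cases j <;> simp [matC, matD]
  rw [h0, sgn_one_one, env_neg_one_smul, ← sub_eq_add_neg] at h
  exact h

lemma one_mem_glPart : (1 : gl) ∈ glPart 0 := by simp

/-- The elements `X₁ ⋯ Xₙ W` of the enveloping algebra with all `Xᵢ` even and `W` one of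
`1`, `C`, `D`, `γ(C ∧ D)`. -/
inductive EnvMonomial : Env → Prop
  | one : EnvMonomial 1
  | C : EnvMonomial (envι matC)
  | D : EnvMonomial (envι matD)
  | CD : EnvMonomial gammaCD
  | mul (X : gl) (hX : X ∈ glPart 0) (Z : Env) (hZ : EnvMonomial Z) : EnvMonomial (envι X * Z)

lemma mem_span_even_mul {X : gl} (hX : X ∈ glPart 0) {Z : Env}
    (hZ : Z ∈ Submodule.span ℝ {Z | EnvMonomial Z}) :
    envι X * Z ∈ Submodule.span ℝ {Z | EnvMonomial Z} := by
  induction hZ using Submodule.span_induction with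
  | mem Z hZ => exact Submodule.subset_span (.mul X hX Z hZ)
  | zero => simp
  | add a b _ _ ha hb => rw [mul_add]; exact Submodule.add_mem _ ha hb
  | smul r a _ ha => rw [mul_smul_comm]; exact Submodule.smul_mem _ r ha

/-- If left multiplication by the odd element `X` maps `1, C, D, γ(C ∧ D)` into the span of the
monomials, then it preserves this span, provided that `X` is an eigenvector of `ad 𝔤₀`. -/
lemma mem_span_odd_mul {X : gl} (hX : X ∈ glPart 1)
    (had : ∀ Y ∈ glPart 0, ∃ c : ℝ, X * Y - Y * X = c • X)
    (h1 : envι X * 1 ∈ Submodule.span ℝ {Z | EnvMonomial Z})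
    (hC : envι X * envι matC ∈ Submodule.span ℝ {Z | EnvMonomial Z})
    (hD : envι X * envι matD ∈ Submodule.span ℝ {Z | EnvMonomial Z})
    (hCD : envι X * gammaCD ∈ Submodule.span ℝ {Z | EnvMonomial Z}) {Z : Env}
    (hZ : Z ∈ Submodule.span ℝ {Z | EnvMonomial Z}) :
    envι X * Z ∈ Submodule.span ℝ {Z | EnvMonomial Z} := by
  induction hZ using Submodule.span_induction with
  | mem Z hZ =>
    induction hZ with
    | one => exact h1
    | C => exact hC
    | D => exact hD
    | CD => exact hCD
    | mul Y hY Z _ ih =>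
      obtain ⟨c, hc⟩ := had Y hY
      have h := envι_mul 1 0 hX hY
      rw [sbr_zero_right, hc, sgn_zero_right, one_smul, map_smul] at h
      rw [← mul_assoc, h, add_mul, mul_assoc, smul_mul_assoc]
      exact Submodule.add_mem _ (Submodule.smul_mem _ c ih) (mem_span_even_mul hY ih)
  | zero => simp
  | add a b _ _ ha hb => rw [mul_add]; exact Submodule.add_mem _ ha hb
  | smul r a _ ha => rw [mul_smul_comm]; exact Submodule.smul_mem _ r ha

lemma gammaCD_eq : gammaCD = envι matC * envι matD - (1 / 2 : ℝ) • envι 1 := by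
  rw [gammaCD, envι_matC_matD, sub_sub, ← two_smul ℝ (envι matD * envι matC), smul_sub, smul_smul]
  have : envι 1 = (1 / 2 : ℝ) • envι 1 + (1 / 2 : ℝ) • envι 1 := by
    rw [← add_smul]; norm_num
  nth_rw 2 [this]
  norm_num
  abel

lemma gammaCD_eq' : gammaCD = (1 / 2 : ℝ) • envι 1 - envι matD * envι matC := by
  rw [gammaCD, envι_matC_matD, sub_sub, ← two_smul ℝ (envι matD * envι matC), smul_sub, smul_smul]
  norm_num

lemma envι_one_comm (X : gl) {p : ZMod 2} (hX : X ∈ glPart p) :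
    envι X * envι 1 = envι 1 * envι X := by
  rw [envι_mul p 0 hX one_mem_glPart, sbr_zero_right]; simp

/-- The enveloping algebra is generated by `1, C, D, γ(C ∧ D)` as a left module over the enveloping
algebra of `𝔤₀`: the part of the Poincaré–Birkhoff–Witt theorem that does not need
independence. -/
lemma span_envMonomial : Submodule.span ℝ {Z | EnvMonomial Z} = ⊤ := by
  have hE : ∀ Z, EnvMonomial Z → Z ∈ Submodule.span ℝ {Z | EnvMonomial Z} :=
    fun Z hZ => Submodule.subset_span hZ
  have hCl : ∀ Z ∈ Submodule.span ℝ {Z | EnvMonomial Z},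
      envι matC * Z ∈ Submodule.span ℝ {Z | EnvMonomial Z} := fun Z hZ => by
    refine mem_span_odd_mul matC_mem (fun Y hY => ⟨Y 1 1 - Y 0 0, ?_⟩) ?_ ?_ ?_ ?_ hZ
    · obtain ⟨h1, h2⟩ := mem_glPart_zero.1 hY
      ext i j
      simp only [Matrix.sub_apply, Matrix.mul_apply, Fin.sum_univ_two]
      fin_cases i <;> fin_cases j <;> simp [matC, h1, h2]
    · rw [mul_one]; exact hE _ .C
    · rw [envι_matC_sq]; exact Submodule.zero_mem _
    · rw [sub_eq_iff_eq_add.1 gammaCD_eq.symm]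
      refine Submodule.add_mem _ (hE _ .CD) (Submodule.smul_mem _ _ ?_)
      simpa using hE _ (.mul 1 one_mem_glPart 1 .one)
    · rw [gammaCD_eq, mul_sub, ← mul_assoc, envι_matC_sq, zero_mul, zero_sub, mul_smul_comm,
        envι_one_comm _ matC_mem]
      exact Submodule.neg_mem _ (Submodule.smul_mem _ _ (hE _ (.mul 1 one_mem_glPart _ .C)))
  have hDl : ∀ Z ∈ Submodule.span ℝ {Z | EnvMonomial Z},
      envι matD * Z ∈ Submodule.span ℝ {Z | EnvMonomial Z} := fun Z hZ => by
    refine mem_span_odd_mul matD_mem (fun Y hY => ⟨Y 0 0 - Y 1 1, ?_⟩) ?_ ?_ ?_ ?_ hZ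
    · obtain ⟨h1, h2⟩ := mem_glPart_zero.1 hY
      ext i j
      simp only [Matrix.sub_apply, Matrix.mul_apply, Fin.sum_univ_two]
      fin_cases i <;> fin_cases j <;> simp [matD, h1, h2]
    · rw [mul_one]; exact hE _ .D
    · rw [show envι matD * envι matC = (1 / 2 : ℝ) • envι 1 - gammaCD by rw [gammaCD_eq']; abel]
      refine Submodule.sub_mem _ (Submodule.smul_mem _ _ ?_) (hE _ .CD)
      simpa using hE _ (.mul 1 one_mem_glPart 1 .one)
    · rw [envι_matD_sq]; exact Submodule.zero_mem _
    · rw [gammaCD_eq', mul_sub, ← mul_assoc, envι_matD_sq, zero_mul, sub_zero, mul_smul_comm,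
        envι_one_comm _ matD_mem]
      exact Submodule.smul_mem _ _ (hE _ (.mul 1 one_mem_glPart _ .D))
  have key : ∀ W : Env, ∀ Z ∈ Submodule.span ℝ {Z | EnvMonomial Z},
      W * Z ∈ Submodule.span ℝ {Z | EnvMonomial Z} := by
    intro W
    induction W using Env.induction with
    | algebraMap r =>
      intro Z hZ
      rw [← Algebra.smul_def]
      exact Submodule.smul_mem _ r hZ
    | ι X =>
      intro Z hZ
      rw [← glEven_add_glOdd X, map_add, add_mul]
      refine Submodule.add_mem _ (mem_span_even_mul (glEven_mem X) hZ) ?_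
      rw [eq_smul_matC_add _ (glOdd_mem X), map_add, map_smul, map_smul, add_mul, smul_mul_assoc,
        smul_mul_assoc]
      exact Submodule.add_mem _ (Submodule.smul_mem _ _ (hCl Z hZ))
        (Submodule.smul_mem _ _ (hDl Z hZ))
    | mul a b ha hb =>
      intro Z hZ
      rw [mul_assoc]
      exact ha _ (hb _ hZ)
    | add a b ha hb =>
      intro Z hZ
      rw [add_mul]
      exact Submodule.add_mem _ (ha _ hZ) (hb _ hZ)
  rw [eq_top_iff]
  intro W _
  simpa using key W 1 (hE _ .one)

/-- Kostant's superfunctions are determined by their values on `1, C, D, γ(C ∧ D)`. -/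
lemma kostantFn_ext {Φ Ψ : Env →ₗ[ℝ] Fn U} (hΦ : Φ ∈ KostantFn U) (hΨ : Ψ ∈ KostantFn U)
    (h1 : Φ 1 = Ψ 1) (hC : Φ (envι matC) = Ψ (envι matC)) (hD : Φ (envι matD) = Ψ (envι matD))
    (hCD : Φ gammaCD = Ψ gammaCD) : Φ = Ψ := by
  refine LinearMap.ext_on span_envMonomial fun Z hZ => ?_
  induction hZ with
  | one => exact h1
  | C => exact hC
  | D => exact hD
  | CD => exact hCD
  | mul X hX Z _ ih =>
    ext g
    rw [hΦ X hX, hΨ X hX, ih]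

/-! ### The structure of Kostant and Koszul -/

/-- The action of the enveloping algebra by the operators of the left structure with `ε = 1`, which
are the operators of the structure of Kostant and Koszul up to the sign `(-1)^{|X|}`. -/
def envAction (U : Opens G) : Env →ₐ[ℝ] Module.End ℝ (SF U) :=
  RingQuot.liftAlgHom ℝ ⟨TensorAlgebra.lift ℝ (leftFam (1 / 2, 1 / 2) 1 U), by
    rintro _ _ ⟨p, q, X, Y, hX, hY⟩
    refine LinearMap.ext fun F => ?_
    have := (leftRep (1 / 2, 1 / 2) 1 (by norm_num)).bracket U p q X hX Y hY F
    simp only [map_mul, map_add, map_smul, TensorAlgebra.lift_ι_apply]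
    rw [LinearMap.add_apply]
    exact (sub_eq_iff_eq_add.1 this.symm)⟩

lemma envAction_envι (X : gl) : envAction U (envι X) = leftFam (1 / 2, 1 / 2) 1 U X := by
  simp [envAction, envι]

/-- Koszul's splitting: `κ(F)(Z)` is the numerical part of `Z.F`. -/
def koszul (U : Opens G) : SF U →ₗ[ℝ] (Env →ₗ[ℝ] Fn U) :=
  LinearMap.mk₂ ℝ (fun F Z => (envAction U Z F).re) (fun _ _ _ => by simp) (fun _ _ _ => by simp)
    (fun _ _ _ => by simp) (fun _ _ _ => by simp)

lemma koszul_apply (F : SF U) (Z : Env) : koszul U F Z = (envAction U Z F).re := rfl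

lemma koszul_mem (F : SF U) : koszul U F ∈ KostantFn U := by
  intro X hX Z g
  obtain ⟨h1, h2⟩ := mem_glPart_zero.1 hX
  rw [koszul_apply, map_mul, envAction_envι, Module.End.mul_apply, re_leftFam,
    leftD_eq _ _ g.2, h1, h2]
  simp [koszul_apply]

lemma half_sub : ((1, 1) - (1 / 2, 1 / 2) : ℝ × ℝ) = (1 / 2, 1 / 2) := by norm_num

lemma invDer_zero (f : Fn U) : invDer ((0, 0) : ℝ × ℝ) f = 0 := by
  rw [invDer_combination]; simp

lemma koszul_one (F : SF U) : koszul U F 1 = F.re := by simp [koszul_apply]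

lemma koszul_C (F : SF U) : koszul U F (envι matC) = F.imI := by
  simp [koszul_apply, envAction_envι, re_leftFam, matC, invDer_zero]

lemma koszul_D (F : SF U) : koszul U F (envι matD) = F.imJ := by
  simp [koszul_apply, envAction_envι, re_leftFam, matD, invDer_zero]

lemma koszul_CD (F : SF U) : koszul U F gammaCD = -F.imK := by
  have hC : envAction U (envι matC * envι matD) F =
      leftFam (1 / 2, 1 / 2) 1 U matC (leftFam (1 / 2, 1 / 2) 1 U matD F) := by
    rw [map_mul, envAction_envι, envAction_envι]; rfl
  have hD : envAction U (envι matD * envι matC) F =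
      leftFam (1 / 2, 1 / 2) 1 U matD (leftFam (1 / 2, 1 / 2) 1 U matC F) := by
    rw [map_mul, envAction_envι, envAction_envι]; rfl
  have h : koszul U F gammaCD = (1 / 2 : ℝ) • ((envAction U (envι matC * envι matD) F).re -
      (envAction U (envι matD * envι matC) F).re) := by
    rw [gammaCD, map_smul, map_sub, koszul_apply, koszul_apply]
  rw [h, hC, hD]
  simp only [re_leftFam, imI_leftFam, imJ_leftFam, half_sub]
  simp only [matC, matD, Matrix.of_apply, Matrix.cons_val', Matrix.cons_val_zero,
    Matrix.cons_val_one, Matrix.cons_val_fin_one, invDer_zero]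
  module

lemma isKoszulSplitting_koszul (U : Opens G) : IsKoszulSplitting U (koszul U) where
  bij := by
    refine ⟨fun F _ => koszul_mem F, fun F _ H _ h => ?_, fun Φ hΦ => ?_⟩
    · ext1
      · rw [← koszul_one, h, koszul_one]
      · rw [← koszul_C, h, koszul_C]
      · rw [← koszul_D, h, koszul_D]
      · rw [← neg_inj, ← koszul_CD, h, koszul_CD]
    · refine ⟨⟨Φ 1, Φ (envι matC), Φ (envι matD), -Φ gammaCD⟩, trivial,
        kostantFn_ext (koszul_mem _) hΦ ?_ ?_ ?_ ?_⟩
      · rw [koszul_one]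
      · rw [koszul_C]
      · rw [koszul_D]
      · rw [koszul_CD, neg_neg]
  on_one := koszul_one
  on_C := koszul_C
  on_D := koszul_D
  on_CD := koszul_CD

/-- Koszul's splitting is unique. -/
lemma IsKoszulSplitting.eq_koszul {κ : SF U →ₗ[ℝ] (Env →ₗ[ℝ] Fn U)} (h : IsKoszulSplitting U κ) :
    κ = koszul U := by
  refine LinearMap.ext fun F => kostantFn_ext (h.bij.mapsTo trivial) (koszul_mem F) ?_ ?_ ?_ ?_
  · rw [h.on_one, koszul_one]
  · rw [h.on_C, koszul_C]
  · rw [h.on_D, koszul_D]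
  · rw [h.on_CD, koszul_CD]

lemma leftFam_neg (y : ℝ × ℝ) (p : ZMod 2) {X : gl} (hX : X ∈ glPart p) (F : SF U) :
    leftFam y (-1) U X F = sgn p p • leftFam y 1 U X F := by
  revert hX
  refine forall_parity (P := fun p => X ∈ glPart p → _ = sgn p p • _) ?_ ?_ p
  · intro hX
    obtain ⟨h1, h2⟩ := mem_glPart_zero.1 hX
    ext1 <;> simp [re_leftFam, imI_leftFam, imJ_leftFam, imK_leftFam, h1, h2]
  · intro hX
    obtain ⟨h1, h2⟩ := mem_glPart_one.1 hX
    ext1 <;> simp [re_leftFam, imI_leftFam, imJ_leftFam, imK_leftFam, h1, h2, invDer_zero]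
    all_goals module

/-- The parity operator on superfunctions. -/
def parityOp (U : Opens G) : SF U →ₗ[ℝ] SF U where
  toFun F := ⟨F.re, -F.imI, -F.imJ, F.imK⟩
  map_add' F H := by ext1 <;> simp [add_comm]
  map_smul' r F := by ext1 <;> simp

/-- `parityOp` for odd `p`, the identity for even `p`. -/
def parityPow (p : ZMod 2) (U : Opens G) : SF U →ₗ[ℝ] SF U :=
  if p = 1 then parityOp U else LinearMap.id

lemma parityPow_of_mem {p q : ZMod 2} {F : SF U} (hF : F ∈ grPart (Fn U) q) :
    parityPow p U F = sgn p q • F := by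
  revert hF
  refine forall_parity (P := fun p => F ∈ grPart (Fn U) q → parityPow p U F = sgn p q • F) ?_ ?_ p
  · intro; simp [parityPow]
  refine forall_parity (P := fun q => F ∈ grPart (Fn U) q → parityPow 1 U F = sgn 1 q • F) ?_ ?_ q
  · intro hF
    obtain ⟨h1, h2⟩ := mem_grPart_zero.1 hF
    ext1 <;> simp [parityPow, parityOp, h1, h2]
  · intro hF
    obtain ⟨h1, h2⟩ := mem_grPart_one.1 hF
    ext1 <;> simp [parityPow, parityOp, h1, h2]

lemma sgn_add_right (p q r : ZMod 2) : sgn p (q + r) = sgn p q * sgn p r := by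
  have h2 : (1 : ZMod 2) + 1 = 0 := rfl
  revert p q r
  refine forall_parity ?_ ?_ <;> refine forall_parity ?_ ?_ <;> refine forall_parity ?_ ?_ <;>
    simp [h2]

lemma sgn_mul_self (p q : ZMod 2) : sgn p q * sgn p q = 1 := by
  unfold sgn; split_ifs <;> norm_num

/-- Multiplied by the parity operator, the right operators commute with the left ones. -/
lemma rightFam_parityPow_comm (p : ZMod 2) {X : gl} (hX : X ∈ glPart p) (Z : gl) (F : SF U) :
    rightFam (-1) U X (parityPow p U (leftFam (1 / 2, 1 / 2) 1 U Z F)) =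
      leftFam (1 / 2, 1 / 2) 1 U Z (rightFam (-1) U X (parityPow p U F)) := by
  have key : ∀ q r : ZMod 2, ∀ Z ∈ glPart q, ∀ F ∈ grPart (Fn U) r,
      rightFam (-1) U X (parityPow p U (leftFam (1 / 2, 1 / 2) 1 U Z F)) =
      leftFam (1 / 2, 1 / 2) 1 U Z (rightFam (-1) U X (parityPow p U F)) := by
    intro q r Z hZ F hF
    have h := rightOp_leftOp (ε := -1) (ε' := 1) (rightData_invDer (U := U)) p q hX hZ F
    have hmem : leftFam (1 / 2, 1 / 2) 1 U Z F ∈ grPart (Fn U) (q + r) :=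
      (leftRep (1 / 2, 1 / 2) 1 (by norm_num)).parity U q r Z hZ F hF
    rw [parityPow_of_mem hF, parityPow_of_mem hmem, map_smul, map_smul,
      map_smul, sgn_add_right]
    simp only [leftFam, rightFam, half_sub] at h ⊢
    rw [h, smul_smul, mul_right_comm, sgn_mul_self, one_mul]
  have h1 : ∀ q : ZMod 2, ∀ Z ∈ glPart q,
      rightFam (-1) U X ∘ₗ parityPow p U ∘ₗ leftFam (1 / 2, 1 / 2) 1 U Z =
      leftFam (1 / 2, 1 / 2) 1 U Z ∘ₗ rightFam (-1) U X ∘ₗ parityPow p U :=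
    fun q Z hZ => linearMap_gr_ext fun r F hF => key q r Z hZ F hF
  have h2 := fun q Z hZ => LinearMap.congr_fun (h1 q Z hZ) F
  simp only [LinearMap.comp_apply] at h2
  rw [← glEven_add_glOdd Z]
  simp only [map_add, LinearMap.add_apply]
  rw [h2 0 _ (glEven_mem Z), h2 1 _ (glOdd_mem Z)]

lemma rightFam_parityPow_envAction (p : ZMod 2) {X : gl} (hX : X ∈ glPart p) (Z : Env)
    (F : SF U) :
    rightFam (-1) U X (parityPow p U (envAction U Z F)) =
      envAction U Z (rightFam (-1) U X (parityPow p U F)) := by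
  induction Z using Env.induction generalizing F with
  | algebraMap r => simp [Algebra.algebraMap_eq_smul_one]
  | ι Z => rw [envAction_envι, rightFam_parityPow_comm p hX]
  | mul a b ha hb => rw [map_mul, Module.End.mul_apply, ha, hb, Module.End.mul_apply]
  | add a b ha hb => simp only [map_add, LinearMap.add_apply, ha, hb]

lemma conj_toMat (g : G) (X : gl) : toMat g⁻¹ * X * toMat g =
    !![X 0 0, X 0 1 * ((g.2 : ℝ) * (g.1 : ℝ)⁻¹); X 1 0 * ((g.1 : ℝ) * (g.2 : ℝ)⁻¹), X 1 1] := by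
  ext i j
  simp only [Matrix.mul_apply, Fin.sum_univ_two]
  fin_cases i <;> fin_cases j <;> simp [toMat] <;> field_simp

lemma re_rightFam_parityPow (p : ZMod 2) {X : gl} (hX : X ∈ glPart p) (F : SF U) (g : U) :
    (rightFam (-1) U X (parityPow p U F)).re g =
      -(leftFam (1 / 2, 1 / 2) 1 U (toMat (g : G)⁻¹ * X * toMat (g : G)) F).re g := by
  rw [conj_toMat, re_leftFam, re_rightFam]
  revert hX
  refine forall_parity (P := fun p => X ∈ glPart p →
    (-invDer _ (parityPow p U F).re - (-1 : ℝ) • (X 0 1 • (ratioFn U * (parityPow p U F).imI) +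
      X 1 0 • (ratioFn' U * (parityPow p U F).imJ))) g = _) ?_ ?_ p
  · intro hX
    obtain ⟨h1, h2⟩ := mem_glPart_zero.1 hX
    simp [parityPow, h1, h2]
  · intro hX
    obtain ⟨h1, h2⟩ := mem_glPart_one.1 hX
    simp [parityPow, parityOp, h1, h2, invDer_zero, ratioFn_apply, ratioFn'_apply]
    ring

lemma stdRT_isKostantKoszul (h : (-1 : ℝ) * -1 = 1) : (stdRT (-1) h).IsKostantKoszul := by
  intro U
  refine ⟨koszul U, isKoszulSplitting_koszul U, fun p X hX F Z => ?_, fun p q X hX F hF Z g => ?_⟩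
  · change koszul U (leftFam (1 / 2, 1 / 2) (-1) U X F) Z = _
    rw [leftFam_neg _ p hX, map_smul, LinearMap.smul_apply, koszul_apply, koszul_apply, map_mul,
      envAction_envι, Module.End.mul_apply]
  · change koszul U (rightFam (-1) U X F) Z g = _
    have h1 : F = sgn p q • parityPow p U F := by
      rw [parityPow_of_mem hF, smul_smul, sgn_mul_self, one_smul]
    rw [koszul_apply, koszul_apply, map_mul, envAction_envι, Module.End.mul_apply]
    nth_rw 1 [h1]
    rw [map_smul, map_smul, ← rightFam_parityPow_envAction p hX]
    have := re_rightFam_parityPow p hX (envAction U Z F) g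
    simp [this]

/-- The conditions of Kostant and Koszul determine the RT structure. -/
lemma RT.IsKostantKoszul.eq {S T : RT} (hS : S.IsKostantKoszul) (hT : T.IsKostantKoszul) :
    S = T := by
  have hinj : ∀ U, Function.Injective (koszul U) := fun U =>
    Set.injOn_univ.1 (isKoszulSplitting_koszul U).bij.injOn
  refine RT.ext_homogeneous (fun U p q X hX F hF => ?_) (fun U p q X hX F hF => ?_)
  all_goals
    obtain ⟨κ, hκ, hl, hr⟩ := hS U
    obtain ⟨κ', hκ', hl', hr'⟩ := hT U
    rw [hκ.eq_koszul] at hl hr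
    rw [hκ'.eq_koszul] at hl' hr'
    apply hinj U
    refine LinearMap.ext fun Z => ?_
  · rw [hl p X hX, hl' p X hX]
  · ext g
    rw [hr p q X hX F hF, hr' p q X hX F hF]

/-! ### Points of the supergroup `G̃` -/

/-- The coefficient of `C* ∧ D*` in the product of two odd elements. -/
def wedge (γ δ : Gr ℝ) : ℝ := γ.imI * δ.imJ - γ.imJ * δ.imI

lemma odd_mul_odd {γ δ : Gr ℝ} (hγ : γ ∈ grPart ℝ 1) (hδ : δ ∈ grPart ℝ 1) :
    γ * δ = ⟨0, 0, 0, wedge γ δ⟩ := by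
  obtain ⟨h1, h2⟩ := mem_grPart_one.1 hγ
  obtain ⟨h3, h4⟩ := mem_grPart_one.1 hδ
  ext <;> simp [wedge, h1, h2, h3, h4]

/-- The exponential of an odd supermatrix; the third power of such a matrix is zero. -/
lemma exp_odd {γ δ : Gr ℝ} (hγ : γ ∈ grPart ℝ 1) (hδ : δ ∈ grPart ℝ 1) :
    IsNilpotent.exp (!![0, γ; δ, 0] : Matrix (Fin 2) (Fin 2) (Gr ℝ)) =
      !![⟨1, 0, 0, wedge γ δ / 2⟩, γ; δ, ⟨1, 0, 0, -(wedge γ δ / 2)⟩] := by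
  have hsq : (!![0, γ; δ, 0] : Matrix (Fin 2) (Fin 2) (Gr ℝ)) ^ 2 =
      !![⟨0, 0, 0, wedge γ δ⟩, 0; 0, ⟨0, 0, 0, -wedge γ δ⟩] := by
    rw [sq]
    ext i j : 1
    simp only [Matrix.mul_apply, Fin.sum_univ_two]
    fin_cases i <;> fin_cases j <;> simp [odd_mul_odd hγ hδ, odd_mul_odd hδ hγ]
    simp [wedge]; ring
  obtain ⟨h1, h2⟩ := mem_grPart_one.1 hγ
  obtain ⟨h3, h4⟩ := mem_grPart_one.1 hδ
  have hcube : (!![0, γ; δ, 0] : Matrix (Fin 2) (Fin 2) (Gr ℝ)) ^ 3 = 0 := by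
    rw [pow_succ, hsq]
    ext i j : 1
    simp only [Matrix.mul_apply, Fin.sum_univ_two]
    fin_cases i <;> fin_cases j <;> simp <;> ext <;> simp [h1, h2, h3, h4]
  rw [IsNilpotent.exp_eq_sum hcube]
  simp only [Finset.sum_range_succ, Finset.sum_range_zero, hsq, pow_zero, pow_one]
  ext i j : 1
  fin_cases i <;> fin_cases j <;> ext <;> simp [Rat.smul_def] <;> ring

lemma mat_eq (x : SPoint) : x.mat =
    !![⟨x.g.1, 0, 0, x.g.1 * (x.a + wedge x.γ x.δ / 2)⟩,
        ⟨0, x.g.1 * x.γ.imI, x.g.1 * x.γ.imJ, 0⟩;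
      ⟨0, x.g.2 * x.δ.imI, x.g.2 * x.δ.imJ, 0⟩,
        ⟨x.g.2, 0, 0, x.g.2 * (x.b - wedge x.γ x.δ / 2)⟩] := by
  obtain ⟨h1, h2⟩ := mem_grPart_one.1 x.γ_odd
  obtain ⟨h3, h4⟩ := mem_grPart_one.1 x.δ_odd
  rw [SPoint.mat, exp_odd x.γ_odd x.δ_odd]
  ext i j : 1
  simp only [Matrix.mul_apply, Fin.sum_univ_two]
  fin_cases i <;> fin_cases j <;> ext <;> simp [h1, h2, h3, h4] <;> ring

/-- The point `x` has the coordinates `g, a, b, γ, δ`. -/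
structure SPoint.Is (x : SPoint) (g : G) (a b γ₁ γ₂ δ₁ δ₂ : ℝ) : Prop where
  g_eq : x.g = g
  a_eq : x.a = a
  b_eq : x.b = b
  γ_imI : x.γ.imI = γ₁
  γ_imJ : x.γ.imJ = γ₂
  δ_imI : x.δ.imI = δ₁
  δ_imJ : x.δ.imJ = δ₂

/-- A point of `G̃` is determined by its matrix. -/
lemma mat_eq_iff (x : SPoint) (g : G) (p q γ₁ γ₂ δ₁ δ₂ : ℝ) :
    x.mat = !![⟨g.1, 0, 0, g.1 * p⟩, ⟨0, g.1 * γ₁, g.1 * γ₂, 0⟩;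
        ⟨0, g.2 * δ₁, g.2 * δ₂, 0⟩, ⟨g.2, 0, 0, g.2 * q⟩] ↔
      x.Is g (p - (γ₁ * δ₂ - γ₂ * δ₁) / 2) (q + (γ₁ * δ₂ - γ₂ * δ₁) / 2) γ₁ γ₂ δ₁ δ₂ := by
  rw [mat_eq]
  constructor
  · intro h
    have h00 := congrFun (congrFun h 0) 0
    have h01 := congrFun (congrFun h 0) 1
    have h10 := congrFun (congrFun h 1) 0
    have h11 := congrFun (congrFun h 1) 1
    simp [QuaternionAlgebra.ext_iff] at h00 h01 h10 h11
    obtain ⟨hz, hp⟩ := h00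
    obtain ⟨hw, hq⟩ := h11
    have hg : x.g = g := Prod.ext (Units.ext hz) (Units.ext hw)
    rw [hg] at hp hq h01 h10
    simp at hp hq h01 h10
    refine ⟨hg, ?_, ?_, h01.1, h01.2, h10.1, h10.2⟩
    · rw [← hp, ← h01.1, ← h01.2, ← h10.1, ← h10.2, wedge]; ring
    · rw [← hq, ← h01.1, ← h01.2, ← h10.1, ← h10.2, wedge]; ring
  · rintro ⟨hg, ha, hb, h1, h2, h3, h4⟩
    simp only [hg, ha, hb, h1, h2, h3, h4, wedge]
    ext i j : 1
    fin_cases i <;> fin_cases j <;> ext <;> simp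

lemma cont_eq (F : SF U) (x : SPoint) : cont F x =
    ⟨ext0 F.re x.g, ext0 F.imI x.g * x.γ.imI + ext0 F.imJ x.g * x.δ.imI,
      ext0 F.imI x.g * x.γ.imJ + ext0 F.imJ x.g * x.δ.imJ,
      leftD !![x.a, 0; 0, x.b] F.re x.g + ext0 F.imK x.g * wedge x.δ x.γ⟩ := by
  obtain ⟨h1, h2⟩ := mem_grPart_one.1 x.γ_odd
  obtain ⟨h3, h4⟩ := mem_grPart_one.1 x.δ_odd
  rw [cont, odd_mul_odd x.δ_odd x.γ_odd]
  ext <;> simp [contFn, h1, h2, h3, h4]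

lemma exp_grMat {X : gl} (hX : X ∈ glPart 1) {α : Gr ℝ} (hα : α ∈ grPart ℝ 1) (t : ℝ) :
    IsNilpotent.exp (grMat X (t • α)) = !![1, (t * X 0 1) • α; (t * X 1 0) • α, 1] := by
  obtain ⟨h1, h2⟩ := mem_glPart_one.1 hX
  obtain ⟨h3, h4⟩ := mem_grPart_one.1 hα
  have h : grMat X (t • α) = !![0, (t * X 0 1) • α; (t * X 1 0) • α, 0] := by
    ext i j : 1
    fin_cases i <;> fin_cases j <;> simp [grMat, h1, h2, smul_smul, mul_comm]
  have hw : wedge ((t * X 0 1) • α) ((t * X 1 0) • α) = 0 := by simp [wedge]; ring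
  rw [h, exp_odd (by simp [h3, h4]) (by simp [h3, h4]), hw]
  ext i j : 1
  fin_cases i <;> fin_cases j <;> ext <;> simp

lemma grMat_toMat (g : G) : grMat (toMat g) 1 = !![⟨g.1, 0, 0, 0⟩, 0; 0, ⟨g.2, 0, 0, 0⟩] := by
  ext i j : 1
  fin_cases i <;> fin_cases j <;> ext <;> simp [grMat, toMat]

lemma expG_fst (X : gl) : ((expG X).1 : ℝ) = Real.exp (X 0 0) := rfl
lemma expG_snd (X : gl) : ((expG X).2 : ℝ) = Real.exp (X 1 1) := rfl

/-- Right translation of a point by the odd one-parameter group of `α X`. -/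
lemma mat_mul_exp_odd_iff (x y : SPoint) {X : gl} (hX : X ∈ glPart 1) {α : Gr ℝ}
    (hα : α ∈ grPart ℝ 1) (t : ℝ) :
    y.mat = x.mat * IsNilpotent.exp (grMat X (t • α)) ↔
      y.Is x.g (x.a + t * ((X 1 0 * wedge x.γ α + X 0 1 * wedge x.δ α) / 2))
        (x.b + t * ((X 1 0 * wedge x.γ α + X 0 1 * wedge x.δ α) / 2))
        (x.γ.imI + t * (X 0 1 * α.imI)) (x.γ.imJ + t * (X 0 1 * α.imJ))
        (x.δ.imI + t * (X 1 0 * α.imI)) (x.δ.imJ + t * (X 1 0 * α.imJ)) := by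
  obtain ⟨h3, h4⟩ := mem_grPart_one.1 hα
  have h : x.mat * IsNilpotent.exp (grMat X (t • α)) =
      !![⟨x.g.1, 0, 0, x.g.1 * (x.a + wedge x.γ x.δ / 2 + t * X 1 0 * wedge x.γ α)⟩,
        ⟨0, x.g.1 * (x.γ.imI + t * (X 0 1 * α.imI)), x.g.1 * (x.γ.imJ + t * (X 0 1 * α.imJ)), 0⟩;
      ⟨0, x.g.2 * (x.δ.imI + t * (X 1 0 * α.imI)), x.g.2 * (x.δ.imJ + t * (X 1 0 * α.imJ)), 0⟩,
        ⟨x.g.2, 0, 0, x.g.2 * (x.b - wedge x.γ x.δ / 2 + t * X 0 1 * wedge x.δ α)⟩] := by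
    rw [exp_grMat hX hα, mat_eq]
    ext i j : 1
    simp only [Matrix.mul_apply, Fin.sum_univ_two]
    fin_cases i <;> fin_cases j <;> ext <;> simp [h3, h4, wedge] <;> ring
  rw [h, mat_eq_iff]
  have e1 : ∀ r s r' s' : ℝ, r = r' → s = s' → ∀ g c1 c2 d1 d2,
      (y.Is g r s c1 c2 d1 d2 ↔ y.Is g r' s' c1 c2 d1 d2) := by
    rintro r s _ _ rfl rfl; simp
  apply e1 <;> simp only [wedge] <;> ring

/-- Left translation of a point by the odd one-parameter group of `-α X`. -/
lemma exp_odd_mul_mat_iff (x y : SPoint) {X : gl} (hX : X ∈ glPart 1) {α : Gr ℝ}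
    (hα : α ∈ grPart ℝ 1) (t : ℝ) {c d : ℝ} (hc : c = -(X 0 1 * (x.g.2 * (x.g.1 : ℝ)⁻¹)))
    (hd : d = -(X 1 0 * (x.g.1 * (x.g.2 : ℝ)⁻¹))) :
    y.mat = IsNilpotent.exp (-(grMat X (t • α))) * x.mat ↔
      y.Is x.g (x.a + t * (-(d * wedge x.γ α + c * wedge x.δ α) / 2))
        (x.b + t * (-(d * wedge x.γ α + c * wedge x.δ α) / 2))
        (x.γ.imI + t * (c * α.imI)) (x.γ.imJ + t * (c * α.imJ))
        (x.δ.imI + t * (d * α.imI)) (x.δ.imJ + t * (d * α.imJ)) := by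
  obtain ⟨h3, h4⟩ := mem_grPart_one.1 hα
  have hneg : -(grMat X (t • α)) = grMat X ((-t) • α) := by
    ext i j : 1
    simp [grMat]
  have hz : (x.g.1 : ℝ) ≠ 0 := x.g.1.ne_zero
  have hw : (x.g.2 : ℝ) ≠ 0 := x.g.2.ne_zero
  have h : IsNilpotent.exp (-(grMat X (t • α))) * x.mat =
      !![⟨x.g.1, 0, 0, x.g.1 * (x.a + wedge x.γ x.δ / 2 - t * c * wedge x.δ α)⟩,
        ⟨0, x.g.1 * (x.γ.imI + t * (c * α.imI)), x.g.1 * (x.γ.imJ + t * (c * α.imJ)), 0⟩;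
      ⟨0, x.g.2 * (x.δ.imI + t * (d * α.imI)), x.g.2 * (x.δ.imJ + t * (d * α.imJ)), 0⟩,
        ⟨x.g.2, 0, 0, x.g.2 * (x.b - wedge x.γ x.δ / 2 - t * d * wedge x.γ α)⟩] := by
    rw [hneg, exp_grMat hX hα, mat_eq, hc, hd]
    ext i j : 1
    simp only [Matrix.mul_apply, Fin.sum_univ_two]
    fin_cases i <;> fin_cases j <;> ext <;> simp [h3, h4, wedge] <;> field_simp <;> ring
  rw [h, mat_eq_iff]
  have e1 : ∀ r s r' s' : ℝ, r = r' → s = s' → ∀ g c1 c2 d1 d2,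
      (y.Is g r s c1 c2 d1 d2 ↔ y.Is g r' s' c1 c2 d1 d2) := by
    rintro r s _ _ rfl rfl; simp
  apply e1 <;> simp only [wedge] <;> ring

/-- Right translation of a point by the even one-parameter group of `X`. -/
lemma mat_mul_exp_even_iff (x y : SPoint) (X : gl) (t : ℝ) :
    y.mat = x.mat * grMat (toMat (expG (t • X))) 1 ↔
      y.Is (x.g * expG (t • X)) x.a x.b
        (Real.exp (t * (X 1 1 - X 0 0)) * x.γ.imI) (Real.exp (t * (X 1 1 - X 0 0)) * x.γ.imJ)
        (Real.exp (t * (X 0 0 - X 1 1)) * x.δ.imI)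
        (Real.exp (t * (X 0 0 - X 1 1)) * x.δ.imJ) := by
  have e : ∀ r s : ℝ, Real.exp (t * (r - s)) = Real.exp (t * r) / Real.exp (t * s) := fun r s => by
    rw [mul_sub, Real.exp_sub]
  have h : x.mat * grMat (toMat (expG (t • X))) 1 =
      !![⟨(x.g * expG (t • X)).1, 0, 0,
          (x.g * expG (t • X)).1 * (x.a + wedge x.γ x.δ / 2)⟩,
        ⟨0, (x.g * expG (t • X)).1 * (Real.exp (t * (X 1 1 - X 0 0)) * x.γ.imI),
          (x.g * expG (t • X)).1 * (Real.exp (t * (X 1 1 - X 0 0)) * x.γ.imJ), 0⟩;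
      ⟨0, (x.g * expG (t • X)).2 * (Real.exp (t * (X 0 0 - X 1 1)) * x.δ.imI),
          (x.g * expG (t • X)).2 * (Real.exp (t * (X 0 0 - X 1 1)) * x.δ.imJ), 0⟩,
        ⟨(x.g * expG (t • X)).2, 0, 0,
          (x.g * expG (t • X)).2 * (x.b - wedge x.γ x.δ / 2)⟩] := by
    rw [grMat_toMat, mat_eq]
    ext i j : 1
    simp only [Matrix.mul_apply, Fin.sum_univ_two]
    fin_cases i <;> fin_cases j <;> ext <;> simp [expG_fst, expG_snd, e] <;> field_simp
  rw [h, mat_eq_iff]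
  have e1 : ∀ r s r' s' : ℝ, r = r' → s = s' → ∀ g c1 c2 d1 d2,
      (y.Is g r s c1 c2 d1 d2 ↔ y.Is g r' s' c1 c2 d1 d2) := by
    rintro r s _ _ rfl rfl; simp
  apply e1 <;> simp only [wedge, e] <;> field_simp <;> ring

/-- Left translation of a point by the even one-parameter group of `-X`. -/
lemma exp_even_mul_mat_iff (x y : SPoint) (X : gl) (t : ℝ) :
    y.mat = grMat (toMat (expG (-(t • X)))) 1 * x.mat ↔
      y.Is (x.g * expG (t • -X)) x.a x.b x.γ.imI x.γ.imJ x.δ.imI x.δ.imJ := by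
  have h : grMat (toMat (expG (-(t • X)))) 1 * x.mat =
      !![⟨(x.g * expG (t • -X)).1, 0, 0,
          (x.g * expG (t • -X)).1 * (x.a + wedge x.γ x.δ / 2)⟩,
        ⟨0, (x.g * expG (t • -X)).1 * x.γ.imI, (x.g * expG (t • -X)).1 * x.γ.imJ, 0⟩;
      ⟨0, (x.g * expG (t • -X)).2 * x.δ.imI, (x.g * expG (t • -X)).2 * x.δ.imJ, 0⟩,
        ⟨(x.g * expG (t • -X)).2, 0, 0,
          (x.g * expG (t • -X)).2 * (x.b - wedge x.γ x.δ / 2)⟩] := by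
    rw [grMat_toMat, mat_eq]
    ext i j : 1
    simp only [Matrix.mul_apply, Fin.sum_univ_two]
    fin_cases i <;> fin_cases j <;> ext <;> simp [expG_fst, expG_snd] <;> ring
  rw [h, mat_eq_iff]
  have e1 : ∀ r s r' s' : ℝ, r = r' → s = s' → ∀ g c1 c2 d1 d2,
      (y.Is g r s c1 c2 d1 d2 ↔ y.Is g r' s' c1 c2 d1 d2) := by
    rintro r s _ _ rfl rfl; simp
  apply e1 <;> simp only [wedge] <;> ring

/-! ### The structure of Berezin -/

lemma SPoint.Is.wedge_δ_γ {x : SPoint} {g : G} {a b γ₁ γ₂ δ₁ δ₂ : ℝ}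
    (h : x.Is g a b γ₁ γ₂ δ₁ δ₂) : wedge x.δ x.γ = δ₁ * γ₂ - δ₂ * γ₁ := by
  rw [wedge, h.γ_imI, h.γ_imJ, h.δ_imI, h.δ_imJ]

lemma cont_of_is (F : SF U) {x : SPoint} {g : G} {a b γ₁ γ₂ δ₁ δ₂ : ℝ}
    (h : x.Is g a b γ₁ γ₂ δ₁ δ₂) : cont F x =
    ⟨ext0 F.re g, ext0 F.imI g * γ₁ + ext0 F.imJ g * δ₁, ext0 F.imI g * γ₂ + ext0 F.imJ g * δ₂,
      leftD !![a, 0; 0, b] F.re g + ext0 F.imK g * (δ₁ * γ₂ - δ₂ * γ₁)⟩ := by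
  rw [cont_eq, h.wedge_δ_γ, h.g_eq, h.a_eq, h.b_eq, h.γ_imI, h.γ_imJ, h.δ_imI, h.δ_imJ]

lemma SPoint.is_self (x : SPoint) :
    x.Is x.g x.a x.b x.γ.imI x.γ.imJ x.δ.imI x.δ.imJ := ⟨rfl, rfl, rfl, rfl, rfl, rfl, rfl⟩

lemma leftD_diag (a b : ℝ) (f : Fn U) {g : G} (hg : g ∈ U) :
    leftD !![a, 0; 0, b] f g = a * invDer (1, 0) f ⟨g, hg⟩ + b * invDer (0, 1) f ⟨g, hg⟩ := by
  rw [leftD_eq _ f hg]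
  simp [invDer_combination a b]

lemma invDer_half (f : Fn U) (x : U) :
    invDer (1 / 2, 1 / 2) f x = (invDer (1, 0) f x + invDer (0, 1) f x) / 2 := by
  rw [invDer_combination]
  simp
  ring

/-- The derivative of a continued superfunction along a curve in `G̃` which is affine in the odd
coordinates and moves with equal speed in both nilpotent even coordinates, that is, along the
central element `E₁₁ + E₂₂` of `𝔤₀`. -/
lemma hasDerivGr_odd (F : SF U) {g : G} (hg : g ∈ U) (x : ℝ → SPoint)
    (a b s γ₁ γ₂ δ₁ δ₂ α₁ α₂ c d : ℝ)
    (hx : ∀ t, (x t).Is g (a + t * s) (b + t * s) (γ₁ + t * (c * α₁)) (γ₂ + t * (c * α₂))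
      (δ₁ + t * (d * α₁)) (δ₂ + t * (d * α₂))) :
    HasDerivGr (fun t => cont F (x t))
      ⟨0, (c * F.imI ⟨g, hg⟩ + d * F.imJ ⟨g, hg⟩) * α₁,
        (c * F.imI ⟨g, hg⟩ + d * F.imJ ⟨g, hg⟩) * α₂,
        2 * s * invDer (1 / 2, 1 / 2) F.re ⟨g, hg⟩ +
          F.imK ⟨g, hg⟩ * (c * (δ₁ * α₂ - δ₂ * α₁) + d * (α₁ * γ₂ - α₂ * γ₁))⟩ := by
  have hlin : ∀ p q : ℝ, HasDerivAt (fun t : ℝ => p + t * q) q 0 := fun p q => by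
    simpa using! ((hasDerivAt_id (0 : ℝ)).mul_const q).const_add p
  simp only [HasDerivGr, cont_of_is F (hx _), leftD_diag _ _ _ hg, ext0_of_mem _ hg]
  refine ⟨hasDerivAt_const _ _, ?_, ?_, ?_⟩
  · exact (((hlin γ₁ (c * α₁)).const_mul (F.imI ⟨g, hg⟩)).add
      ((hlin δ₁ (d * α₁)).const_mul (F.imJ ⟨g, hg⟩))).congr_deriv (by ring)
  · exact (((hlin γ₂ (c * α₂)).const_mul (F.imI ⟨g, hg⟩)).add
      ((hlin δ₂ (d * α₂)).const_mul (F.imJ ⟨g, hg⟩))).congr_deriv (by ring)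
  · refine HasDerivAt.congr_deriv ((((hlin a s).mul_const (invDer (1, 0) F.re ⟨g, hg⟩)).add
      ((hlin b s).mul_const (invDer (0, 1) F.re ⟨g, hg⟩))).add
      ((((hlin δ₁ (d * α₁)).mul (hlin γ₂ (c * α₂))).sub
      ((hlin δ₂ (d * α₂)).mul (hlin γ₁ (c * α₁)))).const_mul (F.imK ⟨g, hg⟩))) ?_
    rw [invDer_half]; ring

open Filter Topology in
/-- The derivative of a continued superfunction along a curve in `G̃` which rescales the odd
coordinates with opposite weights. -/
lemma hasDerivGr_even (F : SF U) {g : G} (hg : g ∈ U) (x : ℝ → SPoint) (X : gl)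
    (a b γ₁ γ₂ δ₁ δ₂ r : ℝ)
    (hx : ∀ t, (x t).Is (g * expG (t • X)) a b (Real.exp (t * r) * γ₁) (Real.exp (t * r) * γ₂)
      (Real.exp (t * -r) * δ₁) (Real.exp (t * -r) * δ₂)) :
    HasDerivGr (fun t => cont F (x t))
      ⟨invDer (X 0 0, X 1 1) F.re ⟨g, hg⟩,
        (invDer (X 0 0, X 1 1) F.imI ⟨g, hg⟩ + r * F.imI ⟨g, hg⟩) * γ₁ +
          (invDer (X 0 0, X 1 1) F.imJ ⟨g, hg⟩ - r * F.imJ ⟨g, hg⟩) * δ₁,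
        (invDer (X 0 0, X 1 1) F.imI ⟨g, hg⟩ + r * F.imI ⟨g, hg⟩) * γ₂ +
          (invDer (X 0 0, X 1 1) F.imJ ⟨g, hg⟩ - r * F.imJ ⟨g, hg⟩) * δ₂,
        invDer (a, b) (invDer (X 0 0, X 1 1) F.re) ⟨g, hg⟩ +
          invDer (X 0 0, X 1 1) F.imK ⟨g, hg⟩ * (δ₁ * γ₂ - δ₂ * γ₁)⟩ := by
  have hg0 : g * expG ((0 : ℝ) • X) = g := by rw [zero_smul, expG_eq]; simp [← Prod.zero_eq_mk]
  have hexp : ∀ r p : ℝ, HasDerivAt (fun t : ℝ => Real.exp (t * r) * p) (r * p) 0 := fun r p => by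
    simpa using! (((hasDerivAt_id (0 : ℝ)).mul_const r).exp).mul_const p
  have hmem : ∀ᶠ t : ℝ in 𝓝 0, g * expG (t • X) ∈ U := by
    have hc : Continuous fun t : ℝ => g * expG (t • X) := by
      simp only [expG_eq]
      exact continuous_const.mul (continuous_expPair.comp (by fun_prop))
    have hU : (U : Set G) ∈ 𝓝 (g * expG ((0 : ℝ) • X)) := by
      rw [hg0]; exact U.isOpen.mem_nhds hg
    exact hc.continuousAt.eventually hU
  have hev : (fun t : ℝ => leftD !![a, 0; 0, b] F.re (g * expG (t • X))) =ᶠ[𝓝 0]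
      fun t => ext0 (invDer (a, b) F.re) (g * expG (t • X)) := by
    filter_upwards [hmem] with t ht
    rw [leftD_eq _ _ ht, ext0_of_mem _ ht]; rfl
  have h1 := fun f : Fn U => hasDerivAt_ext0 X f hg
  simp only [HasDerivGr, cont_of_is F (hx _)]
  have hpair : ∀ (f : Fn U) (r p : ℝ),
      HasDerivAt (fun t : ℝ => ext0 f (g * expG (t • X)) * (Real.exp (t * r) * p))
        ((invDer (X 0 0, X 1 1) f ⟨g, hg⟩ + r * f ⟨g, hg⟩) * p) 0 := fun f r p => by
    refine HasDerivAt.congr_deriv ((h1 f).mul (hexp r p)) ?_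
    simp only [hg0, ext0_of_mem f hg, zero_mul, Real.exp_zero]
    ring
  refine ⟨h1 F.re, ?_, ?_, ?_⟩
  · exact ((hpair F.imI r γ₁).add (hpair F.imJ (-r) δ₁)).congr_deriv (by ring)
  · exact ((hpair F.imI r γ₂).add (hpair F.imJ (-r) δ₂)).congr_deriv (by ring)
  · have e : ∀ t : ℝ, Real.exp (t * -r) * δ₁ * (Real.exp (t * r) * γ₂) -
        Real.exp (t * -r) * δ₂ * (Real.exp (t * r) * γ₁) = δ₁ * γ₂ - δ₂ * γ₁ := fun t => by
      have : Real.exp (t * -r) * Real.exp (t * r) = 1 := by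
        rw [← Real.exp_add]; simp
      linear_combination (δ₁ * γ₂ - δ₂ * γ₁) * this
    simp only [e]
    rw [invDer_comm]
    exact ((h1 (invDer (a, b) F.re)).congr_of_eventuallyEq hev).add
      ((h1 F.imK).mul_const (δ₁ * γ₂ - δ₂ * γ₁))

lemma stdRT_isBerezin (h : (1 : ℝ) * 1 = 1) : (stdRT 1 h).IsBerezin where
  left_even U X hX F x hx hmat := by
    obtain ⟨h1, h2⟩ := mem_glPart_zero.1 hX
    have hd := hasDerivGr_even F hx x X (x 0).a (x 0).b (x 0).γ.imI (x 0).γ.imJ (x 0).δ.imI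
      (x 0).δ.imJ (X 1 1 - X 0 0) (fun t => by
        simpa using (mat_mul_exp_even_iff (x 0) (x t) X t).1 (hmat t))
    convert hd using 1
    change cont (leftFam (1 / 2, 1 / 2) 1 U X F) (x 0) = _
    rw [cont_of_is _ (x 0).is_self]
    ext1
    · simp [re_leftFam, ext0_of_mem _ hx, h1, h2]
    · simp [imI_leftFam, imJ_leftFam, ext0_of_mem _ hx, h1, h2, -mul_eq_mul_right_iff]
      ring
    · simp [imI_leftFam, imJ_leftFam, ext0_of_mem _ hx, h1, h2, -mul_eq_mul_right_iff]
      ring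
    · rw [leftD_eq _ _ hx]
      simp [re_leftFam, imK_leftFam, ext0_of_mem _ hx, h1, h2]
  left_odd U X hX α hα F x hx hmat := by
    obtain ⟨h1, h2⟩ := mem_glPart_one.1 hX
    obtain ⟨h3, h4⟩ := mem_grPart_one.1 hα
    have hd := hasDerivGr_odd F hx x _ _ _ _ _ _ _ _ _ _ _
      (fun t => (mat_mul_exp_odd_iff (x 0) (x t) hX hα t).1 (hmat t))
    convert hd using 1
    change cont (leftFam (1 / 2, 1 / 2) 1 U X F) (x 0) * α = _
    rw [cont_of_is _ (x 0).is_self]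
    ext1
    · simp [h3, h4]
    · simp [re_leftFam, ext0_of_mem _ hx, h1, h2, h3, h4, invDer_zero]
    · simp [re_leftFam, ext0_of_mem _ hx, h1, h2, h3, h4, invDer_zero]
    · have e : (1 : ℝ) - 2⁻¹ = 2⁻¹ := by norm_num
      simp [imI_leftFam, imJ_leftFam, ext0_of_mem _ hx, h1, h2, h3, h4, invDer_zero, wedge, e]
      ring
  right_even U X hX F x hx hmat := by
    obtain ⟨h1, h2⟩ := mem_glPart_zero.1 hX
    have hd := hasDerivGr_even F hx x (-X) (x 0).a (x 0).b (x 0).γ.imI (x 0).γ.imJ (x 0).δ.imI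
      (x 0).δ.imJ 0 (fun t => by
        simpa using (exp_even_mul_mat_iff (x 0) (x t) X t).1 (hmat t))
    convert hd using 1
    change cont (rightFam 1 U X F) (x 0) = _
    have hneg : ∀ f : Fn U, invDer (-X 0 0, -X 1 1) f = -invDer (X 0 0, X 1 1) f := fun f => by
      have := invDer_smul (-1) (X 0 0, X 1 1) f
      simpa using! this
    rw [cont_of_is _ (x 0).is_self]
    ext1
    · simp [re_rightFam, ext0_of_mem _ hx, h1, h2, hneg]
    · simp [imI_rightFam, imJ_rightFam, ext0_of_mem _ hx, h1, h2, hneg]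
    · simp [imI_rightFam, imJ_rightFam, ext0_of_mem _ hx, h1, h2, hneg]
    · rw [leftD_eq _ _ hx]
      simp [re_rightFam, imK_rightFam, ext0_of_mem _ hx, h1, h2, hneg]
  right_odd U X hX α hα F x hx hmat := by
    obtain ⟨h1, h2⟩ := mem_glPart_one.1 hX
    obtain ⟨h3, h4⟩ := mem_grPart_one.1 hα
    have hd := hasDerivGr_odd F hx x _ _ _ _ _ _ _ _ _ _ _
      (fun t => (exp_odd_mul_mat_iff (x 0) (x t) hX hα t rfl rfl).1 (hmat t))
    convert hd using 1
    change cont (rightFam 1 U X F) (x 0) * α = _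
    rw [cont_of_is _ (x 0).is_self]
    ext1
    · simp [h3, h4]
    · simp [re_rightFam, ext0_of_mem _ hx, h1, h2, h3, h4, invDer_zero, ratioFn_apply,
        ratioFn'_apply, -mul_eq_mul_right_iff]
      ring
    · simp [re_rightFam, ext0_of_mem _ hx, h1, h2, h3, h4, invDer_zero, ratioFn_apply,
        ratioFn'_apply, -mul_eq_mul_right_iff]
      ring
    · simp [imI_rightFam, imJ_rightFam, ext0_of_mem _ hx, h1, h2, h3, h4, invDer_zero,
        ratioFn_apply, ratioFn'_apply, wedge]
      ring

lemma HasDerivGr.unique {f : ℝ → Gr ℝ} {p q : Gr ℝ} (hp : HasDerivGr f p)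
    (hq : HasDerivGr f q) : p = q :=
  QuaternionAlgebra.ext (hp.1.unique hq.1) (hp.2.1.unique hq.2.1) (hp.2.2.1.unique hq.2.2.1)
    (hp.2.2.2.unique hq.2.2.2)

lemma SPoint.Is.eq {x y : SPoint} {g : G} {a b γ₁ γ₂ δ₁ δ₂ : ℝ}
    (hx : x.Is g a b γ₁ γ₂ δ₁ δ₂) (hy : y.Is g a b γ₁ γ₂ δ₁ δ₂) : x = y := by
  obtain ⟨h1, h2⟩ := mem_grPart_one.1 x.γ_odd
  obtain ⟨h3, h4⟩ := mem_grPart_one.1 x.δ_odd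
  obtain ⟨h1', h2'⟩ := mem_grPart_one.1 y.γ_odd
  obtain ⟨h3', h4'⟩ := mem_grPart_one.1 y.δ_odd
  have hγ : x.γ = y.γ := QuaternionAlgebra.ext (h1.trans h1'.symm) (hx.γ_imI.trans hy.γ_imI.symm)
    (hx.γ_imJ.trans hy.γ_imJ.symm) (h2.trans h2'.symm)
  have hδ : x.δ = y.δ := QuaternionAlgebra.ext (h3.trans h3'.symm) (hx.δ_imI.trans hy.δ_imI.symm)
    (hx.δ_imJ.trans hy.δ_imJ.symm) (h4.trans h4'.symm)
  have hg := hx.g_eq.trans hy.g_eq.symm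
  have ha := hx.a_eq.trans hy.a_eq.symm
  have hb := hx.b_eq.trans hy.b_eq.symm
  cases x
  cases y
  simp_all

lemma SPoint.mat_injective : Function.Injective SPoint.mat := by
  intro x y h
  rw [mat_eq y] at h
  have := (mat_eq_iff x y.g _ _ _ _ _ _).1 h
  refine this.eq ?_
  convert y.is_self using 1 <;> rw [wedge] <;> ring

lemma SPoint.exists_is (g : G) (a b γ₁ γ₂ δ₁ δ₂ : ℝ) :
    ∃ x : SPoint, x.Is g a b γ₁ γ₂ δ₁ δ₂ :=
  ⟨⟨g, a, b, ⟨0, γ₁, γ₂, 0⟩, ⟨0, δ₁, δ₂, 0⟩, by simp, by simp⟩, rfl, rfl, rfl, rfl, rfl, rfl, rfl⟩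

/-- The point of `G̃` over `g` with odd coordinates `γ = C*` and `δ = D*`. -/
def stdPoint (g : G) : SPoint where
  g := g
  a := 0
  b := 0
  γ := ⟨0, 1, 0, 0⟩
  δ := ⟨0, 0, 1, 0⟩
  γ_odd := by simp
  δ_odd := by simp

lemma stdPoint_is (g : G) : (stdPoint g).Is g 0 0 1 0 0 1 := ⟨rfl, rfl, rfl, rfl, rfl, rfl, rfl⟩

lemma cont_stdPoint (F : SF U) {g : G} (hg : g ∈ U) : cont F (stdPoint g) =
    ⟨F.re ⟨g, hg⟩, F.imI ⟨g, hg⟩, F.imJ ⟨g, hg⟩, -F.imK ⟨g, hg⟩⟩ := by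
  rw [cont_of_is F (stdPoint_is g), leftD_diag _ _ _ hg]
  ext <;> simp [ext0_of_mem _ hg]

/-- A superfunction is determined by its continuation to the points `stdPoint g`. -/
lemma eq_of_cont_stdPoint {H K : SF U}
    (h : ∀ g ∈ U, cont H (stdPoint g) = cont K (stdPoint g)) : H = K := by
  have h' : ∀ x : U, _ := fun x => h x x.2
  simp only [cont_stdPoint _ (Subtype.coe_prop _), QuaternionAlgebra.mk.injEq, neg_inj] at h'
  ext1 <;> ext x
  exacts [(h' x).1, (h' x).2.1, (h' x).2.2.1, (h' x).2.2.2]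

/-- If all odd multiples of the continuations agree, then the superfunctions agree up to the
coefficient of `C* ∧ D*`. -/
lemma eq_of_cont_stdPoint_mul {H K : SF U}
    (h : ∀ g ∈ U, ∀ α ∈ grPart ℝ 1, cont H (stdPoint g) * α = cont K (stdPoint g) * α) :
    H.re = K.re ∧ H.imI = K.imI ∧ H.imJ = K.imJ := by
  have h1 : ∀ x : U, _ := fun x => h x x.2 ⟨0, 1, 0, 0⟩ (by simp)
  have h2 : ∀ x : U, _ := fun x => h x x.2 ⟨0, 0, 1, 0⟩ (by simp)
  simp only [cont_stdPoint _ (Subtype.coe_prop _)] at h1 h2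
  refine ⟨?_, ?_, ?_⟩ <;> ext x
  · simpa using congrArg QuaternionAlgebra.imI (h1 x)
  · simpa using congrArg QuaternionAlgebra.imK (h2 x)
  · simpa using congrArg QuaternionAlgebra.imK (h1 x)

lemma exists_curve {x₀ : SPoint} {N : ℝ → Matrix (Fin 2) (Fin 2) (Gr ℝ)}
    (h : ∀ t, ∃ y : SPoint, y.mat = N t) (h0 : N 0 = x₀.mat) :
    ∃ x : ℝ → SPoint, x 0 = x₀ ∧ ∀ t, (x t).mat = N t := by
  choose x hx using h
  exact ⟨x, SPoint.mat_injective (by rw [hx, h0]), hx⟩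

lemma sbr_self_eq_zero {X : gl} (h : X * X = 0) : sbr 1 1 X X = 0 := by
  rw [sbr_one_one, h, add_zero]

/-- An odd operator of square zero in a representation is determined by its values up to the
coefficient of `C* ∧ D*`, provided that it is injective on multiples of `C* ∧ D*`. -/
lemma SuperRep.op_eq_of_sq_zero {ρ σ : SuperRep} {X : gl} (hX : X ∈ glPart 1) (hXX : X * X = 0)
    (h : ∀ F : SF U, (ρ.op U X F).re = (σ.op U X F).re ∧ (ρ.op U X F).imI = (σ.op U X F).imI ∧
      (ρ.op U X F).imJ = (σ.op U X F).imJ)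
    (hinj : ∀ d : Fn U, σ.op U X ⟨0, 0, 0, d⟩ = 0 → d = 0) : ρ.op U X = σ.op U X := by
  have heven : ∀ F ∈ grPart (Fn U) 0, ρ.op U X F = σ.op U X F := fun F hF => by
    have h1 := mem_grPart_one.1 (ρ.parity U 1 0 X hX F hF)
    have h2 := mem_grPart_one.1 (σ.parity U 1 0 X hX F hF)
    exact QuaternionAlgebra.ext (h F).1 (h F).2.1 (h F).2.2 (h1.2.trans h2.2.symm)
  have hsq : ∀ τ : SuperRep, ∀ F, τ.op U X (τ.op U X F) = 0 := fun τ F => by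
    have := τ.bracket U 1 1 X hX X hX F
    rw [sbr_self_eq_zero hXX, map_zero, LinearMap.zero_apply, sgn_one_one, neg_one_smul,
      sub_neg_eq_add, ← two_smul ℝ] at this
    have h2 := congrArg ((1 / 2 : ℝ) • ·) this
    simpa [smul_smul] using h2.symm
  refine linearMap_gr_ext (forall_parity heven fun F hF => ?_)
  have h1 : ρ.op U X F ∈ grPart (Fn U) 0 := ρ.parity U 1 1 X hX F hF
  have hdiff : (⟨0, 0, 0, (ρ.op U X F).imK - (σ.op U X F).imK⟩ : SF U) =
      ρ.op U X F - σ.op U X F := by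
    ext1 <;> simp [h F]
  have hd := hinj ((ρ.op U X F).imK - (σ.op U X F).imK) (by
    rw [hdiff, map_sub, ← heven _ h1, hsq ρ, hsq σ, sub_zero])
  exact QuaternionAlgebra.ext (h F).1 (h F).2.1 (h F).2.2 (sub_eq_zero.1 hd)

lemma matC_sq : matC * matC = 0 := by
  ext i j; fin_cases i <;> fin_cases j <;> simp [matC]

lemma matD_sq : matD * matD = 0 := by
  ext i j; fin_cases i <;> fin_cases j <;> simp [matD]

section

variable {S T : RT} (hS : S.IsBerezin) (hT : T.IsBerezin)
include hS hT

lemma RT.IsBerezin.left_even_eq {X : gl} (hX : X ∈ glPart 0) (F : SF U) :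
    S.left.op U X F = T.left.op U X F := by
  refine eq_of_cont_stdPoint fun g hg => ?_
  obtain ⟨x, hx0, hx⟩ := exists_curve (x₀ := stdPoint g)
    (N := fun t => (stdPoint g).mat * grMat (toMat (expG (t • X))) 1)
    (fun t => by
      simp only [mat_mul_exp_even_iff]
      exact SPoint.exists_is _ _ _ _ _ _ _)
    (((mat_mul_exp_even_iff _ _ X 0).2 (by
      simpa [expG_eq, ← Prod.zero_eq_mk] using! (stdPoint g).is_self)).symm)
  have hg' : (x 0).g ∈ U := by rw [hx0]; exact hg
  rw [← hx0] at hx ⊢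
  exact (hS.left_even U X hX F x hg' hx).unique (hT.left_even U X hX F x hg' hx)

lemma RT.IsBerezin.right_even_eq {X : gl} (hX : X ∈ glPart 0) (F : SF U) :
    S.right.op U X F = T.right.op U X F := by
  refine eq_of_cont_stdPoint fun g hg => ?_
  obtain ⟨x, hx0, hx⟩ := exists_curve (x₀ := stdPoint g)
    (N := fun t => grMat (toMat (expG (-(t • X)))) 1 * (stdPoint g).mat)
    (fun t => by
      simp only [exp_even_mul_mat_iff]
      exact SPoint.exists_is _ _ _ _ _ _ _)
    (((exp_even_mul_mat_iff _ _ X 0).2 (by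
      simpa [expG_eq, ← Prod.zero_eq_mk] using! (stdPoint g).is_self)).symm)
  have hg' : (x 0).g ∈ U := by rw [hx0]; exact hg
  rw [← hx0] at hx ⊢
  exact (hS.right_even U X hX F x hg' hx).unique (hT.right_even U X hX F x hg' hx)

lemma RT.IsBerezin.left_odd_eq {X : gl} (hX : X ∈ glPart 1) (F : SF U) :
    (S.left.op U X F).re = (T.left.op U X F).re ∧
      (S.left.op U X F).imI = (T.left.op U X F).imI ∧
      (S.left.op U X F).imJ = (T.left.op U X F).imJ := by
  refine eq_of_cont_stdPoint_mul fun g hg α hα => ?_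
  obtain ⟨x, hx0, hx⟩ := exists_curve (x₀ := stdPoint g)
    (N := fun t => (stdPoint g).mat * IsNilpotent.exp (grMat X (t • α)))
    (fun t => by
      simp only [mat_mul_exp_odd_iff _ _ hX hα]
      exact SPoint.exists_is _ _ _ _ _ _ _)
    (((mat_mul_exp_odd_iff _ _ hX hα 0).2 (by simpa using (stdPoint g).is_self)).symm)
  have hg' : (x 0).g ∈ U := by rw [hx0]; exact hg
  rw [← hx0] at hx ⊢
  exact (hS.left_odd U X hX α hα F x hg' hx).unique (hT.left_odd U X hX α hα F x hg' hx)

lemma RT.IsBerezin.right_odd_eq {X : gl} (hX : X ∈ glPart 1) (F : SF U) :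
    (S.right.op U X F).re = (T.right.op U X F).re ∧
      (S.right.op U X F).imI = (T.right.op U X F).imI ∧
      (S.right.op U X F).imJ = (T.right.op U X F).imJ := by
  refine eq_of_cont_stdPoint_mul fun g hg α hα => ?_
  obtain ⟨x, hx0, hx⟩ := exists_curve (x₀ := stdPoint g)
    (N := fun t => IsNilpotent.exp (-(grMat X (t • α))) * (stdPoint g).mat)
    (fun t => by
      simp only [exp_odd_mul_mat_iff _ _ hX hα t rfl rfl]
      exact SPoint.exists_is _ _ _ _ _ _ _)
    (((exp_odd_mul_mat_iff _ _ hX hα 0 rfl rfl).2 (by simpa using (stdPoint g).is_self)).symm)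
  have hg' : (x 0).g ∈ U := by rw [hx0]; exact hg
  rw [← hx0] at hx ⊢
  exact (hS.right_odd U X hX α hα F x hg' hx).unique (hT.right_odd U X hX α hα F x hg' hx)

end

/-- The conditions of Berezin determine the RT structure. The derivatives along odd one-parameter
groups leave the coefficient of `C* ∧ D*` undetermined; it is found from `C² = D² = 0`. -/
lemma RT.IsBerezin.eq_stdRT {S : RT} (hS : S.IsBerezin) (h : (1 : ℝ) * 1 = 1) :
    S = stdRT 1 h := by
  have hT := stdRT_isBerezin h
  have hlC : ∀ U, S.left.op U matC = (stdRT 1 h).left.op U matC := fun U =>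
    SuperRep.op_eq_of_sq_zero matC_mem matC_sq (hS.left_odd_eq hT matC_mem) fun d hd => by
      have : (leftFam (1 / 2, 1 / 2) 1 U matC ⟨0, 0, 0, d⟩).imJ = 0 :=
        congrArg QuaternionAlgebra.imJ hd
      simpa [imJ_leftFam, matC] using this
  have hlD : ∀ U, S.left.op U matD = (stdRT 1 h).left.op U matD := fun U =>
    SuperRep.op_eq_of_sq_zero matD_mem matD_sq (hS.left_odd_eq hT matD_mem) fun d hd => by
      have : (leftFam (1 / 2, 1 / 2) 1 U matD ⟨0, 0, 0, d⟩).imI = 0 :=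
        congrArg QuaternionAlgebra.imI hd
      simpa [imI_leftFam, matD] using this
  have hrC : ∀ U, S.right.op U matC = (stdRT 1 h).right.op U matC := fun U =>
    SuperRep.op_eq_of_sq_zero matC_mem matC_sq (hS.right_odd_eq hT matC_mem) fun d hd => by
      have : (rightFam 1 U matC ⟨0, 0, 0, d⟩).imJ = 0 := congrArg QuaternionAlgebra.imJ hd
      exact ratioFn_ne_zero_mul (by simpa [imJ_rightFam, matC] using this)
  have hrD : ∀ U, S.right.op U matD = (stdRT 1 h).right.op U matD := fun U =>
    SuperRep.op_eq_of_sq_zero matD_mem matD_sq (hS.right_odd_eq hT matD_mem) fun d hd => by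
      have : (rightFam 1 U matD ⟨0, 0, 0, d⟩).imI = 0 := congrArg QuaternionAlgebra.imI hd
      exact ratioFn'_ne_zero_mul (by simpa [imI_rightFam, matD] using this)
  refine RT.ext_homogeneous (fun U p q X hX F _ => ?_) (fun U p q X hX F _ => ?_)
  · revert hX
    refine forall_parity (P := fun p => X ∈ glPart p → _) (fun hX => ?_) (fun hX => ?_) p
    · exact hS.left_even_eq hT hX F
    · rw [eq_smul_matC_add X hX]
      simp only [map_add, map_smul, LinearMap.add_apply, hlC, hlD]
  · revert hX
    refine forall_parity (P := fun p => X ∈ glPart p → _) (fun hX => ?_) (fun hX => ?_) p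
    · exact hS.right_even_eq hT hX F
    · rw [eq_smul_matC_add X hX]
      simp only [map_add, map_smul, LinearMap.add_apply, hrC, hrD]

/-! ### Essential constants and planedness of the left structures -/

lemma invDer_algebraMap (v : ℝ × ℝ) (r : ℝ) : invDer v (algebraMap ℝ (Fn U) r) = 0 :=
  Derivation.map_algebraMap _ r

lemma invDer_zF (v : ℝ × ℝ) : invDer v zF.re = v.1 • zF.re := by
  rw [invDer_eq_smul zF.re (fun g => (g.1 : ℝ)) 1 0 (fun _ => rfl)]
  · simp
  · intro g w; simp [expPair]

lemma invDer_wF (v : ℝ × ℝ) : invDer v wF.re = v.2 • wF.re := by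
  rw [invDer_eq_smul wF.re (fun g => (g.2 : ℝ)) 0 1 (fun _ => rfl)]
  · simp
  · intro g w; simp [expPair]

lemma zF_re_apply (x : (⊤ : Opens G)) : zF.re x = (x.1.1 : ℝ) := rfl

lemma wF_re_apply (x : (⊤ : Opens G)) : wF.re x = (x.1.2 : ℝ) := rfl

lemma leftLRT_hasConstants (y : ℝ × ℝ) (ε : ℝ) (hε : ε * ε = 1) :
    (leftLRT y ε hε).HasConstants !![0, ε * y.1; 0, ε * y.2]
      !![ε * (1 - y.1), 0; ε * (1 - y.2), 0] !![ε, 0; 0, ε] := by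
  have h0 : invDer ((0, 0) : ℝ × ℝ) zF.re = 0 := invDer_zero _
  have h1 : invDer ((0, 0) : ℝ × ℝ) wF.re = 0 := invDer_zero _
  have hz1 : zF.imI = 0 := rfl
  have hz2 : zF.imJ = 0 := rfl
  have hz3 : zF.imK = 0 := rfl
  have hw1 : wF.imI = 0 := rfl
  have hw2 : wF.imJ = 0 := rfl
  have hw3 : wF.imK = 0 := rfl
  constructor <;> intro x
  · intro z w
    change (leftFam y ε ⊤ matC zF).eval x = _
    ext1 <;> simp [SF.eval, re_leftFam, imI_leftFam, imJ_leftFam, imK_leftFam, matC, invDer_zero,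
      invDer_zF, hz1, hz2, hz3, zF_re_apply, z, mul_assoc]
  · intro z w
    change (leftFam y ε ⊤ matC wF).eval x = _
    ext1 <;> simp [SF.eval, re_leftFam, imI_leftFam, imJ_leftFam, imK_leftFam, matC, invDer_zero,
      invDer_wF, hw1, hw2, hw3, wF_re_apply, w, mul_assoc]
  · intro z w
    change (leftFam y ε ⊤ matD zF).eval x = _
    ext1 <;> simp [SF.eval, re_leftFam, imI_leftFam, imJ_leftFam, imK_leftFam, matD, invDer_zero,
      invDer_zF, hz1, hz2, hz3, zF_re_apply, z, mul_assoc]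
  · intro z w
    change (leftFam y ε ⊤ matD wF).eval x = _
    ext1 <;> simp [SF.eval, re_leftFam, imI_leftFam, imJ_leftFam, imK_leftFam, matD, invDer_zero,
      invDer_wF, hw1, hw2, hw3, wF_re_apply, w, mul_assoc]
  · change (leftFam y ε ⊤ matC (SF.cov ⊤ 1 0)).re x = _
    simp [re_leftFam, SF.cov, matC]
  · intro z w
    change (leftFam y ε ⊤ matC (SF.cov ⊤ 0 1)).re x = _
    simp [re_leftFam, SF.cov, matC]
  · intro z w
    change (leftFam y ε ⊤ matD (SF.cov ⊤ 1 0)).re x = _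
    simp [re_leftFam, SF.cov, matD]
  · change (leftFam y ε ⊤ matD (SF.cov ⊤ 0 1)).re x = _
    simp [re_leftFam, SF.cov, matD]

lemma sbr_matC {X : gl} (hX : X ∈ glPart 0) : sbr 1 0 matC X = (X 1 1 - X 0 0) • matC := by
  obtain ⟨h1, h2⟩ := mem_glPart_zero.1 hX
  rw [sbr_zero_right]
  ext i j
  simp only [Matrix.sub_apply, Matrix.mul_apply, Fin.sum_univ_two]
  fin_cases i <;> fin_cases j <;> simp [matC, h1, h2]

lemma sbr_matD {X : gl} (hX : X ∈ glPart 0) : sbr 1 0 matD X = (X 0 0 - X 1 1) • matD := by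
  obtain ⟨h1, h2⟩ := mem_glPart_zero.1 hX
  rw [sbr_zero_right]
  ext i j
  simp only [Matrix.sub_apply, Matrix.mul_apply, Fin.sum_univ_two]
  fin_cases i <;> fin_cases j <;> simp [matD, h1, h2]

/-- In coordinates, planedness says that an even `X` acts on `C*` and `D*` by the weights
`± (X₁₁ - X₀₀)`. -/
lemma LRT.planed_iff {S : LRT} : S.Planed ↔ ∀ U : Opens G, ∀ X ∈ glPart 0, ∀ a b : ℝ,
    S.op U X (SF.cov U a b) = SF.cov U (a * (X 1 1 - X 0 0)) (b * (X 0 0 - X 1 1)) := by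
  refine forall₃_congr fun U X hX => forall₂_congr fun a b => ?_
  rw [sbr_matC hX, sbr_matD hX]
  simp [matC, matD]

lemma leftLRT_planed (y : ℝ × ℝ) (ε : ℝ) (hε : ε * ε = 1) : (leftLRT y ε hε).Planed := by
  rw [LRT.planed_iff]
  intro U X hX a b
  obtain ⟨h1, h2⟩ := mem_glPart_zero.1 hX
  change leftFam y ε U X _ = _
  ext1 <;> simp only [re_leftFam, imI_leftFam, imJ_leftFam, imK_leftFam, SF.cov, h1, h2,
    invDer_algebraMap] <;> simp [Algebra.smul_def, mul_comm]

/-! ### Morphisms -/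

lemma SF.ext_eval {F H : SF U} (h : ∀ x, F.eval x = H.eval x) : F = H := by
  ext x
  · exact congrArg QuaternionAlgebra.re (h x)
  · exact congrArg QuaternionAlgebra.imI (h x)
  · exact congrArg QuaternionAlgebra.imJ (h x)
  · exact congrArg QuaternionAlgebra.imK (h x)

lemma re_dualMap (L : gl →ₗ[ℝ] gl) (v : Gr ℝ) : (dualMap L v).re = v.re := by
  simp [dualMap]

lemma imI_dualMap (L : gl →ₗ[ℝ] gl) (v : Gr ℝ) :
    (dualMap L v).imI = v.imI * L matC 0 1 + v.imJ * L matC 1 0 := by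
  simp [dualMap]

lemma imJ_dualMap (L : gl →ₗ[ℝ] gl) (v : Gr ℝ) :
    (dualMap L v).imJ = v.imI * L matD 0 1 + v.imJ * L matD 1 0 := by
  simp [dualMap]

/-- The pull-back of a constant odd superfunction `α` is `α ∘ L`. -/
lemma Mor.pull_cov (m : Mor) (U : Opens G) (a b : ℝ) :
    m.pull U (SF.cov U a b) = SF.cov (preim m.ψ m.smooth U)
      (a * m.L matC 0 1 + b * m.L matC 1 0) (a * m.L matD 0 1 + b * m.L matD 1 0) := by
  refine SF.ext_eval fun x => ?_
  rw [m.compat]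
  have h (V : Opens G) (a b : ℝ) (x : V) : (SF.cov V a b).eval x = ⟨0, a, b, 0⟩ := rfl
  rw [h, h]
  ext1 <;> simp [dualMap]

/-- If the numerical parts of `C.C*` and `D.D*` are `s` and those of `C.D*` and `D.C*` vanish, then
the numerical part of `X.α` is `s α(X)` for odd `X`. -/
lemma LRT.HasConstants.re_op_cov {S : LRT} {MC MD : Matrix (Fin 2) (Fin 2) ℝ} {s : ℝ}
    (h : S.HasConstants MC MD !![s, 0; 0, s]) {X : gl} (hX : X ∈ glPart 1) (a b : ℝ)
    (x : (⊤ : Opens G)) :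
    (S.op ⊤ X (SF.cov ⊤ a b)).re x = s * (a * X 0 1 + b * X 1 0) := by
  have hcov : SF.cov ⊤ a b = a • SF.cov ⊤ 1 0 + b • SF.cov ⊤ 0 1 := by
    ext1 <;> simp [SF.cov, Algebra.algebraMap_eq_smul_one]
  have h1 : (S.op ⊤ matC (SF.cov ⊤ 1 0)).re x = s := h.C_C x
  have h2 : (S.op ⊤ matC (SF.cov ⊤ 0 1)).re x = 0 := by simpa using! h.C_D x
  have h3 : (S.op ⊤ matD (SF.cov ⊤ 1 0)).re x = 0 := by simpa using! h.D_C x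
  have h4 : (S.op ⊤ matD (SF.cov ⊤ 0 1)).re x = s := h.D_D x
  have h5 : (S.op ⊤ X (SF.cov ⊤ a b)).re x =
      X 0 1 * (a * (S.op ⊤ matC (SF.cov ⊤ 1 0)).re x + b * (S.op ⊤ matC (SF.cov ⊤ 0 1)).re x) +
      X 1 0 * (a * (S.op ⊤ matD (SF.cov ⊤ 1 0)).re x +
        b * (S.op ⊤ matD (SF.cov ⊤ 0 1)).re x) := by
    nth_rw 1 [eq_smul_matC_add X hX, hcov]
    simp only [map_add, map_smul, LinearMap.add_apply, LinearMap.smul_apply]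
    change a * (X 0 1 * _ + X 1 0 * _) + b * (X 0 1 * _ + X 1 0 * _) = _
    ring
  rw [h5, h1, h2, h3, h4]
  ring

/-- The sign of the numerical parts of `C.C*` and `D.D*` is invariant under isomorphisms. -/
lemma LRT.HasConstants.not_isomorphic {S T : LRT} {MC MD MC' MD' : Matrix (Fin 2) (Fin 2) ℝ}
    {s : ℝ} (hs : s ≠ 0) (hS : S.HasConstants MC MD !![s, 0; 0, s])
    (hT : T.HasConstants MC' MD' !![-s, 0; 0, -s]) : ¬ S.Isomorphic T := by
  rintro ⟨m, ⟨-, -, hm⟩, heq⟩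
  have key : ∀ X ∈ glPart 1, m.L X 0 1 = 0 := by
    intro X hX
    have h := congrArg (fun F => F.re ⟨1, trivial⟩) (heq ⊤ X (SF.cov ⊤ 1 0))
    rw [m.pull_cov] at h
    have h1 := congrArg QuaternionAlgebra.re
      (m.compat ⊤ (T.op ⊤ (m.L X) (SF.cov ⊤ 1 0)) ⟨1, trivial⟩)
    rw [re_dualMap] at h1
    have h2 := hS.re_op_cov hX (1 * m.L matC 0 1 + 0 * m.L matC 1 0)
      (1 * m.L matD 0 1 + 0 * m.L matD 1 0) ⟨1, trivial⟩
    have h3 := hT.re_op_cov (m.L_even 1 X hX) 1 0 ⟨m.ψ 1, trivial⟩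
    have h4 := (h2.symm.trans h).trans (h1.trans h3)
    have h5 : m.L X 0 1 = X 0 1 * m.L matC 0 1 + X 1 0 * m.L matD 0 1 := by
      nth_rw 1 [eq_smul_matC_add X hX]
      simp
    have h6 : s * (2 * m.L X 0 1) = 0 := by linear_combination h4 + s * h5
    simpa [hs] using h6
  have h0 : m.pull ⊤ (SF.cov ⊤ 1 0) = m.pull ⊤ 0 := by
    rw [m.pull_cov, key _ matC_mem, key _ matD_mem, map_zero]
    ext1 <;> simp [SF.cov]
  have h1 := congrArg (fun F : SF ⊤ => F.imI ⟨1, trivial⟩) ((hm ⊤).1 h0)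
  simp [SF.cov] at h1

/-! ### Invariance of planedness -/

/-- The even part of a morphism of Lie superalgebras underlying an isomorphism is onto, since the
even part of `𝔤` acts faithfully on functions. -/
lemma Mor.exists_even_preimage {m : Mor} (hm : m.IsIso) {S : LRT} {ρ : SuperRep}
    (heq : m.Equivariant S.toSuperRep ρ) {Y : gl} (hY : Y ∈ glPart 0) :
    ∃ X ∈ glPart 0, m.L X = Y := by
  have hinj : ∀ X ∈ glPart 0, m.L X = 0 → X = 0 := by
    intro X hX h
    have h0 : ∀ F : SF ⊤, S.op ⊤ X F = 0 := by
      intro F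
      obtain ⟨H, rfl⟩ := (hm.2.2 ⊤).2 F
      have := heq ⊤ X H
      rwa [h, map_zero, LinearMap.zero_apply, map_zero] at this
    obtain ⟨h1, h2⟩ := mem_glPart_zero.1 hX
    have hz := S.native ⊤ X hX zF.re ⟨1, trivial⟩
    have hw := S.native ⊤ X hX wF.re ⟨1, trivial⟩
    rw [h0, leftD_eq X _ (g := 1) (Opens.mem_top _), invDer_zF] at hz
    rw [h0, leftD_eq X _ (g := 1) (Opens.mem_top _), invDer_wF] at hw
    have hz := congrArg QuaternionAlgebra.re hz
    have hw := congrArg QuaternionAlgebra.re hw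
    have h00 : X 0 0 = 0 := by simpa [SF.eval, zF_re_apply] using! hz.symm
    have h11 : X 1 1 = 0 := by simpa [SF.eval, wF_re_apply] using! hw.symm
    ext i j; fin_cases i <;> fin_cases j <;> simp [*]
  let i : (Fin 2 → ℝ) →ₗ[ℝ] gl := Matrix.diagonalLinearMap (Fin 2) ℝ ℝ
  let N : (Fin 2 → ℝ) →ₗ[ℝ] (Fin 2 → ℝ) := Matrix.diagLinearMap (Fin 2) ℝ ℝ ∘ₗ m.L ∘ₗ i
  have hi : ∀ v, i v ∈ glPart 0 := fun v => by simp [i]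
  have hdiag : ∀ X ∈ glPart 0, X = Matrix.diagonal (Matrix.diag X) := by
    intro X hX
    obtain ⟨h1, h2⟩ := mem_glPart_zero.1 hX
    ext i j; fin_cases i <;> fin_cases j <;> simp [*]
  have hN : Function.Injective N := by
    rw [injective_iff_map_eq_zero]
    intro v hv
    have h1 : m.L (i v) = 0 := by
      rw [hdiag _ (m.L_even 0 _ (hi v)), show Matrix.diag (m.L (i v)) = N v from rfl, hv]
      simp
    exact Matrix.diagonal_injective ((hinj _ (hi v) h1).trans Matrix.diagonal_zero.symm)
  obtain ⟨v, hv⟩ := (LinearMap.injective_iff_surjective.1 hN) (Matrix.diag Y)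
  refine ⟨i v, hi v, ?_⟩
  rw [hdiag _ (m.L_even 0 _ (hi v)), hdiag Y hY, ← hv]
  rfl

/-- The pull-back by an isomorphism intertwines the two actions that planedness prescribes on
constant odd superfunctions. -/
lemma Mor.pull_cov_bracket (m : Mor) (U : Opens G) {X : gl} (hX : X ∈ glPart 0) (a b : ℝ) :
    m.pull U (SF.cov U (a * (m.L X 1 1 - m.L X 0 0)) (b * (m.L X 0 0 - m.L X 1 1))) =
      SF.cov (preim m.ψ m.smooth U)
        ((a * m.L matC 0 1 + b * m.L matC 1 0) * (X 1 1 - X 0 0))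
        ((a * m.L matD 0 1 + b * m.L matD 1 0) * (X 0 0 - X 1 1)) := by
  obtain ⟨h3, h4⟩ := mem_glPart_zero.1 (m.L_even 0 X hX)
  obtain ⟨h5, h6⟩ := mem_glPart_one.1 (m.L_even 1 _ matC_mem)
  obtain ⟨h7, h8⟩ := mem_glPart_one.1 (m.L_even 1 _ matD_mem)
  have hLC := m.L_bracket 1 0 matC matC_mem X hX
  have hLD := m.L_bracket 1 0 matD matD_mem X hX
  rw [sbr_matC hX, map_smul, sbr_zero_right] at hLC
  rw [sbr_matD hX, map_smul, sbr_zero_right] at hLD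
  have c01 := congrFun (congrFun hLC 0) 1
  have c10 := congrFun (congrFun hLC 1) 0
  have d01 := congrFun (congrFun hLD 0) 1
  have d10 := congrFun (congrFun hLD 1) 0
  simp [Matrix.mul_apply, h3, h4, h5, h6, h7, h8] at c01 c10 d01 d10
  rw [m.pull_cov]
  congr 1
  · linear_combination -a * c01 - b * c10
  · linear_combination -a * d01 - b * d10

/-- The dual of the odd part of an isomorphism is onto. -/
lemma Mor.exists_cov {m : Mor} (hm : m.IsIso) (a' b' : ℝ) :
    ∃ a b : ℝ, a * m.L matC 0 1 + b * m.L matC 1 0 = a' ∧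
      a * m.L matD 0 1 + b * m.L matD 1 0 = b' := by
  obtain ⟨F, hF⟩ := (hm.2.2 ⊤).2 (SF.cov _ a' b')
  have h := m.compat ⊤ F ⟨1, trivial⟩
  rw [hF] at h
  have hI := congrArg QuaternionAlgebra.imI h
  have hJ := congrArg QuaternionAlgebra.imJ h
  rw [imI_dualMap] at hI
  rw [imJ_dualMap] at hJ
  exact ⟨_, _, hI.symm, hJ.symm⟩

/-- For an isomorphism every open set is a preimage. -/
lemma Mor.exists_preim_eq {m : Mor} (hm : m.IsIso) (V : Opens G) :
    ∃ U, V = preim m.ψ m.smooth U := by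
  obtain ⟨φ, hφ, hφ'⟩ := Function.bijective_iff_has_inverse.1 hm.1
  have hc : Continuous φ := (hm.2.1 φ hφ').continuous
  refine ⟨⟨φ ⁻¹' V, V.isOpen.preimage hc⟩, ?_⟩
  ext x
  change x ∈ V ↔ φ (m.ψ x) ∈ V
  rw [hφ x]

lemma LRT.Isomorphic.planed_iff {S T : LRT} (h : S.Isomorphic T) : S.Planed ↔ T.Planed := by
  obtain ⟨m, hm, heq⟩ := h
  rw [LRT.planed_iff, LRT.planed_iff]
  constructor
  · intro hS U Y hY a b
    obtain ⟨X, hX, rfl⟩ := m.exists_even_preimage hm heq hY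
    apply (hm.2.2 U).1
    rw [← heq, m.pull_cov, hS _ X hX, m.pull_cov_bracket U hX]
  · intro hT V X hX a' b'
    obtain ⟨U, rfl⟩ := m.exists_preim_eq hm V
    obtain ⟨a, b, rfl, rfl⟩ := m.exists_cov hm a' b'
    rw [← m.pull_cov, heq, hT _ _ (m.L_even 0 X hX), m.pull_cov_bracket U hX]

end RTLie
end

theorem theorem3 :
    -- both constructions define RT Lie supergroup structures
    (∃! K : RTLie.RT, K.IsKostantKoszul) ∧ (∃! B : RTLie.RT, B.IsBerezin) ∧
    -- these are planed, have the stated constants, and are not isomorphic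
    (∀ K B : RTLie.RT, K.IsKostantKoszul → B.IsBerezin →
      K.left.Planed ∧ B.left.Planed ∧
      K.left.HasConstants !![0, -1/2; 0, -1/2] !![-1/2, 0; -1/2, 0] !![-1, 0; 0, -1] ∧
      B.left.HasConstants !![0, 1/2; 0, 1/2] !![1/2, 0; 1/2, 0] !![1, 0; 0, 1] ∧
      ¬ K.left.Isomorphic B.left ∧ ¬ B.left.Isomorphic K.left ∧
      ¬ K.Isomorphic B ∧ ¬ B.Isomorphic K) ∧
    -- the constants found when the square in the odd exponential is taken with weight one (instead
    -- of one half) also define a planed LRT structure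
    (∃ T : RTLie.LRT, T.Planed ∧
      T.HasConstants !![0, 1; 0, 0] !![0, 0; 1, 0] !![1, 0; 0, 1]) ∧
    -- no LRT structures with the respective constants are isomorphic
    (∀ S T : RTLie.LRT,
      S.HasConstants !![0, -1/2; 0, -1/2] !![-1/2, 0; -1/2, 0] !![-1, 0; 0, -1] →
      (T.HasConstants !![0, 1/2; 0, 1/2] !![1/2, 0; 1/2, 0] !![1, 0; 0, 1] ∨
        T.HasConstants !![0, 1; 0, 0] !![0, 0; 1, 0] !![1, 0; 0, 1]) →
      ¬ S.Isomorphic T ∧ ¬ T.Isomorphic S) ∧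
    -- isomorphisms preserve the property of being planed
    (∀ S T : RTLie.LRT, S.Isomorphic T → (S.Planed ↔ T.Planed)) := by
  have hKK : (-1 : ℝ) * -1 = 1 := by norm_num
  have hB : (1 : ℝ) * 1 = 1 := one_mul 1
  have cKK : (RTLie.leftLRT (1 / 2, 1 / 2) (-1) hKK).HasConstants
      !![0, -1/2; 0, -1/2] !![-1/2, 0; -1/2, 0] !![-1, 0; 0, -1] := by
    convert RTLie.leftLRT_hasConstants (1 / 2, 1 / 2) (-1) hKK using 3 <;> norm_num
  have cB : (RTLie.leftLRT (1 / 2, 1 / 2) 1 hB).HasConstants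
      !![0, 1/2; 0, 1/2] !![1/2, 0; 1/2, 0] !![1, 0; 0, 1] := by
    convert RTLie.leftLRT_hasConstants (1 / 2, 1 / 2) 1 hB using 3 <;> norm_num
  have cB' : (RTLie.leftLRT (1, 0) 1 hB).HasConstants
      !![0, 1; 0, 0] !![0, 0; 1, 0] !![1, 0; 0, 1] := by
    convert RTLie.leftLRT_hasConstants (1, 0) 1 hB using 3 <;> norm_num
  have hnot : ∀ (S T : RTLie.LRT) (MC MD MC' MD' : Matrix (Fin 2) (Fin 2) ℝ),
      S.HasConstants MC MD !![-1, 0; 0, -1] → T.HasConstants MC' MD' !![1, 0; 0, 1] →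
      ¬ S.Isomorphic T ∧ ¬ T.Isomorphic S := fun S T MC MD MC' MD' hS hT =>
    ⟨hS.not_isomorphic (by norm_num) (by rwa [neg_neg]), hT.not_isomorphic one_ne_zero hS⟩
  refine ⟨⟨RTLie.stdRT (-1) hKK, RTLie.stdRT_isKostantKoszul hKK,
      fun K hK => hK.eq (RTLie.stdRT_isKostantKoszul hKK)⟩,
    ⟨RTLie.stdRT 1 hB, RTLie.stdRT_isBerezin hB, fun B h => h.eq_stdRT hB⟩,
    fun K B hK hB' => ?_, ⟨_, RTLie.leftLRT_planed _ _ _, cB'⟩, fun S T hS hT => ?_,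
    fun S T h => h.planed_iff⟩
  · obtain rfl := hK.eq (RTLie.stdRT_isKostantKoszul hKK)
    obtain rfl := hB'.eq_stdRT hB
    obtain ⟨h1, h2⟩ := hnot _ _ _ _ _ _ cKK cB
    exact ⟨RTLie.leftLRT_planed _ _ _, RTLie.leftLRT_planed _ _ _, cKK, cB, h1, h2,
      fun ⟨m, hm, heq, _⟩ => h1 ⟨m, hm, heq⟩, fun ⟨m, hm, heq, _⟩ => h2 ⟨m, hm, heq⟩⟩
  · rcases hT with hT | hT
    · exact hnot _ _ _ _ _ _ hS hT
    · exact hnot _ _ _ _ _ _ hS hT
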